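/- All graphs are finite and simple. Let $L$ be a cycle in a graph $G$. An \emph{$L$-bridge} is either (i) an edge of $E(G)\setminus E(L)$ with both endpoints in $V(L)$ (together with its endpoints), or (ii) a component $D$ of $G-V(L)$ together with all edges between $V(D)$ and $V(L)$ and their endpoints. The \emph{attachments} of an $L$-bridge $B$ are the vertices of $V(L)\cap V(B)$. Two $L$-bridges $B_1,B_2$ \emph{overlap} if $L$ cannot be partitioned into two (edge-disjoint) subpaths $L_1,L_2$ such that all attachments of $B_i$ lie on $L_i$ for $i=1,2$. The \emph{overlap graph} $O_G(L)$ has the $L$-bridges as its vertices, two distinct bridges being adjacent if and only if they overlap. Fix a direction of traversal of $L$ and write $v^+$ and $v^-$ for the successor and the predecessor of a vertex $v$ on $L$. A \emph{dicycle} of $G$ is a cycle of $G$ directed in one of its two directions of traversal. For $a\in V(L)$ and $ij\in\mathbb{Z}_2^2$, a dicycle $\vec C$ is \emph{of type $ij$ with respect to $a$} if there is an edge $ab\in E(G)\setminus E(L)$ such that $\vec C$ contains the arcs $(b,a)$ and $(a,a^+)$ if $ij=00$; $(a,b)$ and $(a^+,a)$ if $ij=01$; $(b,a)$ and $(a,a^-)$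 if $ij=10$; $(a,b)$ and $(a^-,a)$ if $ij=11$. \textbf{Theorem.} Let $L$ be a cycle in a $2$-connected graph $G$ and let $T_1,\dots,T_s$ be all the $L$-bridges of $G$. Suppose that they are pairwise vertex-disjoint, that each $T_i$ is a tree, and that $O_G(L)$ is a tree (in particular $s\ge 1$). Then there is a set $\mathcal C$ of dicycles of $G$ such that the following hold. (C1) Every edge of $L$ lies in exactly two dicycles of $\mathcal C$, and every edge of $E(G)\setminus E(L)$ lies in at least four dicycles of $\mathcal C$. (C2) For every dicycle in $\mathcal C$ with underlying cycle $C$, the symmetric difference $L\triangle C$ (the subgraph of $G$ induced by the edge set $E(L)\triangle E(C)$) is a cycle. (C3) Every dicycle in $\mathcal C$ contains either no or exactly two attachments of each $L$-bridge. (C4) For every $ij\in\mathbb{Z}_2^2$ and every vertex $x$ that is an attachment of some $L$-bridge, there is exactly one dicycle in $\mathcal C$ that is of type $ij$ with respect to $x$. -/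

import Mathlib

namespace VossBridges

/-- A graph is 2-connected: it has at least three vertices, is connected, and stays connected
when any single vertex is deleted. -/
def IsTwoConnected {V : Type*} (G : SimpleGraph V) : Prop :=
  3 ≤ ENat.card V ∧ G.Connected ∧ ∀ v : V, (G.induce {w | w ≠ v}).Connected

/-- The subgraph of `G` formed by a vertex set `D` disjoint from `H`, all edges of `G` inside `D`,
and all edges of `G` between `D` and `V(H)` together with their endpoints. -/
def attachedSubgraph {V : Type*} {G : SimpleGraph V} (H : G.Subgraph) (D : Set V) :
    G.Subgraph where
  verts := D ∪ {x | x ∈ H.verts ∧ ∃ y ∈ D, G.Adj x y}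
  Adj a b := G.Adj a b ∧
    ((a ∈ D ∧ b ∈ D) ∨ (a ∈ D ∧ b ∈ H.verts) ∨ (a ∈ H.verts ∧ b ∈ D))
  adj_sub h := h.1
  edge_vert := by
    rintro a b ⟨hab, h | h | h⟩
    · exact Or.inl h.1
    · exact Or.inl h.1
    · exact Or.inr ⟨h.1, b, h.2, hab⟩
  symm := ⟨by
    rintro a b ⟨hab, h⟩
    exact ⟨hab.symm, by tauto⟩⟩

/-- `B` is an `H`-bridge of `G`: either an edge of `G` outside `H` with both endpoints in `V(H)`,
or a component of `G - V(H)` together with all edges between it and `V(H)`. -/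
def IsBridge {V : Type*} {G : SimpleGraph V} (H B : G.Subgraph) : Prop :=
  (∃ (x y : V) (hxy : G.Adj x y),
      x ∈ H.verts ∧ y ∈ H.verts ∧ ¬ H.Adj x y ∧ B = G.subgraphOfAdj hxy) ∨
  (∃ K : (G.induce H.vertsᶜ).ConnectedComponent,
      B = attachedSubgraph H (Subtype.val '' K.supp))

/-- The type of all `H`-bridges of `G`. -/
abbrev Bridge {V : Type*} {G : SimpleGraph V} (H : G.Subgraph) : Type _ :=
  {B : G.Subgraph // IsBridge H B}

/-- The attachments of an `H`-bridge `B`: the common vertices of `H` and `B`. -/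
def attachments {V : Type*} {G : SimpleGraph V} (H B : G.Subgraph) : Set V :=
  H.verts ∩ B.verts

/-- The cycle `L` can be partitioned into two subpaths (edge-disjoint, with union `L`), the first
of which contains all attachments of `B₁` and the second all attachments of `B₂`. -/
def Avoid {V : Type*} {G : SimpleGraph V} {u : V} (L : G.Walk u u) (B₁ B₂ : G.Subgraph) : Prop :=
  ∃ (x y : V) (P Q : G.Walk x y), P.IsPath ∧ Q.IsPath ∧
    Disjoint P.edgeSet Q.edgeSet ∧ P.toSubgraph ⊔ Q.toSubgraph = L.toSubgraph ∧
    attachments L.toSubgraph B₁ ⊆ {v | v ∈ P.support} ∧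
    attachments L.toSubgraph B₂ ⊆ {v | v ∈ Q.support}

theorem Avoid.symm {V : Type*} {G : SimpleGraph V} {u : V} {L : G.Walk u u}
    {B₁ B₂ : G.Subgraph} (h : Avoid L B₁ B₂) : Avoid L B₂ B₁ := by
  obtain ⟨x, y, P, Q, hP, hQ, hd, hs, h1, h2⟩ := h
  exact ⟨x, y, Q, P, hQ, hP, hd.symm, by rw [sup_comm]; exact hs, h2, h1⟩

/-- The overlap graph of `G` with respect to the cycle `L`: its vertices are the `L`-bridges, and
two distinct bridges are adjacent if and only if they overlap. -/
def overlapGraph {V : Type*} {G : SimpleGraph V} {u : V} (L : G.Walk u u) :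
    SimpleGraph (Bridge L.toSubgraph) where
  Adj B₁ B₂ := B₁ ≠ B₂ ∧ ¬ Avoid L B₁.1 B₂.1
  symm := ⟨fun _ _ h => ⟨h.1.symm, fun h' => h.2 h'.symm⟩⟩
  loopless := ⟨fun _ h => h.1 rfl⟩

/-- A dicycle of `G`: the set of arcs obtained by traversing a cycle of `G` in one of its two
directions (so a dicycle has no distinguished starting vertex). -/
@[ext]
structure Dicycle {V : Type*} (G : SimpleGraph V) where
  /-- the arcs of the dicycle -/
  arcs : Set G.Dart
  isDicycle : ∃ (u : V) (c : G.Walk u u), c.IsCycle ∧ arcs = {d | d ∈ c.darts}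

/-- The vertices of a dicycle. -/
def Dicycle.verts {V : Type*} {G : SimpleGraph V} (C : Dicycle G) : Set V :=
  {v | ∃ d ∈ C.arcs, d.fst = v}

/-- The edges of the underlying (undirected) cycle of a dicycle. -/
def Dicycle.edgeSet {V : Type*} {G : SimpleGraph V} (C : Dicycle G) : Set (Sym2 V) :=
  {e | ∃ d ∈ C.arcs, d.edge = e}

/-- A set of edges is the edge set of a cycle of `G`. -/
def IsCycleEdgeSet {V : Type*} (G : SimpleGraph V) (S : Set (Sym2 V)) : Prop :=
  ∃ (w : V) (c : G.Walk w w), c.IsCycle ∧ c.edgeSet = S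

/-- The dicycle `C` is of type `ij` with respect to the vertex `a` of the cycle `L`, which is
oriented by its direction of traversal. Here `d` is the arc from `a` to `b` along an edge `ab`
outside `L`, and `f` is the arc from `a` to `a⁺` (if `i = 0`) or to `a⁻` (if `i = 1`). For `j = 0`
the dicycle enters `a` from `b` and leaves along `L`; for `j = 1` it enters `a` along `L` and
leaves to `b`. -/
def Dicycle.IsOfType {V : Type*} {G : SimpleGraph V} (C : Dicycle G) {u : V} (L : G.Walk u u)
    (a : V) (i j : ZMod 2) : Prop :=
  ∃ d f : G.Dart, d.fst = a ∧ d.edge ∉ L.edgeSet ∧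
    f.fst = a ∧ (if i = 0 then f ∈ L.darts else f.symm ∈ L.darts) ∧
    (if j = 0 then d.symm ∈ C.arcs ∧ f ∈ C.arcs else d ∈ C.arcs ∧ f.symm ∈ C.arcs)

end VossBridges

open VossBridges

open VossBridges

/-! The family uses every edge of `L` once in each direction. A dicycle runs along `L` to an
attachment, crosses the bridge there by a path of the tree to another attachment, and leaves that
one along `L`. The whole family is therefore encoded by labels on the arcs of `L` and on their
reverses, the label being the name of a dicycle. Since the bridges are disjoint trees, all that
matters is the cyclic word that records for each vertex of `L` the bridge attached there, if any.
Two bridges overlap exactly when their letters alternate as `a b a b` in this word. The theorem thus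
reduces to a statement on words: if every letter occurs at least twice and the crossing graph of the
letters is a tree (`IsTreeWord`), then the cyclic word has a `GoodLabelling`.

That statement is proved by induction on the length (`IsTreeWord.hasGoodLabelling`). A descent
through leaves of the crossing graph (`IsTreeWord.reducible`) finds, up to rotation, one of the
factors `p p`, `q p q` with no other `q`, or `q p q p q`. Unless they lead to the base case or to
another rotation, these are shortened to `p`, `p` and `q p q`, which leaves a tree word, and a
labelling of the shorter word is lifted back. Undoing `p p` adds two dicycles, each made of the arc
between the twins and a chord (`insert_same`). Undoing `q p q` adds none: the four dicycles at `p`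
change sides through the new bridge (`insert_around`). Undoing `q p q p q` adds two dicycles with
two arcs and two chords each (`insert_alternating`). The base case `p p` has four dicycles of one
arc each.

The induction carries four further properties. `conn` and `coconn` say that a dicycle, and its
symmetric difference with `L`, is connected, hence a single cycle; the latter is (C2). `cutLabel`
says that across any cut of the occurrences of a letter at least two labels lead in each direction,
which gives the four dicycles through every edge off `L`. `cutPosition` serves to carry `cutLabel`
through the doubling of a position. The remaining claims are read off the labels: (C1) on `L` since
the two directions of an edge have different labels, (C3) since a label has at most one chord in
each bridge, (C4) since a type at an attachment prescribes one arc of `L`, which has one label. -/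

/-! ### Labellings of cyclic words -/

/-- A labelling of the arcs of a cyclic word by dicycles. The cyclic word has the positions `W`, the
successor relation `N` and the letters `l` (positions without a letter are passed straight through).
`fa u false` and `fa u true` are the labels of the dicycles that arrive at `u` along the cycle in
the forward and in the backward direction, `fd u true` and `fd u false` those of the dicycles that
depart from `u` in the forward and in the backward direction. -/
structure ArcLabelling {A B K : Type*} (l : A → Option B) (W : Set A) (N : A → A → Prop)
    (fa fd : A → Bool → K) : Prop where
  fwd : ∀ u v, N u v → fd u true = fa v false
  bwd : ∀ u v, N u v → fd v false = fa u true
  pass : ∀ u ∈ W, l u = none → ∀ b, fa u b = fd u (!b)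
  -- `fa u b` and `fd u b` belong to the two directions of one edge of the cycle: the edge before
  -- `u` for `b = false`, the edge after `u` for `b = true`.
  ne : ∀ u ∈ W, ∀ b, fa u b ≠ fd u b
  -- At a position with a letter no dicycle continues along the cycle. The remaining fields match
  -- the arrivals and departures of each letter by label, so that a label has at most one chord in a
  -- bridge.
  sep : ∀ u ∈ W, ∀ t, l u = some t → ∀ b c, fa u b ≠ fd u c
  inja : ∀ u ∈ W, ∀ v ∈ W, ∀ t, l u = some t → l v = some t → ∀ b c, fa u b = fa v c → u = v ∧ b = c
  injd : ∀ u ∈ W, ∀ v ∈ W, ∀ t, l u = some t → l v = some t → ∀ b c, fd u b = fd v c → u = v ∧ b = c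
  exd : ∀ u ∈ W, ∀ t, l u = some t → ∀ b, ∃ v ∈ W, l v = some t ∧ ∃ c, fd v c = fa u b
  exa : ∀ u ∈ W, ∀ t, l u = some t → ∀ b, ∃ v ∈ W, l v = some t ∧ ∃ c, fa v c = fd u b

/-- Every colouring of the positions that is constant along the chords with label `k` and along the
arcs satisfying `P` is constant on the ends of the arcs satisfying `P`. -/
def LinksArcs {A B K : Type*} (l : A → Option B) (W : Set A) (N : A → A → Prop)
    (fa fd : A → Bool → K) (k : K) (P : A → A → Prop) : Prop :=
  ∀ s : A → Bool, (∀ u v, N u v → P u v → s u = s v) →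
    (∀ u ∈ W, ∀ v ∈ W, ∀ t b c, l u = some t → l v = some t → fa u b = k → fd v c = k → s u = s v) →
    ∀ u v u' v', N u v → P u v → N u' v' → P u' v' → s u = s u'

/-- The chords of each letter stay connected when one label is removed. -/
def CutLabel {A B K : Type*} (l : A → Option B) (W : Set A) (fa fd : A → Bool → K) : Prop :=
  ∀ (t : B) (k : K) (s : A → Bool),
    -- The implication is one-sided, so strong connectivity of the digraph of chords is meant:
    -- across any cut, chords with at least two different labels lead in each direction.
    (∀ u ∈ W, ∀ v ∈ W, l u = some t → l v = some t → ∀ b c, fa u b = fd v c → fa u b ≠ k →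
      s u = true → s v = true) →
    ∀ u ∈ W, ∀ v ∈ W, l u = some t → l v = some t → s u = s v

/-- The chords of each letter stay connected when the two sides of one position are separated. -/
def CutPosition {A B K : Type*} (l : A → Option B) (W : Set A) (fa fd : A → Bool → K) : Prop :=
  ∀ (t : B) (p : A) (s : A → Bool → Bool),
    -- Here `s` colours pairs of a position and a side; the arrival `fa u b` and the departure `fd u
    -- b` are on side `b`. When `p` is doubled, its two sides go to different positions.
    (∀ u ∈ W, l u = some t → u ≠ p → s u true = s u false) →
    (∀ u ∈ W, ∀ v ∈ W, l u = some t → l v = some t → ∀ b c, fa u b = fd v c →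
      s u b = true → s v c = true) →
    ∀ u ∈ W, ∀ v ∈ W, l u = some t → l v = some t → ∀ b c, s u b = s v c

/-- The arc from `u` to `v` is traversed in one of its directions by the dicycle with label `k`. -/
def OnLabel {A K : Type*} (fa : A → Bool → K) (k : K) (u v : A) : Prop :=
  fa v false = k ∨ fa u true = k

/-- A labelling of the arcs of a cyclic word in which the arcs and chords of every dicycle form a
connected set, and so do those of its symmetric difference with the cycle. -/
structure GoodLabelling {A B K : Type*} (l : A → Option B) (W : Set A) (N : A → A → Prop)
    (fa fd : A → Bool → K) : Prop extends ArcLabelling l W N fa fd where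
  conn : ∀ k, LinksArcs l W N fa fd k (OnLabel fa k)
  coconn : ∀ u ∈ W, ∀ b, LinksArcs l W N fa fd (fa u b) (fun x y => ¬ OnLabel fa (fa u b) x y)
  cutLabel : CutLabel l W fa fd
  cutPosition : CutPosition l W fa fd

/-- A colouring compatible with the new word is turned into one compatible with the old word, where
it is constant; every colour on the new arcs already occurs on an old arc. -/
theorem LinksArcs.transfer {A B K A' B' K' : Type*} {l : A → Option B} {W : Set A}
    {N : A → A → Prop} {fa fd : A → Bool → K} {k : K} {P : A → A → Prop}
    {l' : A' → Option B'} {W' : Set A'} {N' : A' → A' → Prop} {fa' fd' : A' → Bool → K'} {k' : K'}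
    {P' : A' → A' → Prop} (h : LinksArcs l W N fa fd k P)
    (H : ∀ s' : A' → Bool, (∀ u v, N' u v → P' u v → s' u = s' v) →
      (∀ u ∈ W', ∀ v ∈ W', ∀ t b c, l' u = some t → l' v = some t →
        fa' u b = k' → fd' v c = k' → s' u = s' v) →
      ∃ s : A → Bool, (∀ u v, N u v → P u v → s u = s v) ∧
        (∀ u ∈ W, ∀ v ∈ W, ∀ t b c, l u = some t → l v = some t →
          fa u b = k → fd v c = k → s u = s v) ∧
        ∀ u v, N' u v → P' u v → ∃ u₁ v₁, N u₁ v₁ ∧ P u₁ v₁ ∧ (s' u = s u₁ ∨ s' u = s v₁)) :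
    LinksArcs l' W' N' fa' fd' k' P' := by
  intro s' h1 h2 u v u' v' huv hp huv' hp'
  obtain ⟨s, ha, hb, hc⟩ := H s' h1 h2
  obtain ⟨a, b, hab, hpab, e1⟩ := hc u v huv hp
  obtain ⟨a', b', hab', hpab', e2⟩ := hc u' v' huv' hp'
  have f1 := ha a b hab hpab
  have f2 := ha a' b' hab' hpab'
  have f3 := h s ha hb a b a' b' hab hpab hab' hpab'
  have g1 : s' u = s a := e1.elim id fun e => e.trans f1.symm
  have g2 : s' u' = s a' := e2.elim id fun e => e.trans f2.symm
  rw [g1, g2, f3]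

/-! ### Insertions that preserve good labellings -/

/-- Insertion of a position without a letter. -/
theorem GoodLabelling.insert_none {A B K : Type*} {l : A → Option B} {W : Set A}
    {N N' I : A → A → Prop} {fa fd : A → Bool → K} (h : GoodLabelling l W N fa fd)
    {x y z : A} (hI : ∀ u v, I u v → u ∈ W ∧ v ∈ W) (hx : x ∈ W) (hy : y ∈ W) (hz : z ∉ W)
    (hN : ∀ u v, N u v ↔ I u v ∨ (u = x ∧ v = y))
    (hN' : ∀ u v, N' u v ↔ I u v ∨ (u = x ∧ v = z) ∨ (u = z ∧ v = y))
    (hl : l z = none) :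
    ∃ fa' fd' : A → Bool → K, GoodLabelling l (insert z W) N' fa' fd' := by
  classical
  have hxy : N x y := (hN x y).2 (Or.inr ⟨rfl, rfl⟩)
  have h1 := h.fwd _ _ hxy
  have h2 := h.bwd _ _ hxy
  -- Both directions of the subdivided arc keep their labels, `fa y false` forward and `fa x true`
  -- backward.
  obtain ⟨fa', hfa1, hfa2, hfa3⟩ : ∃ f : A → Bool → K, f z false = fa y false ∧
      f z true = fa x true ∧ ∀ u ∈ W, ∀ b, f u b = fa u b :=
    ⟨fun u b => if u = z then (if b then fa x true else fa y false) else fa u b, by simp, by simp,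
      fun u hu b => by simp [show u ≠ z from fun h => hz (h ▸ hu)]⟩
  obtain ⟨fd', hfd1, hfd2, hfd3⟩ : ∃ f : A → Bool → K, f z true = fa y false ∧
      f z false = fa x true ∧ ∀ u ∈ W, ∀ b, f u b = fd u b :=
    ⟨fun u b => if u = z then (if b then fa y false else fa x true) else fd u b, by simp, by simp,
      fun u hu b => by simp [show u ≠ z from fun h => hz (h ▸ hu)]⟩
  have hne : fa y false ≠ fa x true := by
    have := h.ne _ hy false
    rwa [h2] at this
  refine ⟨fa', fd', ⟨⟨?_, ?_, ?_, ?_, ?_, ?_, ?_, ?_, ?_⟩, ?_, ?_, ?_, ?_⟩⟩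
  · intro u v huv
    have := h.fwd u v
    grind -ring -linarith -lia -order -ac
  · intro u v huv
    have := h.bwd u v
    grind -ring -linarith -lia -order -ac
  · intro u hu hlu b
    have := h.pass u
    cases b <;> grind -ring -linarith -lia -order -ac
  · intro u hu b
    have := h.ne u
    cases b <;> grind -ring -linarith -lia -order -ac
  · intro u hu b
    have := h.sep u
    grind -ring -linarith -lia -order -ac
  · intro u hu v hv
    have := h.inja u
    grind -ring -linarith -lia -order -ac
  · intro u hu v hv
    have := h.injd u
    grind -ring -linarith -lia -order -ac
  · intro u hu t ht b
    have hu' : u ∈ W := by grind -ring -linarith -lia -order -ac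
    obtain ⟨v, hv, hvt, c, hc⟩ := h.exd u hu' t ht b
    exact ⟨v, Or.inr hv, hvt, c, by grind -ring -linarith -lia -order -ac⟩
  · intro u hu t ht b
    have hu' : u ∈ W := by grind -ring -linarith -lia -order -ac
    obtain ⟨v, hv, hvt, c, hc⟩ := h.exa u hu' t ht b
    exact ⟨v, Or.inr hv, hvt, c, by grind -ring -linarith -lia -order -ac⟩
  · intro k
    refine (h.conn k).transfer fun s h1 h2 => ⟨s, ?_, ?_, ?_⟩
    · intro u v huv hp
      simp only [OnLabel] at *
      have a1 := h1 u v
      have a2 := h1 x z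
      have a3 := h1 z y
      grind -ring -linarith -lia -order -ac
    · intro u hu v hv t b c
      have := h2 u (Or.inr hu) v (Or.inr hv) t b c
      grind -ring -linarith -lia -order -ac
    · intro u v huv hp
      simp only [OnLabel] at *
      rcases (hN' u v).1 huv with h3 | ⟨rfl, rfl⟩ | ⟨rfl, rfl⟩
      · exact ⟨u, v, by grind -ring -linarith -lia -order -ac⟩
      · exact ⟨u, y, by grind -ring -linarith -lia -order -ac⟩
      · exact ⟨x, v, by grind -ring -linarith -lia -order -ac⟩
  · intro w hw b
    obtain ⟨w', hw', b', hb'⟩ : ∃ w' ∈ W, ∃ b', fa' w b = fa w' b' := by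
      rcases hw with rfl | hw
      · cases b
        · exact ⟨y, hy, false, hfa1⟩
        · exact ⟨x, hx, true, hfa2⟩
      · exact ⟨w, hw, b, hfa3 w hw b⟩
    rw [hb']
    generalize hk : fa w' b' = k
    have hco := h.coconn w' hw' b'
    rw [hk] at hco
    refine hco.transfer fun s h1 h2 => ⟨s, ?_, ?_, ?_⟩
    · intro u v huv hp
      simp only [OnLabel] at *
      have a1 := h1 u v
      have a2 := h1 x z
      have a3 := h1 z y
      grind -ring -linarith -lia -order -ac
    · intro u hu v hv t b c
      have := h2 u (Or.inr hu) v (Or.inr hv) t b c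
      grind -ring -linarith -lia -order -ac
    · intro u v huv hp
      simp only [OnLabel] at *
      rcases (hN' u v).1 huv with h3 | ⟨rfl, rfl⟩ | ⟨rfl, rfl⟩
      · exact ⟨u, v, by grind -ring -linarith -lia -order -ac⟩
      · exact ⟨u, y, by grind -ring -linarith -lia -order -ac⟩
      · exact ⟨x, v, by grind -ring -linarith -lia -order -ac⟩
  · intro t k s hs u hu v hv
    have := h.cutLabel t k s (fun u hu v hv => by
      have := hs u (Or.inr hu) v (Or.inr hv)
      grind -ring -linarith -lia -order -ac) u
    grind -ring -linarith -lia -order -ac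
  · intro t p s hs1 hs2 u hu v hv
    have := h.cutPosition t p s (fun u hu => hs1 u (Or.inr hu)) (fun u hu v hv => by
      have := hs2 u (Or.inr hu) v (Or.inr hv)
      grind -ring -linarith -lia -order -ac) u
    grind -ring -linarith -lia -order -ac

set_option maxHeartbeats 2000000 in
/-- Doubling of a position `p`: a position `q` with the same letter is inserted after `p`. -/
theorem GoodLabelling.insert_same {A B K : Type*} {l : A → Option B} {W : Set A}
    {N N' I : A → A → Prop} {fa fd : A → Bool → K} (h : GoodLabelling l W N fa fd)
    {p x y q : A} (hI : ∀ u v, I u v → u ∈ W ∧ v ∈ W ∧ u ≠ p) (hp : p ∈ W) (hy : y ∈ W) (hq : q ∉ W)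
    (hyp : y ≠ p) (hxp : I x p)
    (hN : ∀ u v, N u v ↔ I u v ∨ (u = p ∧ v = y))
    (hN' : ∀ u v, N' u v ↔ I u v ∨ (u = p ∧ v = q) ∨ (u = q ∧ v = y))
    (hcyc : ∀ s : A → Bool, (∀ u v, N u v → s u = s v) → ∀ u ∈ W, ∀ v ∈ W, s u = s v)
    {t₀ : B} (hlp : l p = some t₀) (hlq : l q = some t₀) :
    ∃ fa' fd' : A → Bool → K ⊕ Bool, GoodLabelling l (insert q W) N' fa' fd' := by
  classical
  have hpy : N p y := (hN p y).2 (Or.inr ⟨rfl, rfl⟩)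
  have h1 := h.fwd _ _ hpy
  have h2 := h.bwd _ _ hpy
  have hqp : q ≠ p := fun e => hq (e ▸ hp)
  have hqW : ∀ u ∈ W, u ≠ q := fun u hu e => hq (e ▸ hu)
  -- The arc from `p` to `q` gets the new label `.inr true`, its reverse `.inr false`; each new
  -- dicycle is closed by a chord between `p` and `q`. Old labels stay at `p` on its left side and
  -- move to `q` on its right side.
  obtain ⟨fa', a1, a2, a3, a4, a5⟩ : ∃ f : A → Bool → K ⊕ Bool, f q false = .inr true ∧
      f q true = .inl (fa p true) ∧ f p true = .inr false ∧ f p false = .inl (fa p false) ∧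
      ∀ u ∈ W, u ≠ p → ∀ b, f u b = .inl (fa u b) :=
    ⟨fun u b => if u = q then (if b then .inl (fa p true) else .inr true) else
      if u = p then (if b then .inr false else .inl (fa p false)) else .inl (fa u b),
      by simp, by simp, by simp [hqp.symm], by simp [hqp.symm],
      fun u hu hup b => by simp [hqW u hu, hup]⟩
  obtain ⟨fd', d1, d2, d3, d4, d5⟩ : ∃ f : A → Bool → K ⊕ Bool, f q false = .inr false ∧
      f q true = .inl (fd p true) ∧ f p true = .inr true ∧ f p false = .inl (fd p false) ∧
      ∀ u ∈ W, u ≠ p → ∀ b, f u b = .inl (fd u b) :=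
    ⟨fun u b => if u = q then (if b then .inl (fd p true) else .inr false) else
      if u = p then (if b then .inr true else .inl (fd p false)) else .inl (fd u b),
      by simp, by simp, by simp [hqp.symm], by simp [hqp.symm],
      fun u hu hup b => by simp [hqW u hu, hup]⟩
  have hsep := h.sep p hp t₀ hlp
  have na : fa p true ≠ fa p false := fun e => by
    simpa using (h.inja p hp p hp t₀ hlp hlp _ _ e).2
  have nd : fd p true ≠ fd p false := fun e => by
    simpa using (h.injd p hp p hp t₀ hlp hlp _ _ e).2
  refine ⟨fa', fd', ⟨⟨?_, ?_, ?_, ?_, ?_, ?_, ?_, ?_, ?_⟩, ?_, ?_, ?_, ?_⟩⟩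
  · intro u v huv
    have := h.fwd u v
    have := hI u v
    by_cases hv : v = p <;> grind -ring -linarith -lia -order -ac
  · intro u v huv
    have := h.bwd u v
    have := hI u v
    by_cases hv : v = p <;> grind -ring -linarith -lia -order -ac
  · intro u hu hlu b
    have := h.pass u
    by_cases hv : u = p <;> grind -ring -linarith -lia -order -ac
  · intro u hu b
    have := h.ne u
    by_cases hv : u = p <;> cases b <;> grind -ring -linarith -lia -order -ac
  · intro u hu t ht b c
    have := h.sep u
    by_cases hv : u = p <;> cases b <;> cases c <;> grind -ring -linarith -lia -order -ac
  · intro u hu v hv t htu htv b c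
    have := h.inja u
    have := h.inja p hp v
    have := h.inja p hp p hp
    by_cases hu' : u = p <;> by_cases hv' : v = p <;> cases b <;> cases c <;> grind -ring -linarith -lia -order -ac
  · intro u hu v hv t htu htv b c
    have := h.injd u
    have := h.injd p hp v
    have := h.injd p hp p hp
    by_cases hu' : u = p <;> by_cases hv' : v = p <;> cases b <;> cases c <;> grind -ring -linarith -lia -order -ac
  · have key : ∀ u ∈ W, ∀ t, l u = some t → ∀ b, ∃ v ∈ insert q W, l v = some t ∧
        ∃ c, fd' v c = .inl (fa u b) := by
      intro u hu t ht b
      obtain ⟨v, hv, hvt, c, hc⟩ := h.exd u hu t ht b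
      by_cases hvp : v = p
      · subst hvp
        cases c
        · exact ⟨v, Or.inr hv, hvt, false, by grind -ring -linarith -lia -order -ac⟩
        · exact ⟨q, Or.inl rfl, by grind -ring -linarith -lia -order -ac, true, by grind⟩
      · exact ⟨v, Or.inr hv, hvt, c, by grind -ring -linarith -lia -order -ac⟩
    intro u hu t ht b
    rcases hu with rfl | hu
    · cases b
      · exact ⟨p, Or.inr hp, by grind -ring -linarith -lia -order -ac, true, by grind⟩
      · rw [a2]; exact key p hp t (by grind -ring -linarith -lia -order -ac) true
    · by_cases hup : u = p
      · subst hup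
        cases b
        · rw [a4]; exact key u hp t ht false
        · exact ⟨q, Or.inl rfl, by grind -ring -linarith -lia -order -ac, false, by grind⟩
      · rw [a5 u hu hup]; exact key u hu t ht b
  · have key : ∀ u ∈ W, ∀ t, l u = some t → ∀ b, ∃ v ∈ insert q W, l v = some t ∧
        ∃ c, fa' v c = .inl (fd u b) := by
      intro u hu t ht b
      obtain ⟨v, hv, hvt, c, hc⟩ := h.exa u hu t ht b
      by_cases hvp : v = p
      · subst hvp
        cases c
        · exact ⟨v, Or.inr hv, hvt, false, by grind -ring -linarith -lia -order -ac⟩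
        · exact ⟨q, Or.inl rfl, by grind -ring -linarith -lia -order -ac, true, by grind⟩
      · exact ⟨v, Or.inr hv, hvt, c, by grind -ring -linarith -lia -order -ac⟩
    intro u hu t ht b
    rcases hu with rfl | hu
    · cases b
      · exact ⟨p, Or.inr hp, by grind -ring -linarith -lia -order -ac, true, by grind⟩
      · rw [d2]; exact key p hp t (by grind -ring -linarith -lia -order -ac) true
    · by_cases hup : u = p
      · subst hup
        cases b
        · rw [d4]; exact key u hp t ht false
        · exact ⟨q, Or.inl rfl, by grind -ring -linarith -lia -order -ac, false, by grind⟩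
      · rw [d5 u hu hup]; exact key u hu t ht b
  · intro k
    rcases k with k | k
    -- An old dicycle uses at most one side of the old `p`. If that is the right side, it now passes
    -- through `q`, so `p` takes the colour of `q`.
    · refine (h.conn k).transfer fun s h1 h2 =>
        ⟨fun u => if u = p ∧ (fa p true = k ∨ fd p true = k) then s q else s u, ?_, ?_, ?_⟩
      · intro u v huv hpk
        simp only [OnLabel] at *
        have b1 := h1 u v
        have b2 := h1 q y
        have := hI u v
        have := h.fwd u v
        have := h.bwd u v
        have := hsep true true
        have := hsep true false
        have := hsep false true
        have := hsep false false
        by_cases hv' : v = p <;> grind -ring -linarith -lia -order -ac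
      · intro u hu v hv t b c htu htv hb hc
        have e1 := h2 u (Or.inr hu) v (Or.inr hv) t
        have e2 := h2 u (Or.inr hu) q (Or.inl rfl) t
        have e3 := h2 q (Or.inl rfl) v (Or.inr hv) t
        have := hsep
        have := h.inja p hp p hp
        have := h.injd p hp p hp
        by_cases hu' : u = p <;> by_cases hv' : v = p <;> cases b <;> cases c <;> grind -ring -linarith -lia -order -ac
      · intro u v huv hpk
        simp only [OnLabel] at *
        rcases (hN' u v).1 huv with h3 | ⟨rfl, rfl⟩ | ⟨rfl, rfl⟩
        · have := hI u v h3
          refine ⟨u, v, by grind -ring -linarith -lia -order -ac, ?_, by grind⟩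
          by_cases hv' : v = p <;> grind -ring -linarith -lia -order -ac
        · grind -ring -linarith -lia -order -ac
        · exact ⟨p, v, by grind -ring -linarith -lia -order -ac, by grind, by grind⟩
    · intro s h1 h2 u v u' v' huv hp1 huv' hp2
      have : ∀ u v, N' u v → OnLabel fa' (.inr k) u v → u = p := by
        intro u v huv ho
        simp only [OnLabel] at ho
        rcases (hN' u v).1 huv with h3 | ⟨rfl, rfl⟩ | ⟨rfl, rfl⟩
        · have := hI u v h3
          by_cases hv' : v = p <;> grind -ring -linarith -lia -order -ac
        · rfl
        · grind -ring -linarith -lia -order -ac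
      rw [this u v huv hp1, this u' v' huv' hp2]
  · intro w hw b
    obtain ⟨w', hw', b', hb'⟩ | ⟨b', hb'⟩ : (∃ w' ∈ W, ∃ b', fa' w b = .inl (fa w' b')) ∨
        ∃ b', fa' w b = .inr b' := by
      rcases hw with rfl | hw
      · cases b
        · exact Or.inr ⟨_, a1⟩
        · exact Or.inl ⟨p, hp, true, a2⟩
      · by_cases hwp : w = p
        · subst hwp
          cases b
          · exact Or.inl ⟨w, hp, false, a4⟩
          · exact Or.inr ⟨_, a3⟩
        · exact Or.inl ⟨w, hw, b, a5 w hw hwp b⟩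
    · rw [hb']
      generalize hk : fa w' b' = k
      have hco := h.coconn w' hw' b'
      rw [hk] at hco
      refine hco.transfer fun s g1 g2 => ?_
      -- Old dicycles avoid the arc from `p` to `q`, so this arc joins `p` and `q` in the
      -- complement.
      have hs : s p = s q := g1 p q (by grind -ring -linarith -lia -order -ac) (by simp only [OnLabel]; grind)
      refine ⟨s, ?_, ?_, ?_⟩
      · intro u v huv hp
        simp only [OnLabel] at *
        have b1 := g1 u v
        have b3 := g1 q y
        have := hI u v
        by_cases hv' : v = p <;> grind -ring -linarith -lia -order -ac
      · intro u hu v hv t b c htu htv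
        have e1 := g2 u (Or.inr hu) v (Or.inr hv) t
        have e2 := g2 u (Or.inr hu) q (Or.inl rfl) t
        have e3 := g2 q (Or.inl rfl) v (Or.inr hv) t
        by_cases hu' : u = p <;> by_cases hv' : v = p <;> cases b <;> cases c <;> grind -ring -linarith -lia -order -ac
      · intro u v huv hpk
        simp only [OnLabel] at *
        rcases (hN' u v).1 huv with h3 | ⟨rfl, rfl⟩ | ⟨rfl, rfl⟩
        · have := hI u v h3
          by_cases hv' : v = p
          · subst hv'
            exact ⟨u, v, by grind -ring -linarith -lia -order -ac, by grind -ring -linarith -lia -order -ac, .inl rfl⟩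
          · exact ⟨u, v, by grind -ring -linarith -lia -order -ac, by grind -ring -linarith -lia -order -ac, .inl rfl⟩
        -- The arc from `p` to `q` has no old counterpart, but a dicycle uses at most one of the two
        -- old arcs at `p`, so the other one shows the colour of `p`.
        · by_cases hk' : OnLabel fa k u y
          · have hxu : ¬ OnLabel fa k x u := by
              have := h.fwd x u
              have := h.bwd x u
              have := h.inja u hp u hp
              have := h.injd u hp u hp
              simp only [OnLabel] at *
              grind -ring -linarith -lia -order -ac
            have hs' := g1 x u (by grind -ring -linarith -lia -order -ac) (by
              simp only [OnLabel] at *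
              grind -ring -linarith -lia -order -ac)
            exact ⟨x, u, by grind -ring -linarith -lia -order -ac, hxu, .inl hs'.symm⟩
          · exact ⟨u, y, hpy, hk', .inl rfl⟩
        · exact ⟨p, v, by grind -ring -linarith -lia -order -ac, by grind, by grind⟩
    · rw [hb']
      intro s h1 h2 
      -- The symmetric difference of a new dicycle with the cycle replaces the arc from `p` to `q`
      -- by a chord; identifying `p` and `q` gives the old cycle.
      have hs : s p = s q := by
        have := h2 p (Or.inr hp) q (Or.inl rfl) t₀ true false hlp hlq
        have := h2 q (Or.inl rfl) p (Or.inr hp) t₀ false true hlq hlp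
        cases b' <;> grind -ring -linarith -lia -order -ac
      have := hcyc s (fun u v huv => by
        simp only [OnLabel] at *
        have b1 := h1 u v
        have b3 := h1 q y
        have := hI u v
        by_cases hv' : v = p <;> grind -ring -linarith -lia -order -ac)
      intro u v u' v' huv _ huv' _
      have := hI u v
      have := hI u' v'
      grind -ring -linarith -lia -order -ac
  · intro t k s hs u hu v hv htu htv
    rcases k with k | k
    · have hsq : t = t₀ → s p = s q := by
        intro e
        have e1 := hs p (Or.inr hp) q (Or.inl rfl) (e ▸ hlp) (e ▸ hlq) true false (by grind -ring -linarith -lia -order -ac) (by grind)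
        have e2 := hs q (Or.inl rfl) p (Or.inr hp) (e ▸ hlq) (e ▸ hlp) false true (by grind -ring -linarith -lia -order -ac) (by grind)
        exact Bool.eq_iff_iff.2 ⟨e1, e2⟩
      have := h.cutLabel t k s (fun u hu v hv htu htv b c => by
        have e1 := hs u (Or.inr hu) v (Or.inr hv)
        have e2 := hs u (Or.inr hu) q (Or.inl rfl)
        have e3 := hs q (Or.inl rfl) v (Or.inr hv)
        by_cases hu' : u = p <;> by_cases hv' : v = p <;> cases b <;> cases c <;> grind -ring -linarith -lia -order -ac)
      grind -ring -linarith -lia -order -ac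
    -- Removing a new label leaves only one of the two opposite chords between `p` and `q`, so these
    -- can no longer be identified. They act as the two sides of the old `p`.
    · have := h.cutPosition t p (fun u b => if u = p ∧ b = true then s q else s u) (by grind -ring -linarith -lia -order -ac)
        (fun u hu v hv htu htv b c => by
        have e1 := hs u (Or.inr hu) v (Or.inr hv)
        have e2 := hs u (Or.inr hu) q (Or.inl rfl)
        have e3 := hs q (Or.inl rfl) v (Or.inr hv)
        have e4 := hs q (Or.inl rfl) q (Or.inl rfl)
        by_cases hu' : u = p <;> by_cases hv' : v = p <;> cases b <;> cases c <;> grind -ring -linarith -lia -order -ac)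
      have e1 := fun u hu v hv htu htv => this u hu v hv htu htv true true
      have e2 := fun u hu v hv htu htv => this u hu v hv htu htv true false
      have e3 := fun u hu v hv htu htv => this u hu v hv htu htv false true
      have e4 := fun u hu v hv htu htv => this u hu v hv htu htv false false
      by_cases hu' : u = p <;> by_cases hv' : v = p <;> grind -ring -linarith -lia -order -ac
  · intro t p₀ s hs1 hs2 u hu v hv htu htv b c
    have hsq : t = t₀ → s p true = s q false := by
      intro e
      have e1 := hs2 p (Or.inr hp) q (Or.inl rfl) (e ▸ hlp) (e ▸ hlq) true false (by grind -ring -linarith -lia -order -ac)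
      have e2 := hs2 q (Or.inl rfl) p (Or.inr hp) (e ▸ hlq) (e ▸ hlp) false true (by grind -ring -linarith -lia -order -ac)
      exact Bool.eq_iff_iff.2 ⟨e1, e2⟩
    -- The sides of the old `p` are the outer sides of `p` and `q`. The inner sides agree by `hsq`,
    -- so the old `p` is split only if `p₀` is `p` or `q`.
    have := h.cutPosition t (if p₀ = q then p else p₀)
        (fun u b => if u = p ∧ b = true then s q true else s u b)
        (fun u hu htu hup => by
          have := hs1 u (Or.inr hu)
          have := hs1 q (Or.inl rfl)
          have := hs1 p (Or.inr hp)
          grind -ring -linarith -lia -order -ac)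
        (fun u hu v hv htu htv b c => by
        have e1 := hs2 u (Or.inr hu) v (Or.inr hv)
        have e2 := hs2 u (Or.inr hu) q (Or.inl rfl)
        have e3 := hs2 q (Or.inl rfl) v (Or.inr hv)
        have e4 := hs2 q (Or.inl rfl) q (Or.inl rfl)
        by_cases hu' : u = p <;> by_cases hv' : v = p <;> cases b <;> cases c <;> grind -ring -linarith -lia -order -ac)
    have f1 := fun u hu v hv htu htv => this u hu v hv htu htv true true
    have f2 := fun u hu v hv htu htv => this u hu v hv htu htv true false
    have f3 := fun u hu v hv htu htv => this u hu v hv htu htv false true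
    have f4 := fun u hu v hv htu htv => this u hu v hv htu htv false false
    have g1 := hs1 q (Or.inl rfl)
    have g2 := hs1 p (Or.inr hp)
    by_cases hu' : u = p <;> by_cases hv' : v = p <;> cases b <;> cases c <;> grind -ring -linarith -lia -order -ac

set_option maxHeartbeats 2000000 in
/-- Insertion of two positions with a new letter around a position `p`. -/
theorem GoodLabelling.insert_around {A B K : Type*} {l : A → Option B} {W : Set A}
    {N N' I : A → A → Prop} {fa fd : A → Bool → K} (h : GoodLabelling l W N fa fd)
    {x p y q r : A} (hI : ∀ u v, I u v → u ∈ W ∧ v ∈ W ∧ u ≠ p ∧ v ≠ p)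
    (hp : p ∈ W) (hx : x ∈ W) (hy : y ∈ W) (hxp : x ≠ p) (hyp : y ≠ p)
    (hq : q ∉ W) (hr : r ∉ W) (hqr : q ≠ r)
    (hN : ∀ u v, N u v ↔ I u v ∨ (u = x ∧ v = p) ∨ (u = p ∧ v = y))
    (hN' : ∀ u v, N' u v ↔ I u v ∨ (u = x ∧ v = q) ∨ (u = q ∧ v = p) ∨ (u = p ∧ v = r) ∨
      (u = r ∧ v = y))
    {t₀ t₁ : B} (hlp : l p = some t₀) (hlq : l q = some t₁) (hlr : l r = some t₁)
    (hW : ∀ u ∈ W, l u ≠ some t₁) :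
    ∃ fa' fd' : A → Bool → K, GoodLabelling l (insert q (insert r W)) N' fa' fd' := by
  classical
  have hpy : N p y := (hN p y).2 (Or.inr (Or.inr ⟨rfl, rfl⟩))
  have hxp' : N x p := (hN x p).2 (Or.inr (Or.inl ⟨rfl, rfl⟩))
  have h1 := h.fwd _ _ hpy
  have h2 := h.bwd _ _ hpy
  have h3 := h.fwd _ _ hxp'
  have h4 := h.bwd _ _ hxp'
  have hqp : q ≠ p := fun e => hq (e ▸ hp)
  have hrp : r ≠ p := fun e => hr (e ▸ hp)
  have hqW : ∀ u ∈ W, u ≠ q := fun u hu e => hq (e ▸ hu)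
  have hrW : ∀ u ∈ W, u ≠ r := fun u hu e => hr (e ▸ hu)
  have hqI : q ∈ insert q (insert r W) := Or.inl rfl
  have hrI : r ∈ insert q (insert r W) := Or.inr (Or.inl rfl)
  have hWI : ∀ u ∈ W, u ∈ insert q (insert r W) := fun u hu => Or.inr (Or.inr hu)
  have hsplit : ∀ u, u ∈ insert q (insert r W) → u = q ∨ u = r ∨ u = p ∨ (u ∈ W ∧ u ≠ p) := by
    intro u hu
    rcases hu with hu | hu | hu
    · exact Or.inl hu
    · exact Or.inr (Or.inl hu)
    · tauto
  -- No label is added. Each of the four dicycles at `p` takes a chord between `q` and `r` and so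
  -- meets `p` from the opposite side; everything away from `p` is unchanged.
  obtain ⟨fa', a1, a2, a3, a4, a5, a6, a7⟩ : ∃ f : A → Bool → K, f q false = fa p false ∧
      f q true = fd p true ∧ f r false = fd p false ∧ f r true = fa p true ∧
      f p false = fa p true ∧ f p true = fa p false ∧
      ∀ u ∈ W, u ≠ p → ∀ b, f u b = fa u b :=
    ⟨fun u b => if u = q then (if b then fd p true else fa p false) else
      if u = r then (if b then fa p true else fd p false) else
      if u = p then fa p (!b) else fa u b,
      by simp, by simp, by simp [hqr.symm], by simp [hqr.symm], by simp [hqp.symm, hrp.symm],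
      by simp [hqp.symm, hrp.symm], fun u hu hup b => by simp [hqW u hu, hrW u hu, hup]⟩
  obtain ⟨fd', d1, d2, d3, d4, d5, d6, d7⟩ : ∃ f : A → Bool → K, f q false = fd p false ∧
      f q true = fa p true ∧ f r false = fa p false ∧ f r true = fd p true ∧
      f p false = fd p true ∧ f p true = fd p false ∧
      ∀ u ∈ W, u ≠ p → ∀ b, f u b = fd u b :=
    ⟨fun u b => if u = q then (if b then fa p true else fd p false) else
      if u = r then (if b then fd p true else fa p false) else
      if u = p then fd p (!b) else fd u b,
      by simp, by simp, by simp [hqr.symm], by simp [hqr.symm], by simp [hqp.symm, hrp.symm],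
      by simp [hqp.symm, hrp.symm], fun u hu hup b => by simp [hqW u hu, hrW u hu, hup]⟩
  have s1 := h.sep p hp t₀ hlp true true
  have s2 := h.sep p hp t₀ hlp true false
  have s3 := h.sep p hp t₀ hlp false true
  have s4 := h.sep p hp t₀ hlp false false
  have na : fa p true ≠ fa p false := fun e => by
    simpa using (h.inja p hp p hp t₀ hlp hlp _ _ e).2
  have nd : fd p true ≠ fd p false := fun e => by
    simpa using (h.injd p hp p hp t₀ hlp hlp _ _ e).2
  have hlq' : ∀ t, l q = some t → t = t₁ := by grind -ring -linarith -lia -order -ac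
  have hlr' : ∀ t, l r = some t → t = t₁ := by grind -ring -linarith -lia -order -ac
  have hseg : ∀ u v, N' u v → fd' u true = fa' v false ∧ fd' v false = fa' u true := by
    intro u v huv
    rcases (hN' u v).1 huv with h5 | ⟨rfl, rfl⟩ | ⟨rfl, rfl⟩ | ⟨rfl, rfl⟩ | ⟨rfl, rfl⟩
    · obtain ⟨b1, b2, b3, b4⟩ := hI u v h5
      have b5 : N u v := (hN u v).2 (Or.inl h5)
      rw [a7 u b1 b3, d7 u b1 b3, a7 v b2 b4, d7 v b2 b4]
      exact ⟨h.fwd u v b5, h.bwd u v b5⟩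
    · rw [a1, d1, a7 u hx hxp, d7 u hx hxp]; exact ⟨h3, h4⟩
    · rw [d2, a5, d5, a2]; exact ⟨rfl, rfl⟩
    · rw [d6, a3, d3, a6]; exact ⟨rfl, rfl⟩
    · rw [d4, a4, a7 v hy hyp, d7 v hy hyp]; exact ⟨h1, h2⟩
  have hsplit' : ∀ u, u ∈ insert q (insert r W) → (u = q ∨ u = r) ∨ u ∈ W := by
    intro u hu
    rcases hu with hu | hu | hu
    · exact Or.inl (Or.inl hu)
    · exact Or.inl (Or.inr hu)
    · exact Or.inr hu
  -- `ε` exchanges the two sides of `p`; on the old positions the new labels are the old ones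
  -- composed with `ε`.
  obtain ⟨ε, hεp, hεn⟩ : ∃ ε : A → Bool → Bool, (∀ b, ε p b = !b) ∧ ∀ u, u ≠ p → ∀ b, ε u b = b :=
    ⟨fun u b => if u = p then !b else b, by simp, by simp +contextual⟩
  have hεε : ∀ u b, ε u (ε u b) = b := by
    intro u b
    by_cases hu : u = p
    · subst hu; simp [hεp]
    · simp [hεn u hu]
  have hε : ∀ u b c, ε u b = ε u c → b = c := by
    intro u b c e
    rw [← hεε u b, e, hεε]
  have hfa : ∀ u ∈ W, ∀ b, fa' u b = fa u (ε u b) := by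
    intro u hu b
    by_cases hup : u = p
    · subst hup; cases b <;> simp [hεp, a5, a6]
    · rw [hεn u hup, a7 u hu hup]
  have hfd : ∀ u ∈ W, ∀ b, fd' u b = fd u (ε u b) := by
    intro u hu b
    by_cases hup : u = p
    · subst hup; cases b <;> simp [hεp, d5, d6]
    · rw [hεn u hup, d7 u hu hup]
  have hqrs : ∀ k, ∀ s : A → Bool, (∀ u ∈ insert q (insert r W), ∀ v ∈ insert q (insert r W),
      ∀ t b c, l u = some t → l v = some t → fa' u b = k → fd' v c = k → s u = s v) →
      (k = fa p true ∨ k = fa p false ∨ k = fd p true ∨ k = fd p false) → s q = s r := by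
    rintro k s g2 (rfl | rfl | rfl | rfl)
    · exact (g2 r hrI q hqI t₁ true true hlr hlq a4 d2).symm
    · exact g2 q hqI r hrI t₁ false false hlq hlr a1 d3
    · exact g2 q hqI r hrI t₁ true true hlq hlr a2 d4
    · exact (g2 r hrI q hqI t₁ false false hlr hlq a3 d1).symm
  have hOn : ∀ k u v, I u v → (OnLabel fa' k u v ↔ OnLabel fa k u v) := by
    intro k u v h5
    obtain ⟨c1, c2, c3, c4⟩ := hI u v h5
    rw [OnLabel, OnLabel, a7 u c1 c3, a7 v c2 c4]
  have hOn1 : ∀ k, OnLabel fa' k x q ↔ OnLabel fa k x p := by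
    intro k; rw [OnLabel, OnLabel, a1, a7 x hx hxp]
  have hOn2 : ∀ k, OnLabel fa' k q p ↔ OnLabel fa k p y := by
    intro k; rw [OnLabel, OnLabel, a2, a5, h1, or_comm]
  have hOn3 : ∀ k, OnLabel fa' k p r ↔ OnLabel fa k x p := by
    intro k; rw [OnLabel, OnLabel, a3, a6, h4, or_comm]
  have hOn4 : ∀ k, OnLabel fa' k r y ↔ OnLabel fa k p y := by
    intro k; rw [OnLabel, OnLabel, a4, a7 y hy hyp]
  refine ⟨fa', fd', ⟨⟨fun u v huv => (hseg u v huv).1, fun u v huv => (hseg u v huv).2,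
    ?_, ?_, ?_, ?_, ?_, ?_, ?_⟩, ?_, ?_, ?_, ?_⟩⟩
  · intro u hu hlu b
    rcases hsplit u hu with rfl | rfl | rfl | ⟨hu, hup⟩
    · grind -ring -linarith -lia -order -ac
    · grind -ring -linarith -lia -order -ac
    · grind -ring -linarith -lia -order -ac
    · rw [a7 u hu hup, d7 u hu hup]; exact h.pass u hu hlu b
  · intro u hu b
    rcases hsplit u hu with rfl | rfl | rfl | ⟨hu, hup⟩
    · cases b <;> grind -ring -linarith -lia -order -ac
    · cases b <;> grind -ring -linarith -lia -order -ac
    · cases b <;> grind -ring -linarith -lia -order -ac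
    · rw [a7 u hu hup, d7 u hu hup]; exact h.ne u hu b
  · intro u hu t ht b c
    rcases hsplit u hu with rfl | rfl | rfl | ⟨hu, hup⟩
    · cases b <;> cases c <;> grind -ring -linarith -lia -order -ac
    · cases b <;> cases c <;> grind -ring -linarith -lia -order -ac
    · cases b <;> cases c <;> grind -ring -linarith -lia -order -ac
    · rw [a7 u hu hup, d7 u hu hup]; exact h.sep u hu t ht b c
  · intro u hu v hv t htu htv b c hbc
    rcases hsplit' u hu with hu | hu <;> rcases hsplit' v hv with hv | hv
    · rcases hu with rfl | rfl <;> rcases hv with rfl | rfl <;> cases b <;> cases c <;> grind -ring -linarith -lia -order -ac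
    · have := hW v hv
      grind -ring -linarith -lia -order -ac
    · have := hW u hu
      grind -ring -linarith -lia -order -ac
    · rw [hfa u hu, hfa v hv] at hbc
      obtain ⟨rfl, e⟩ := h.inja u hu v hv t htu htv _ _ hbc
      exact ⟨rfl, hε _ _ _ e⟩
  · intro u hu v hv t htu htv b c hbc
    rcases hsplit' u hu with hu | hu <;> rcases hsplit' v hv with hv | hv
    · rcases hu with rfl | rfl <;> rcases hv with rfl | rfl <;> cases b <;> cases c <;> grind -ring -linarith -lia -order -ac
    · have := hW v hv
      grind -ring -linarith -lia -order -ac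
    · have := hW u hu
      grind -ring -linarith -lia -order -ac
    · rw [hfd u hu, hfd v hv] at hbc
      obtain ⟨rfl, e⟩ := h.injd u hu v hv t htu htv _ _ hbc
      exact ⟨rfl, hε _ _ _ e⟩
  · intro u hu t htu b
    rcases hsplit' u hu with (rfl | rfl) | hu
    · exact ⟨r, hrI, by rw [hlr, ← htu, hlq], b, by cases b <;> simp [*]⟩
    · exact ⟨q, hqI, by rw [hlq, ← htu, hlr], b, by cases b <;> simp [*]⟩
    · obtain ⟨v, hv, hvt, c, hc⟩ := h.exd u hu t htu (ε u b)
      exact ⟨v, hWI v hv, hvt, ε v c, by rw [hfd v hv, hεε, hc, hfa u hu]⟩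
  · intro u hu t htu b
    rcases hsplit' u hu with (rfl | rfl) | hu
    · exact ⟨r, hrI, by rw [hlr, ← htu, hlq], b, by cases b <;> simp [*]⟩
    · exact ⟨q, hqI, by rw [hlq, ← htu, hlr], b, by cases b <;> simp [*]⟩
    · obtain ⟨v, hv, hvt, c, hc⟩ := h.exa u hu t htu (ε u b)
      exact ⟨v, hWI v hv, hvt, ε v c, by rw [hfa v hv, hεε, hc, hfd u hu]⟩
  · intro k
    refine (h.conn k).transfer fun s g1 g2 => ?_
    have hs := hqrs k s g2
    have b1 := g1 x q ((hN' x q).2 (by simp))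
    have b2 := g1 q p ((hN' q p).2 (by simp))
    have b3 := g1 p r ((hN' p r).2 (by simp))
    have b4 := g1 r y ((hN' r y).2 (by simp))
    simp only [OnLabel] at b1 b2 b3 b4
    rw [a1, a7 x hx hxp] at b1
    rw [a2, a5] at b2
    rw [a3, a6] at b3
    rw [a4, a7 y hy hyp] at b4
    -- The old arc between `x` and `p` is replaced by the arc between `x` and `q`, a chord between
    -- `q` and `r`, and the arc between `r` and `p`.
    have hx1 : OnLabel fa k x p → s x = s p ∧ s q = s r := by
      simp only [OnLabel]; grind -ring -linarith -lia -order -ac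
    have hy1 : OnLabel fa k p y → s p = s y ∧ s q = s r := by
      simp only [OnLabel]; grind -ring -linarith -lia -order -ac
    refine ⟨s, ?_, ?_, ?_⟩
    · intro u v huv hpk
      rcases (hN u v).1 huv with h5 | ⟨rfl, rfl⟩ | ⟨rfl, rfl⟩
      · exact g1 u v ((hN' u v).2 (Or.inl h5)) ((hOn k u v h5).2 hpk)
      · exact (hx1 hpk).1
      · exact (hy1 hpk).1
    · intro u hu v hv t b c htu htv hb hc
      refine g2 u (hWI u hu) v (hWI v hv) t (ε u b) (ε v c) htu htv ?_ ?_
      · rw [hfa u hu, hεε, hb]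
      · rw [hfd v hv, hεε, hc]
    · intro u v huv hpk
      rcases (hN' u v).1 huv with h5 | ⟨rfl, rfl⟩ | ⟨rfl, rfl⟩ | ⟨rfl, rfl⟩ | ⟨rfl, rfl⟩
      · exact ⟨u, v, (hN u v).2 (Or.inl h5), (hOn k u v h5).1 hpk, .inl rfl⟩
      · exact ⟨u, p, hxp', (hOn1 k).1 hpk, .inl rfl⟩
      · exact ⟨v, y, hpy, (hOn2 k).1 hpk, .inl (g1 u v huv hpk)⟩
      · exact ⟨x, u, hxp', (hOn3 k).1 hpk, .inl (hx1 ((hOn3 k).1 hpk)).1.symm⟩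
      · exact ⟨p, v, hpy, (hOn4 k).1 hpk,
          .inl ((g1 u v huv hpk).trans (hy1 ((hOn4 k).1 hpk)).1.symm)⟩
  · intro w hw b
    obtain ⟨w', hw', b', hb'⟩ : ∃ w' ∈ W, ∃ b', fa' w b = fa w' b' := by
      have hd : ∀ c, ∃ w' ∈ W, ∃ b', fd p c = fa w' b' := by
        intro c
        obtain ⟨v, hv, -, c', hc'⟩ := h.exa p hp t₀ hlp c
        exact ⟨v, hv, c', hc'.symm⟩
      rcases hsplit' w hw with (rfl | rfl) | hw
      · cases b
        · rw [a1]; exact ⟨p, hp, _, rfl⟩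
        · rw [a2]; exact hd _
      · cases b
        · rw [a3]; exact hd _
        · rw [a4]; exact ⟨p, hp, _, rfl⟩
      · exact ⟨w, hw, _, hfa w hw b⟩
    rw [hb']
    generalize hk : fa w' b' = k
    have hco := h.coconn w' hw' b'
    rw [hk] at hco
    refine hco.transfer fun s g1 g2 => ?_
    have hs := hqrs k s g2
    have b1 := g1 x q ((hN' x q).2 (by simp))
    have b2 := g1 q p ((hN' q p).2 (by simp))
    have b3 := g1 p r ((hN' p r).2 (by simp))
    have b4 := g1 r y ((hN' r y).2 (by simp))
    simp only [OnLabel] at b1 b2 b3 b4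
    rw [a1, a7 x hx hxp] at b1
    rw [a2, a5] at b2
    rw [a3, a6] at b3
    rw [a4, a7 y hy hyp] at b4
    -- Either the arc between `q` and `p` is off the label as well, or the label has a chord between
    -- `q` and `r`. In both cases `x` is joined to `p`.
    have hx1 : ¬ OnLabel fa k x p → s x = s p := by
      simp only [OnLabel]; grind -ring -linarith -lia -order -ac
    have hy1 : ¬ OnLabel fa k p y → s p = s y := by
      simp only [OnLabel]; grind -ring -linarith -lia -order -ac
    refine ⟨s, ?_, ?_, ?_⟩
    · intro u v huv hpk
      rcases (hN u v).1 huv with h5 | ⟨rfl, rfl⟩ | ⟨rfl, rfl⟩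
      · exact g1 u v ((hN' u v).2 (Or.inl h5)) (fun hh => hpk ((hOn k u v h5).1 hh))
      · exact hx1 hpk
      · exact hy1 hpk
    · intro u hu v hv t b c htu htv hb hc
      refine g2 u (hWI u hu) v (hWI v hv) t (ε u b) (ε v c) htu htv ?_ ?_
      · rw [hfa u hu, hεε, hb]
      · rw [hfd v hv, hεε, hc]
    · intro u v huv hpk
      rcases (hN' u v).1 huv with h5 | ⟨rfl, rfl⟩ | ⟨rfl, rfl⟩ | ⟨rfl, rfl⟩ | ⟨rfl, rfl⟩
      · exact ⟨u, v, (hN u v).2 (Or.inl h5), (hOn k u v h5).not.1 hpk, .inl rfl⟩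
      · exact ⟨u, p, hxp', (hOn1 k).not.1 hpk, .inl rfl⟩
      · exact ⟨v, y, hpy, (hOn2 k).not.1 hpk, .inl (g1 u v huv hpk)⟩
      · exact ⟨x, u, hxp', (hOn3 k).not.1 hpk, .inl (hx1 ((hOn3 k).not.1 hpk)).symm⟩
      · exact ⟨p, v, hpy, (hOn4 k).not.1 hpk,
          .inl ((g1 u v huv hpk).trans (hy1 ((hOn4 k).not.1 hpk)).symm)⟩
  · intro t k s hs
    by_cases ht : t = t₁
    · subst ht
      -- Two chords with different labels lead from `q` to `r` and two lead back, so one in each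
      -- direction survives the removal of a label.
      have e1 := hs q hqI r hrI hlq hlr false false (by rw [a1, d3])
      have e2 := hs q hqI r hrI hlq hlr true true (by rw [a2, d4])
      have e3 := hs r hrI q hqI hlr hlq false false (by rw [a3, d1])
      have e4 := hs r hrI q hqI hlr hlq true true (by rw [a4, d2])
      have e5 : s q = s r := by
        rw [Bool.eq_iff_iff]
        grind -ring -linarith -lia -order -ac
      have key : ∀ u ∈ insert q (insert r W), l u = some t → s u = s q := by
        intro u hu htu
        rcases hsplit' u hu with (rfl | rfl) | hu
        · rfl
        · exact e5.symm
        · exact absurd htu (hW u hu)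
      intro u hu v hv htu htv
      rw [key u hu htu, key v hv htv]
    · have key := h.cutLabel t k s (fun u hu v hv htu htv b c hbc hk => by
        refine hs u (hWI u hu) v (hWI v hv) htu htv (ε u b) (ε v c) ?_ ?_
        · rw [hfa u hu, hfd v hv, hεε, hεε, hbc]
        · rwa [hfa u hu, hεε])
      intro u hu v hv htu htv
      rcases hsplit' u hu with hu | hu
      · grind -ring -linarith -lia -order -ac
      rcases hsplit' v hv with hv | hv
      · grind -ring -linarith -lia -order -ac
      exact key u hu v hv htu htv
  · intro t p₀ s hs1 hs2
    by_cases ht : t = t₁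
    · subst ht
      have e1 := hs2 q hqI r hrI hlq hlr false false (by rw [a1, d3])
      have e2 := hs2 q hqI r hrI hlq hlr true true (by rw [a2, d4])
      have e3 := hs2 r hrI q hqI hlr hlq false false (by rw [a3, d1])
      have e4 := hs2 r hrI q hqI hlr hlq true true (by rw [a4, d2])
      have e5 : s q false = s r false := Bool.eq_iff_iff.2 ⟨e1, e3⟩
      have e6 : s q true = s r true := Bool.eq_iff_iff.2 ⟨e2, e4⟩
      have e7 : s q true = s q false := by
        by_cases hq0 : q = p₀
        · rw [e5, e6]; exact hs1 r hrI hlr (fun e => hqr (hq0.trans e.symm))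
        · exact hs1 q hqI hlq hq0
      have key : ∀ u ∈ insert q (insert r W), l u = some t → ∀ b, s u b = s q false := by
        intro u hu htu b
        rcases hsplit' u hu with (rfl | rfl) | hu
        · cases b <;> simp [e7]
        · cases b
          · exact e5.symm
          · rw [← e6, e7]
        · exact absurd htu (hW u hu)
      intro u hu v hv htu htv b c
      rw [key u hu htu, key v hv htv]
    · have key := h.cutPosition t p₀ (fun u b => s u (ε u b)) (fun u hu htu hup => by
          have := hs1 u (hWI u hu) htu hup
          by_cases hup' : u = p
          · subst hup'; simpa [hεp] using this.symm
          · simpa [hεn u hup'] using this)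
        (fun u hu v hv htu htv b c hbc => by
          refine hs2 u (hWI u hu) v (hWI v hv) htu htv (ε u b) (ε v c) ?_
          rw [hfa u hu, hfd v hv, hεε, hεε, hbc])
      intro u hu v hv htu htv b c
      rcases hsplit' u hu with hu | hu
      · grind -ring -linarith -lia -order -ac
      rcases hsplit' v hv with hv | hv
      · grind -ring -linarith -lia -order -ac
      have := key u hu v hv htu htv (ε u b) (ε v c)
      simpa only [hεε] using this

set_option maxHeartbeats 2000000 in
/-- Insertion of two positions `q'` and `p'` into `q p r`, where `q`, `r`, `q'` have the same letter
and `p`, `p'` have the same letter. -/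
theorem GoodLabelling.insert_alternating {A B K : Type*} {l : A → Option B} {W : Set A}
    {N N' I : A → A → Prop} {fa fd : A → Bool → K} (h : GoodLabelling l W N fa fd)
    {x q p r y q' p' : A}
    (hI : ∀ u v, I u v → u ∈ W ∧ v ∈ W ∧ u ≠ p ∧ v ≠ p ∧ u ≠ q ∧ v ≠ r)
    (hp : p ∈ W) (hq : q ∈ W) (hr : r ∈ W) (hqr : q ≠ r) (hxq : I x q) (hry : I r y)
    (hq' : q' ∉ W) (hp' : p' ∉ W)
    (hN : ∀ u v, N u v ↔ I u v ∨ (u = q ∧ v = p) ∨ (u = p ∧ v = r))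
    (hN' : ∀ u v, N' u v ↔ I u v ∨ (u = q ∧ v = p) ∨ (u = p ∧ v = q') ∨ (u = q' ∧ v = p') ∨
      (u = p' ∧ v = r))
    (hcyc : ∀ s : A → Bool, (∀ u v, N u v → s u = s v) → ∀ u ∈ W, ∀ v ∈ W, s u = s v)
    {t₀ t₁ : B} (ht : t₀ ≠ t₁) (hlp : l p = some t₀) (hlp' : l p' = some t₀) (hlq : l q = some t₁)
    (hlr : l r = some t₁) (hlq' : l q' = some t₁) :
    ∃ fa' fd' : A → Bool → K ⊕ Bool, GoodLabelling l (insert q' (insert p' W)) N' fa' fd' := by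
  classical
  have hne : ∀ {u v : A} {t t' : B}, l u = some t → l v = some t' → t ≠ t' → u ≠ v := by
    rintro u v t t' e1 e2 e3 rfl
    exact e3 (Option.some.inj (e1.symm.trans e2))
  have hqp : q ≠ p := by rintro rfl; exact ht (Option.some.inj (hlp.symm.trans hlq))
  have hrp : r ≠ p := by rintro rfl; exact ht (Option.some.inj (hlp.symm.trans hlr))
  have hqp' : q' ≠ p' := by rintro rfl; exact ht (Option.some.inj (hlp'.symm.trans hlq'))
  have Nqp : N q p := (hN q p).2 (by simp)
  have Npr : N p r := (hN p r).2 (by simp)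
  have h1 := h.fwd _ _ Nqp
  have h2 := h.bwd _ _ Nqp
  have h3 := h.fwd _ _ Npr
  have h4 := h.bwd _ _ Npr
  have hqW : ∀ u ∈ W, u ≠ q' := fun u hu e => hq' (e ▸ hu)
  have hpW : ∀ u ∈ W, u ≠ p' := fun u hu e => hp' (e ▸ hu)
  set W' : Set A := insert q' (insert p' W) with hW'
  have hqI : q' ∈ W' := Or.inl rfl
  have hpI : p' ∈ W' := Or.inr (Or.inl rfl)
  have hWI : ∀ u ∈ W, u ∈ W' := fun u hu => Or.inr (Or.inr hu)
  -- The dicycle `.inr true` goes from `q` to `p`, by a chord to `p'`, back to `q'` and by a chord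
  -- to `q`. The dicycle `.inr false` goes from `q'` back to `p`, by a chord to `p'`, on to `r` and
  -- by a chord to `q'`. Old arrivals at `p` move to `p'`, the old arrival at `r` from `p` moves to
  -- `q'`, and so does the old departure from `q` to `p`.
  obtain ⟨fa', a1, a2, a3, a4, a5, a6, a7, a8⟩ : ∃ f : A → Bool → K ⊕ Bool,
      f p false = .inr true ∧ f p true = .inr false ∧ f p' false = .inl (fa p false) ∧
      f p' true = .inl (fa p true) ∧ f q' false = .inl (fa r false) ∧ f q' true = .inr true ∧
      f r false = .inr false ∧
      ∀ u ∈ W, u ≠ p → ∀ b, ¬ (u = r ∧ b = false) → f u b = .inl (fa u b) :=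
    ⟨fun u b => if u = q' then (if b then .inr true else .inl (fa r false)) else
      if u = p' then .inl (fa p b) else if u = p then (if b then .inr false else .inr true) else
      if u = r ∧ b = false then .inr false else .inl (fa u b),
      by simp [hqW p hp, hpW p hp], by simp [hqW p hp, hpW p hp], by simp [hqp'.symm],
      by simp [hqp'.symm], by simp, by simp, by simp [hqW r hr, hpW r hr, hrp],
      fun u hu hup b hb => by simp only [hqW u hu, hpW u hu, hup, hb, if_false]⟩
  obtain ⟨fd', d1, d2, d3, d4, d5, d6⟩ : ∃ f : A → Bool → K ⊕ Bool,
      f p' false = .inr true ∧ f p' true = .inr false ∧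
      f q' false = .inr false ∧ f q' true = .inl (fd q true) ∧ f q true = .inr true ∧
      ∀ u ∈ W, ∀ b, ¬ (u = q ∧ b = true) → f u b = .inl (fd u b) :=
    ⟨fun u b => if u = q' then (if b then .inl (fd q true) else .inr false) else
      if u = p' then (if b then .inr false else .inr true) else
      if u = q ∧ b = true then .inr true else .inl (fd u b),
      by simp [hqp'.symm], by simp [hqp'.symm], by simp, by simp, by simp [hqW q hq, hpW q hq],
      fun u hu b hb => by simp only [hqW u hu, hpW u hu, hb, if_false]⟩
  have p1 := h.sep p hp t₀ hlp true true
  have p2 := h.sep p hp t₀ hlp true false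
  have p3 := h.sep p hp t₀ hlp false true
  have p4 := h.sep p hp t₀ hlp false false
  have na : fa p true ≠ fa p false := fun e => by
    simpa using (h.inja p hp p hp t₀ hlp hlp _ _ e).2
  have nd : fd p true ≠ fd p false := fun e => by
    simpa using (h.injd p hp p hp t₀ hlp hlp _ _ e).2
  have q1 := h.sep q hq t₁ hlq
  have r1 := h.sep r hr t₁ hlr
  have qd : fd q false ≠ fd q true := fun e => by
    simpa using (h.injd q hq q hq t₁ hlq hlq _ _ e).2
  have qa : fa q false ≠ fa q true := fun e => by
    simpa using (h.inja q hq q hq t₁ hlq hlq _ _ e).2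
  have rd : fd r true ≠ fd r false := fun e => by
    simpa using (h.injd r hr r hr t₁ hlr hlr _ _ e).2
  have ra : fa r true ≠ fa r false := fun e => by
    simpa using (h.inja r hr r hr t₁ hlr hlr _ _ e).2
  -- `ea` and `ed` give the new places of the old arrivals and departures. The exceptional cases in
  -- `hsa` and `hsd` are those of the two new dicycles.
  obtain ⟨ea, ea1, ea2, ea3⟩ : ∃ e : A → Bool → A, (∀ b, e p b = p') ∧ e r false = q' ∧
      ∀ u b, u ≠ p → ¬ (u = r ∧ b = false) → e u b = u :=
    ⟨fun u b => if u = p then p' else if u = r ∧ b = false then q' else u, by simp, by simp [hrp],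
      fun u b h1 h2 => by simp only [h1, h2, if_false]⟩
  obtain ⟨ed, ed1, ed2⟩ : ∃ e : A → Bool → A, e q true = q' ∧
      ∀ u b, ¬ (u = q ∧ b = true) → e u b = u :=
    ⟨fun u b => if u = q ∧ b = true then q' else u, by simp,
      fun u b h1 => by simp only [h1, if_false]⟩
  have ha : ∀ u ∈ W, ∀ b, ea u b ∈ W' ∧ l (ea u b) = l u ∧ fa' (ea u b) b = .inl (fa u b) := by
    intro u hu b
    by_cases hup : u = p
    · subst hup
      rw [ea1]
      exact ⟨hpI, by rw [hlp, hlp'], by cases b <;> assumption⟩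
    by_cases hur : u = r ∧ b = false
    · obtain ⟨rfl, rfl⟩ := hur
      rw [ea2]
      exact ⟨hqI, by rw [hlq', hlr], a5⟩
    rw [ea3 u b hup hur]
    exact ⟨hWI u hu, rfl, a8 u hu hup b hur⟩
  have hd : ∀ u ∈ W, ∀ b, ed u b ∈ W' ∧ l (ed u b) = l u ∧ fd' (ed u b) b = .inl (fd u b) := by
    intro u hu b
    by_cases hur : u = q ∧ b = true
    · obtain ⟨rfl, rfl⟩ := hur
      rw [ed1]
      exact ⟨hqI, by rw [hlq', hlq], d4⟩
    rw [ed2 u b hur]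
    exact ⟨hWI u hu, rfl, d6 u hu b hur⟩
  have hsa : ∀ u ∈ W', ∀ b, (∃ u₀ ∈ W, u = ea u₀ b) ∨ (u = p ∧ b = false) ∨ (u = p ∧ b = true) ∨
      (u = q' ∧ b = true) ∨ (u = r ∧ b = false) := by
    intro u hu b
    rcases hu with rfl | rfl | hu
    · cases b
      · exact Or.inl ⟨r, hr, ea2.symm⟩
      · simp
    · exact Or.inl ⟨p, hp, (ea1 b).symm⟩
    · by_cases hup : u = p
      · cases b <;> simp [hup]
      by_cases hur : u = r ∧ b = false
      · simp [hur]
      · exact Or.inl ⟨u, hu, (ea3 u b hup hur).symm⟩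
  have hsd : ∀ u ∈ W', ∀ b, (∃ u₀ ∈ W, u = ed u₀ b) ∨ (u = p' ∧ b = false) ∨ (u = p' ∧ b = true) ∨
      (u = q ∧ b = true) ∨ (u = q' ∧ b = false) := by
    intro u hu b
    rcases hu with rfl | rfl | hu
    · cases b
      · simp
      · exact Or.inl ⟨q, hq, ed1.symm⟩
    · cases b <;> simp
    · by_cases hur : u = q ∧ b = true
      · simp [hur]
      · exact Or.inl ⟨u, hu, (ed2 u b hur).symm⟩
  have hseg : ∀ u v, N' u v → fd' u true = fa' v false ∧ fd' v false = fa' u true := by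
    intro u v huv
    rcases (hN' u v).1 huv with h5 | ⟨rfl, rfl⟩ | ⟨rfl, rfl⟩ | ⟨rfl, rfl⟩ | ⟨rfl, rfl⟩
    · obtain ⟨b1, b2, b3, b4, b5, b6⟩ := hI u v h5
      have b7 : N u v := (hN u v).2 (Or.inl h5)
      rw [a8 u b1 b3 _ (by simp), a8 v b2 b4 _ (by simp [b6]), d6 u b1 _ (by simp [b5]),
        d6 v b2 _ (by simp), h.fwd u v b7, h.bwd u v b7]
      exact ⟨rfl, rfl⟩
    · rw [a1, d5, d6 v hp _ (by simp), a8 u hq hqp _ (by simp), h2]; exact ⟨rfl, rfl⟩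
    · rw [d6 u hp _ (by simp [hqp.symm]), a5, d3, a2, h3]; exact ⟨rfl, rfl⟩
    · rw [d4, a3, d1, a6, h1]; exact ⟨rfl, rfl⟩
    · rw [d2, a7, d6 v hr _ (by simp), a4, h4]; exact ⟨rfl, rfl⟩
  have hOn : ∀ k u v, I u v → (OnLabel fa' k u v ↔ ∃ k₀, k = .inl k₀ ∧ OnLabel fa k₀ u v) := by
    intro k u v h5
    obtain ⟨b1, b2, b3, b4, b5, b6⟩ := hI u v h5
    rw [OnLabel, a8 u b1 b3 _ (by simp), a8 v b2 b4 _ (by simp [b6])]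
    cases k <;> simp [OnLabel]
  have On1 : ∀ k, OnLabel fa' k q p ↔ k = .inr true ∨ k = .inl (fd p false) := by
    intro k
    rw [OnLabel, a1, a8 q hq hqp _ (by simp), h2, eq_comm, eq_comm (b := k)]
  have On2 : ∀ k, OnLabel fa' k p q' ↔ k = .inr false ∨ k = .inl (fd p true) := by
    intro k
    rw [OnLabel, a2, a5, h3, eq_comm, eq_comm (b := k), or_comm]
  have On3 : ∀ k, OnLabel fa' k q' p' ↔ k = .inr true ∨ k = .inl (fa p false) := by
    intro k
    rw [OnLabel, a3, a6, eq_comm, eq_comm (b := k), or_comm]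
  have On4 : ∀ k, OnLabel fa' k p' r ↔ k = .inr false ∨ k = .inl (fa p true) := by
    intro k
    rw [OnLabel, a7, a4, eq_comm, eq_comm (b := k)]
  have O1 : ∀ k, OnLabel fa k q p ↔ k = fa p false ∨ k = fd p false := by
    intro k
    rw [OnLabel, h2, eq_comm, eq_comm (b := k)]
  have O2 : ∀ k, OnLabel fa k p r ↔ k = fd p true ∨ k = fa p true := by
    intro k
    rw [OnLabel, h3, eq_comm, eq_comm (b := k)]
  have hia : ∀ u b, ((u = p ∧ b = false) ∨ (u = p ∧ b = true) ∨
      (u = q' ∧ b = true) ∨ (u = r ∧ b = false)) → ∃ e, fa' u b = .inr e := by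
    rintro u b (⟨rfl, rfl⟩ | ⟨rfl, rfl⟩ | ⟨rfl, rfl⟩ | ⟨rfl, rfl⟩)
    exacts [⟨_, a1⟩, ⟨_, a2⟩, ⟨_, a6⟩, ⟨_, a7⟩]
  have hid : ∀ u b, ((u = p' ∧ b = false) ∨ (u = p' ∧ b = true) ∨
      (u = q ∧ b = true) ∨ (u = q' ∧ b = false)) → ∃ e, fd' u b = .inr e := by
    rintro u b (⟨rfl, rfl⟩ | ⟨rfl, rfl⟩ | ⟨rfl, rfl⟩ | ⟨rfl, rfl⟩)
    exacts [⟨_, d1⟩, ⟨_, d2⟩, ⟨_, d5⟩, ⟨_, d3⟩]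
  have hsep : ∀ u ∈ W', ∀ t, l u = some t → ∀ b c, fa' u b ≠ fd' u c := by
    intro u hu t htu b c
    rcases hu with rfl | rfl | hu
    · cases b <;> cases c <;> grind -ring -linarith -lia -order -ac
    · cases b <;> cases c <;> grind -ring -linarith -lia -order -ac
    · have := h.sep u hu t htu b c
      by_cases hup : u = p
      · subst hup
        have := d6 u hu c (by simp [hqp.symm])
        cases b <;> grind -ring -linarith -lia -order -ac
      by_cases hur : u = r ∧ b = false
      · obtain ⟨rfl, rfl⟩ := hur
        rw [a7, d6 u hu c (by simp [hqr.symm])]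
        simp
      rw [a8 u hu hup b hur]
      by_cases huq : u = q ∧ c = true
      · obtain ⟨rfl, rfl⟩ := huq
        rw [d5]; simp
      · rw [d6 u hu c huq]; simpa using this
  refine ⟨fa', fd', ⟨⟨fun u v huv => (hseg u v huv).1, fun u v huv => (hseg u v huv).2,
    ?_, ?_, ?_, ?_, ?_, ?_, ?_⟩, ?_, ?_, ?_, ?_⟩⟩
  · intro u hu hlu b
    have hup : u ≠ p := by rintro rfl; simp [hlp] at hlu
    have huq : u ≠ q := by rintro rfl; simp [hlq] at hlu
    have hur : u ≠ r := by rintro rfl; simp [hlr] at hlu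
    rcases hu with rfl | rfl | hu
    · simp [hlq'] at hlu
    · simp [hlp'] at hlu
    · rw [a8 u hu hup _ (by simp [hur]), d6 u hu _ (by simp [huq]), h.pass u hu hlu]
  · intro u hu b
    cases htu : l u with
    | some t => exact hsep u hu t htu b b
    | none =>
      have hup : u ≠ p := by rintro rfl; simp [hlp] at htu
      have huq : u ≠ q := by rintro rfl; simp [hlq] at htu
      have hur : u ≠ r := by rintro rfl; simp [hlr] at htu
      rcases hu with rfl | rfl | hu
      · simp [hlq'] at htu
      · simp [hlp'] at htu
      · rw [a8 u hu hup _ (by simp [hur]), d6 u hu _ (by simp [huq])]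
        simpa using h.ne u hu b
  · exact hsep
  · intro u hu v hv t htu htv b c hbc
    rcases hsa u hu b with ⟨u₀, hu₀, rfl⟩ | hu'
    · obtain ⟨-, l1, f1⟩ := ha u₀ hu₀ b
      rcases hsa v hv c with ⟨v₀, hv₀, rfl⟩ | hv'
      · obtain ⟨-, l2, f2⟩ := ha v₀ hv₀ c
        rw [f1, f2] at hbc
        obtain ⟨rfl, rfl⟩ := h.inja u₀ hu₀ v₀ hv₀ t (l1 ▸ htu) (l2 ▸ htv) _ _ (Sum.inl.inj hbc)
        exact ⟨rfl, rfl⟩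
      · obtain ⟨e, he⟩ := hia v c hv'
        rw [f1, he] at hbc
        cases hbc
    · rcases hsa v hv c with ⟨v₀, hv₀, rfl⟩ | hv'
      · obtain ⟨-, l2, f2⟩ := ha v₀ hv₀ c
        obtain ⟨e, he⟩ := hia u b hu'
        rw [f2, he] at hbc
        cases hbc
      · clear hsa ha hsep
        rcases hu' with ⟨rfl, rfl⟩ | ⟨rfl, rfl⟩ | ⟨rfl, rfl⟩ | ⟨rfl, rfl⟩ <;> rcases hv' with ⟨rfl, rfl⟩ | ⟨rfl, rfl⟩ | ⟨rfl, rfl⟩ | ⟨rfl, rfl⟩ <;> grind -ring -linarith -lia -order -ac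
  · intro u hu v hv t htu htv b c hbc
    rcases hsd u hu b with ⟨u₀, hu₀, rfl⟩ | hu'
    · obtain ⟨-, l1, f1⟩ := hd u₀ hu₀ b
      rcases hsd v hv c with ⟨v₀, hv₀, rfl⟩ | hv'
      · obtain ⟨-, l2, f2⟩ := hd v₀ hv₀ c
        rw [f1, f2] at hbc
        obtain ⟨rfl, rfl⟩ := h.injd u₀ hu₀ v₀ hv₀ t (l1 ▸ htu) (l2 ▸ htv) _ _ (Sum.inl.inj hbc)
        exact ⟨rfl, rfl⟩
      · obtain ⟨e, he⟩ := hid v c hv'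
        rw [f1, he] at hbc
        cases hbc
    · rcases hsd v hv c with ⟨v₀, hv₀, rfl⟩ | hv'
      · obtain ⟨-, l2, f2⟩ := hd v₀ hv₀ c
        obtain ⟨e, he⟩ := hid u b hu'
        rw [f2, he] at hbc
        cases hbc
      · clear hsd hd hsep
        rcases hu' with ⟨rfl, rfl⟩ | ⟨rfl, rfl⟩ | ⟨rfl, rfl⟩ | ⟨rfl, rfl⟩ <;> rcases hv' with ⟨rfl, rfl⟩ | ⟨rfl, rfl⟩ | ⟨rfl, rfl⟩ | ⟨rfl, rfl⟩ <;> grind -ring -linarith -lia -order -ac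
  · intro u hu t htu b
    rcases hsa u hu b with ⟨u₀, hu₀, rfl⟩ | ⟨rfl, rfl⟩ | ⟨rfl, rfl⟩ | ⟨rfl, rfl⟩ | ⟨rfl, rfl⟩
    · obtain ⟨-, l1, f1⟩ := ha u₀ hu₀ b
      obtain ⟨v, hv, hvt, c, hc⟩ := h.exd u₀ hu₀ t (l1 ▸ htu) b
      obtain ⟨m2, l2, f2⟩ := hd v hv c
      exact ⟨_, m2, l2 ▸ hvt, c, by rw [f2, f1, hc]⟩
    · exact ⟨p', hpI, by rw [hlp', ← htu, hlp], false, by rw [d1, a1]⟩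
    · exact ⟨p', hpI, by rw [hlp', ← htu, hlp], true, by rw [d2, a2]⟩
    · exact ⟨q, hWI q hq, by rw [hlq, ← htu, hlq'], true, by rw [d5, a6]⟩
    · exact ⟨q', hqI, by rw [hlq', ← htu, hlr], false, by rw [d3, a7]⟩
  · intro u hu t htu b
    rcases hsd u hu b with ⟨u₀, hu₀, rfl⟩ | ⟨rfl, rfl⟩ | ⟨rfl, rfl⟩ | ⟨rfl, rfl⟩ | ⟨rfl, rfl⟩
    · obtain ⟨-, l1, f1⟩ := hd u₀ hu₀ b
      obtain ⟨v, hv, hvt, c, hc⟩ := h.exa u₀ hu₀ t (l1 ▸ htu) b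
      obtain ⟨m2, l2, f2⟩ := ha v hv c
      exact ⟨_, m2, l2 ▸ hvt, c, by rw [f2, f1, hc]⟩
    · exact ⟨p, hWI p hp, by rw [hlp, ← htu, hlp'], false, by rw [d1, a1]⟩
    · exact ⟨p, hWI p hp, by rw [hlp, ← htu, hlp'], true, by rw [d2, a2]⟩
    · exact ⟨q', hqI, by rw [hlq', ← htu, hlq], true, by rw [d5, a6]⟩
    · exact ⟨r, hWI r hr, by rw [hlr, ← htu, hlq'], false, by rw [d3, a7]⟩
  · rintro (k | e)
    · refine (h.conn k).transfer fun s' g1 g2 => ?_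
      -- Each old position takes the colour of the new position that the dicycle visits in its
      -- place. There is no conflict, as by `sep` a label does not both arrive at and depart from
      -- `p`, `q` or `r`.
      obtain ⟨s, z1, z2, z3, z4, z5, z6, z7⟩ : ∃ s : A → Bool,
          (k = fd p true ∨ k = fd p false → s p = s' p) ∧
          (k ≠ fd p true → k ≠ fd p false → s p = s' p') ∧ (k = fd q true → s q = s' q') ∧
          (k ≠ fd q true → s q = s' q) ∧ (k = fa r false → s r = s' q') ∧
          (k ≠ fa r false → s r = s' r) ∧ (∀ u, u ≠ p → u ≠ q → u ≠ r → s u = s' u) :=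
        ⟨fun u => if u = p then (if k = fd p true ∨ k = fd p false then s' p else s' p') else
          if u = q then (if k = fd q true then s' q' else s' q) else
          if u = r then (if k = fa r false then s' q' else s' r) else s' u,
          fun hk => by simp [hk], fun hk hk' => by simp [hk, hk'],
          fun hk => by simp [hqp, hk], fun hk => by simp [hqp, hk],
          fun hk => by simp [hrp, hqr.symm, hk], fun hk => by simp [hrp, hqr.symm, hk],
          fun u hu1 hu2 hu3 => by simp [hu1, hu2, hu3]⟩
      have hA : ∀ u ∈ W, ∀ b, fa u b = k → s u = s' (ea u b) := by
        rintro u hu b rfl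
        by_cases hup : u = p
        · subst hup
          rw [ea1]
          cases b
          · exact z2 p3 p4
          · exact z2 p1 p2
        by_cases huq : u = q
        · subst huq
          rw [ea3 u b hup (by simp [hqr])]
          exact z4 (q1 b true)
        by_cases hur : u = r
        · subst hur
          cases b
          · rw [ea2]; exact z5 rfl
          · rw [ea3 u true hup (by simp)]; exact z6 ra
        rw [ea3 u b hup (by simp [hur])]
        exact z7 u hup huq hur
      have hD : ∀ u ∈ W, ∀ b, fd u b = k → s u = s' (ed u b) := by
        rintro u hu b rfl
        by_cases hup : u = p
        · subst hup
          rw [ed2 u b (by simp [hqp.symm])]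
          cases b <;> exact z1 (by simp)
        by_cases huq : u = q
        · subst huq
          cases b
          · rw [ed2 u false (by simp)]; exact z4 qd
          · rw [ed1]; exact z3 rfl
        rw [ed2 u b (by simp [huq])]
        by_cases hur : u = r
        · subst hur
          exact z6 (r1 false b).symm
        exact z7 u hup huq hur
      have hI1 : ∀ u v, I u v → OnLabel fa k u v → s u = s' u ∧ s v = s' v := by
        intro u v h5 ho
        obtain ⟨b1, b2, b3, b4, b5, b6⟩ := hI u v h5
        have b7 : N u v := (hN u v).2 (Or.inl h5)
        rcases ho with ho | ho
        · have e1 := hA v b2 false ho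
          have e2 := hD u b1 true (by rw [h.fwd u v b7, ho])
          rw [ea3 v false b4 (by simp [b6])] at e1
          rw [ed2 u true (by simp [b5])] at e2
          exact ⟨e2, e1⟩
        · have e1 := hA u b1 true ho
          have e2 := hD v b2 false (by rw [h.bwd u v b7, ho])
          rw [ea3 u true b3 (by simp)] at e1
          rw [ed2 v false (by simp)] at e2
          exact ⟨e1, e2⟩
      have k1 : OnLabel fa k q p → s q = s p := by
        intro ho
        rcases (O1 k).1 ho with rfl | rfl
        · rw [hA p hp false rfl, hD q hq true h1, ea1, ed1]
          exact g1 q' p' ((hN' _ _).2 (by simp)) ((On3 _).2 (by simp))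
        · rw [hD p hp false rfl, hA q hq true h2.symm, ed2 p _ (by simp), ea3 q _ hqp (by simp)]
          exact g1 q p ((hN' _ _).2 (by simp)) ((On1 _).2 (by simp))
      have k2 : OnLabel fa k p r → s p = s r := by
        intro ho
        rcases (O2 k).1 ho with rfl | rfl
        · rw [hD p hp true rfl, hA r hr false h3.symm, ea2, ed2 p _ (by simp [hqp.symm])]
          exact g1 p q' ((hN' _ _).2 (by simp)) ((On2 _).2 (by simp))
        · rw [hA p hp true rfl, hD r hr false h4, ed2 r _ (by simp), ea1]
          exact g1 p' r ((hN' _ _).2 (by simp)) ((On4 _).2 (by simp))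
      refine ⟨s, ?_, ?_, ?_⟩
      · intro u v huv ho
        rcases (hN u v).1 huv with h5 | ⟨rfl, rfl⟩ | ⟨rfl, rfl⟩
        · obtain ⟨e1, e2⟩ := hI1 u v h5 ho
          rw [e1, e2]
          exact g1 u v ((hN' u v).2 (Or.inl h5)) ((hOn _ u v h5).2 ⟨k, rfl, ho⟩)
        · exact k1 ho
        · exact k2 ho
      · intro u hu v hv t b c htu htv hb hc
        rw [hA u hu b hb, hD v hv c hc]
        obtain ⟨m1, l1, f1⟩ := ha u hu b
        obtain ⟨m2, l2, f2⟩ := hd v hv c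
        exact g2 _ m1 _ m2 t b c (l1 ▸ htu) (l2 ▸ htv) (by rw [f1, hb]) (by rw [f2, hc])
      · intro u v huv ho
        rcases (hN' u v).1 huv with h5 | ⟨rfl, rfl⟩ | ⟨rfl, rfl⟩ | ⟨rfl, rfl⟩ | ⟨rfl, rfl⟩
        · obtain ⟨k', hk', ho'⟩ := (hOn _ u v h5).1 ho
          cases hk'
          exact ⟨u, v, (hN u v).2 (Or.inl h5), ho', Or.inl (hI1 u v h5 ho').1.symm⟩
        · rcases (On1 _).1 ho with e | e
          · cases e
          · cases e
            exact ⟨u, v, Nqp, (O1 _).2 (Or.inr rfl), Or.inl (z4 (h1 ▸ p4.symm)).symm⟩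
        · rcases (On2 _).1 ho with e | e
          · cases e
          · cases e
            exact ⟨u, r, Npr, (O2 _).2 (Or.inl rfl), Or.inl (z1 (Or.inl rfl)).symm⟩
        · rcases (On3 _).1 ho with e | e
          · cases e
          · cases e
            exact ⟨q, p, Nqp, (O1 _).2 (Or.inl rfl), Or.inl (z3 h1.symm).symm⟩
        · rcases (On4 _).1 ho with e | e
          · cases e
          · cases e
            exact ⟨p, v, Npr, (O2 _).2 (Or.inr rfl), Or.inl (z2 p1 p2).symm⟩
    -- A new dicycle has only two arcs, so one chord suffices to link them.
    · have key : ∀ s' : A → Bool, (∀ u ∈ W', ∀ v ∈ W', ∀ t b c, l u = some t → l v = some t →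
          fa' u b = .inr e → fd' v c = .inr e → s' u = s' v) → ∃ w, ∀ u v, N' u v →
          OnLabel fa' (.inr e) u v → s' u = w := by
        intro s' g2
        cases e
        · refine ⟨s' p, fun u v huv ho => ?_⟩
          rcases (hN' u v).1 huv with h5 | ⟨rfl, rfl⟩ | ⟨rfl, rfl⟩ | ⟨rfl, rfl⟩ | ⟨rfl, rfl⟩
          · obtain ⟨k', hk', -⟩ := (hOn _ u v h5).1 ho
            cases hk'
          · simpa using (On1 _).1 ho
          · rfl
          · simpa using (On3 _).1 ho
          · exact (g2 p (hWI p hp) u hpI t₀ true true hlp hlp' a2 d2).symm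
        · refine ⟨s' q, fun u v huv ho => ?_⟩
          rcases (hN' u v).1 huv with h5 | ⟨rfl, rfl⟩ | ⟨rfl, rfl⟩ | ⟨rfl, rfl⟩ | ⟨rfl, rfl⟩
          · obtain ⟨k', hk', -⟩ := (hOn _ u v h5).1 ho
            cases hk'
          · rfl
          · simpa using (On2 _).1 ho
          · exact g2 u hqI q (hWI q hq) t₁ true true hlq' hlq a6 d5
          · simpa using (On4 _).1 ho
      intro s' _ g2 u v u' v' huv ho huv' ho'
      obtain ⟨w, hw⟩ := key s' g2
      rw [hw u v huv ho, hw u' v' huv' ho']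
  · intro w hw b
    obtain ⟨k, w', hw', b', hb', hk⟩ | ⟨e, hb'⟩ : (∃ k, ∃ w' ∈ W, ∃ b', fa' w b = .inl k ∧
        fa w' b' = k) ∨ ∃ e, fa' w b = .inr e := by
      rcases hsa w hw b with ⟨u₀, hu₀, e⟩ | hw'
      · exact Or.inl ⟨_, u₀, hu₀, b, e ▸ (ha u₀ hu₀ b).2.2, rfl⟩
      · exact Or.inr (hia w b hw')
    · rw [hb']
      have hco := h.coconn w' hw' b'
      rw [hk] at hco
      refine hco.transfer fun s' g1 g2 => ?_
      have i1 := g1 q p ((hN' _ _).2 (by simp))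
      have i2 := g1 p q' ((hN' _ _).2 (by simp))
      have i3 := g1 q' p' ((hN' _ _).2 (by simp))
      have i4 := g1 p' r ((hN' _ _).2 (by simp))
      rw [On1] at i1
      rw [On2] at i2
      rw [On3] at i3
      rw [On4] at i4
      simp only [reduceCtorEq, false_or, Sum.inl.injEq] at i1 i2 i3 i4
      -- An old label uses at most one of the four arcs between `q` and `r`. The colour of `p'` is
      -- needed only if this is the arc between `q'` and `p'`; then `k` arrives at `p'` by it.
      obtain ⟨s, z1, z2, z3⟩ : ∃ s : A → Bool, (k = fa p false → s p = s' p') ∧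
          (k ≠ fa p false → s p = s' p) ∧ (∀ u, u ≠ p → s u = s' u) :=
        ⟨fun u => if u = p then (if k = fa p false then s' p' else s' p) else s' u,
          fun hk => by simp [hk], fun hk => by simp [hk], fun u hu => by simp [hu]⟩
      have zq := z3 q hqp
      have zr := z3 r hrp
      have hA : ∀ u ∈ W, ∀ b, fa u b = k → s u = s' (ea u b) := by
        rintro u hu b rfl
        by_cases hup : u = p
        · subst hup
          rw [ea1]
          cases b
          · exact z1 rfl
          · rw [z2 na]
            have := i2 p1
            have := i3 na
            grind -ring -linarith -lia -order -ac
        by_cases hur : u = r ∧ b = false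
        · obtain ⟨rfl, rfl⟩ := hur
          rw [ea2, zr]
          have := i3 (by rw [← h3]; exact p3.symm)
          have := i4 (by rw [← h3]; exact p1.symm)
          grind -ring -linarith -lia -order -ac
        rw [ea3 u b hup hur]
        exact z3 u hup
      have hD : ∀ u ∈ W, ∀ b, fd u b = k → s u = s' (ed u b) := by
        rintro u hu b rfl
        by_cases huq : u = q ∧ b = true
        · obtain ⟨rfl, rfl⟩ := huq
          rw [ed1, zq]
          have := i1 (by rw [h1]; exact p4)
          have := i2 (by rw [h1]; exact p3)
          grind -ring -linarith -lia -order -ac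
        rw [ed2 u b huq]
        by_cases hup : u = p
        · subst hup
          cases b
          · exact z2 p4.symm
          · exact z2 p3.symm
        exact z3 u hup
      refine ⟨s, ?_, ?_, ?_⟩
      · intro u v huv ho
        rcases (hN u v).1 huv with h5 | ⟨rfl, rfl⟩ | ⟨rfl, rfl⟩
        · obtain ⟨b1, b2, b3, b4, b5, b6⟩ := hI u v h5
          rw [z3 u b3, z3 v b4]
          refine g1 u v ((hN' u v).2 (Or.inl h5)) fun ho' => ?_
          obtain ⟨k', hk', ho''⟩ := (hOn _ u v h5).1 ho'
          cases hk'
          exact ho ho''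
        · rw [O1] at ho
          push Not at ho
          rw [zq, z2 ho.1, i1 ho.2]
        · rw [O2] at ho
          push Not at ho
          rw [zr, ← i4 ho.2]
          by_cases hk : k = fa u false
          · exact z1 hk
          · rw [z2 hk, i2 ho.1, i3 hk]
      · intro u hu v hv t b c htu htv hb hc
        rw [hA u hu b hb, hD v hv c hc]
        obtain ⟨m1, l1, f1⟩ := ha u hu b
        obtain ⟨m2, l2, f2⟩ := hd v hv c
        exact g2 _ m1 _ m2 t b c (l1 ▸ htu) (l2 ▸ htv) (by rw [f1, hb]) (by rw [f2, hc])
      · have Nxq : N x q := (hN x q).2 (Or.inl hxq)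
        have Nry : N r y := (hN r y).2 (Or.inl hry)
        -- A dicycle leaves out at least one of the two old arcs at `q`, so the colour of `q` is
        -- seen on the old complement; the same holds at `r`.
        have hQ : ∃ u v, N u v ∧ ¬ OnLabel fa k u v ∧ (s' q = s u ∨ s' q = s v) := by
          by_cases ho : OnLabel fa k q p
          · rw [O1] at ho
            refine ⟨x, q, Nxq, ?_, Or.inr zq.symm⟩
            rw [OnLabel, ← h.bwd x q Nxq]
            push Not
            rcases ho with rfl | rfl
            · rw [← h1]; exact ⟨q1 _ _, qd⟩
            · rw [h2]; exact ⟨qa, (q1 _ _).symm⟩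
          · exact ⟨q, p, Nqp, ho, Or.inl zq.symm⟩
        have hR : ∃ u v, N u v ∧ ¬ OnLabel fa k u v ∧ (s' r = s u ∨ s' r = s v) := by
          by_cases ho : OnLabel fa k p r
          · rw [O2] at ho
            refine ⟨r, y, Nry, ?_, Or.inl zr.symm⟩
            rw [OnLabel, ← h.fwd r y Nry]
            push Not
            rcases ho with rfl | rfl
            · rw [h3]; exact ⟨(r1 _ _).symm, ra⟩
            · rw [← h4]; exact ⟨rd, r1 _ _⟩
          · exact ⟨p, r, Npr, ho, Or.inr zr.symm⟩
        intro u v huv ho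
        rcases (hN' u v).1 huv with h5 | ⟨rfl, rfl⟩ | ⟨rfl, rfl⟩ | ⟨rfl, rfl⟩ | ⟨rfl, rfl⟩
        · refine ⟨u, v, (hN u v).2 (Or.inl h5), fun ho' => ho ((hOn _ u v h5).2 ⟨k, rfl, ho'⟩),
            Or.inl (z3 u (hI u v h5).2.2.1).symm⟩
        · exact hQ
        · rw [On2] at ho
          by_cases hk : k = fd u false
          · have e : s' u = s' r := by grind -ring -linarith -lia -order -ac
            rw [e]; exact hR
          · rw [← i1 hk]; exact hQ
        · rw [On3] at ho
          by_cases hk : k = fa p true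
          · have e : s' u = s' q := by grind -ring -linarith -lia -order -ac
            rw [e]; exact hQ
          · have e : s' u = s' r := by grind -ring -linarith -lia -order -ac
            rw [e]; exact hR
        · rw [On4] at ho
          have e : s' u = s' v := i4 (by simpa using ho)
          rw [e]; exact hR
    · rw [hb']
      intro s' g1 g2
      -- The two arcs between `q` and `r` off the new dicycle, together with its two chords, join
      -- all of `q`, `p`, `q'`, `p'`, `r`. The old cycle then links the rest.
      have hall : s' q = s' p ∧ s' p = s' r ∧ s' q' = s' p ∧ s' p' = s' p := by
        cases e
        · have e1 := g1 q p ((hN' _ _).2 (by simp)) (by change ¬ _; rw [On1]; simp)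
          have e2 := g1 q' p' ((hN' _ _).2 (by simp)) (by change ¬ _; rw [On3]; simp)
          have e3 := g2 p (hWI p hp) p' hpI t₀ true true hlp hlp' a2 d2
          have e4 := g2 r (hWI r hr) q' hqI t₁ false false hlr hlq' a7 d3
          grind -ring -linarith -lia -order -ac
        · have e1 := g1 p q' ((hN' _ _).2 (by simp)) (by change ¬ _; rw [On2]; simp)
          have e2 := g1 p' r ((hN' _ _).2 (by simp)) (by change ¬ _; rw [On4]; simp)
          have e3 := g2 p (hWI p hp) p' hpI t₀ false false hlp hlp' a1 d1
          have e4 := g2 q' hqI q (hWI q hq) t₁ true true hlq' hlq a6 d5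
          grind -ring -linarith -lia -order -ac
      have hc := hcyc s' (by
        intro u v huv
        rcases (hN u v).1 huv with h5 | ⟨rfl, rfl⟩ | ⟨rfl, rfl⟩
        · refine g1 u v ((hN' u v).2 (Or.inl h5)) fun ho => ?_
          obtain ⟨k', hk', -⟩ := (hOn _ u v h5).1 ho
          cases hk'
        · exact hall.1
        · exact hall.2.1)
      have key : ∀ u v, N' u v → s' u = s' p := by
        intro u v huv
        rcases (hN' u v).1 huv with h5 | ⟨rfl, rfl⟩ | ⟨rfl, rfl⟩ | ⟨rfl, rfl⟩ | ⟨rfl, rfl⟩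
        · exact hc u (hI u v h5).1 p hp
        · exact hall.1
        · rfl
        · exact hall.2.2.1
        · exact hall.2.2.2
      intro u v u' v' huv _ huv' _
      rw [key u v huv, key u' v' huv']
  · intro t k s hs
    have hch : ∀ u ∈ W, ∀ v ∈ W, l u = some t → l v = some t → ∀ b c, fa u b = fd v c →
        .inl (fa u b) ≠ k → s (ea u b) = true → s (ed v c) = true := by
      intro u hu v hv htu htv b c hbc hk
      obtain ⟨m1, l1, f1⟩ := ha u hu b
      obtain ⟨m2, l2, f2⟩ := hd v hv c
      exact hs _ m1 _ m2 (l1 ▸ htu) (l2 ▸ htv) b c (by rw [f1, f2, hbc]) (by rwa [f1])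
    by_cases ht0 : t = t₀
    · subst ht0
      have htq : ∀ u, l u = some t → u ≠ q ∧ u ≠ r ∧ u ≠ q' :=
        fun u hu => ⟨hne hu hlq ht, hne hu hlr ht, hne hu hlq' ht⟩
      -- The old occurrence is split into `p`, where the old chords end, and `p'`, where they start.
      -- Two parallel new chords lead from `p` to `p'`, so one survives the removal of a label.
      have hpp : s p = true → s p' = true := by
        by_cases hk : k = .inr true
        · exact hs p (hWI p hp) p' hpI hlp hlp' true true (by rw [a2, d2]) (by rw [a2, hk]; simp)
        · exact hs p (hWI p hp) p' hpI hlp hlp' false false (by rw [a1, d1])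
            (by rw [a1]; exact fun e => hk e.symm)
      have hch' : ∀ u ∈ W, ∀ v ∈ W, l u = some t → l v = some t → ∀ b c, fa u b = fd v c →
          .inl (fa u b) ≠ k → (if u = p then s p' else s u) = true → s v = true := by
        intro u hu v hv htu htv b c hbc hk hsu
        have := hch u hu v hv htu htv b c hbc hk
        rw [ed2 v c (by simp [(htq v htv).1])] at this
        apply this
        by_cases hup : u = p
        · subst hup; simpa [ea1] using hsu
        · rw [ea3 u b hup (by simp [(htq u htu).2.1])]
          simpa [hup] using hsu
      have hW₀ : ∀ u ∈ W, l u = some t → (if u = p then s p' else s u) = s p' := by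
        have key := fun k₀ (hk₀ : ∀ k₁ : K, k₁ ≠ k₀ → (.inl k₁ : K ⊕ Bool) ≠ k) => h.cutLabel t k₀ (fun u => if u = p then s p' else s u)
          (fun u hu v hv htu htv b c hbc hk hsu => by
            have := hch' u hu v hv htu htv b c hbc (hk₀ _ hk) hsu
            by_cases hvp : v = p
            · subst hvp; simpa using hpp this
            · simpa [hvp] using this)
        intro u hu htu
        have h5 : ∃ k₀, ∀ k₁ : K, k₁ ≠ k₀ → (.inl k₁ : K ⊕ Bool) ≠ k := by
          rcases k with k | k
          · exact ⟨k, fun k₁ hk e => hk (Sum.inl.inj e)⟩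
          · exact ⟨fa p true, by simp⟩
        obtain ⟨k₀, hk₀⟩ := h5
        have := key k₀ hk₀ u hu p hp htu hlp
        simpa using this
      have hppe : s p = s p' := by
        rw [Bool.eq_iff_iff]
        refine ⟨hpp, fun hs' => ?_⟩
        obtain ⟨c, hc⟩ : ∃ c, .inl (fd p c) ≠ k := by
          by_cases hk : .inl (fd p true) = k
          · exact ⟨false, fun e => nd (Sum.inl.inj (hk.trans e.symm))⟩
          · exact ⟨true, hk⟩
        obtain ⟨u, hu, htu, b, hb⟩ := h.exa p hp t hlp c
        exact hch' u hu p hp htu hlp b c hb (by rwa [hb]) (by rw [hW₀ u hu htu, hs'])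
      have hall : ∀ u ∈ W', l u = some t → s u = s p' := by
        intro u hu htu
        rcases hu with rfl | rfl | hu
        · exact absurd rfl (htq _ htu).2.2
        · rfl
        · have := hW₀ u hu htu
          by_cases hup : u = p
          · rw [hup, hppe]
          · simpa [hup] using this
      intro u hu v hv htu htv
      rw [hall u hu htu, hall v hv htv]
    have htp : ∀ u, l u = some t → u ≠ p ∧ u ≠ p' :=
      fun u hu => ⟨hne hu hlp ht0, hne hu hlp' ht0⟩
    by_cases ht1 : t = t₁
    · subst ht1
      -- The old chord starting at the left side of `r` and the old chord ending at the right side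
      -- of `q` are rerouted through `q'`. Removing a new label therefore breaks only one old chord.
      have e1 : .inr true ≠ k → s q' = true → s q = true := fun hk =>
        hs q' hqI q (hWI q hq) hlq' hlq true true (by rw [a6, d5]) (by rwa [a6])
      have e2 : .inr false ≠ k → s r = true → s q' = true := fun hk =>
        hs r (hWI r hr) q' hqI hlr hlq' false false (by rw [a7, d3]) (by rwa [a7])
      have hrq : fa r false ≠ fd q true := by rw [← h3, h1]; exact p3.symm
      have hch' : ∀ u ∈ W, ∀ v ∈ W, l u = some t → l v = some t → ∀ b c, fa u b = fd v c →
          .inl (fa u b) ≠ k → (.inr true = k → fa u b ≠ fd q true) →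
          (.inr false = k → fa u b ≠ fa r false) → s u = true → s v = true := by
        intro u hu v hv htu htv b c hbc hk k1 k2 hsu
        have h5 := hch u hu v hv htu htv b c hbc hk
        have h6 : s (ea u b) = true := by
          by_cases hur : u = r ∧ b = false
          · obtain ⟨rfl, rfl⟩ := hur
            rw [ea2]
            exact e2 (fun e => k2 e rfl) hsu
          · rwa [ea3 u b (htp u htu).1 hur]
        have h7 := h5 h6
        by_cases hvq : v = q ∧ c = true
        · obtain ⟨rfl, rfl⟩ := hvq
          rw [ed1] at h7
          exact e1 (fun e => k1 e hbc) h7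
        · rwa [ed2 v c hvq] at h7
      have hW₀ : ∀ u ∈ W, ∀ v ∈ W, l u = some t → l v = some t → s u = s v := by
        rcases k with k | k | k
        · exact h.cutLabel t k s fun u hu v hv htu htv b c hbc hk =>
            hch' u hu v hv htu htv b c hbc (by simpa using hk) (by simp) (by simp)
        · exact h.cutLabel t (fa r false) s fun u hu v hv htu htv b c hbc hk =>
            hch' u hu v hv htu htv b c hbc (by simp) (by simp) (fun _ => hk)
        · exact h.cutLabel t (fd q true) s fun u hu v hv htu htv b c hbc hk =>
            hch' u hu v hv htu htv b c hbc (by simp) (fun _ => hk) (by simp)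
      have hqe : s q' = s q := by
        rw [Bool.eq_iff_iff]
        constructor
        · by_cases hk : .inr true = k
          · obtain ⟨v, hv, htv, c, hc⟩ := h.exd r hr t hlr false
            have h5 := hch r hr v hv hlr htv false c hc.symm (by rw [← hk]; simp)
            rw [ea2, ed2 v c (by rintro ⟨rfl, rfl⟩; exact hrq hc.symm)] at h5
            rwa [hW₀ q hq v hv hlq htv]
          · exact e1 hk
        · by_cases hk : .inr false = k
          · obtain ⟨u, hu, htu, b, hb⟩ := h.exa q hq t hlq true
            have h5 := hch u hu q hq htu hlq b true hb (by rw [← hk]; simp)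
            rw [ed1, ea3 u b (htp u htu).1 (by rintro ⟨rfl, rfl⟩; exact hrq hb)] at h5
            rwa [hW₀ q hq u hu hlq htu]
          · rw [hW₀ q hq r hr hlq hlr]
            exact e2 hk
      have hall : ∀ u ∈ W', l u = some t → s u = s q := by
        intro u hu htu
        rcases hu with rfl | rfl | hu
        · exact hqe
        · exact absurd rfl (htp _ htu).2
        · exact hW₀ u hu q hq htu hlq
      intro u hu v hv htu htv
      rw [hall u hu htu, hall v hv htv]
    have htq : ∀ u, l u = some t → u ≠ q ∧ u ≠ r ∧ u ≠ q' :=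
      fun u hu => ⟨hne hu hlq ht1, hne hu hlr ht1, hne hu hlq' ht1⟩
    have h5 : ∃ k₀, ∀ k₁ : K, k₁ ≠ k₀ → (.inl k₁ : K ⊕ Bool) ≠ k := by
      rcases k with k | k
      · exact ⟨k, fun k₁ hk e => hk (Sum.inl.inj e)⟩
      · exact ⟨fa p true, by simp⟩
    obtain ⟨k₀, hk₀⟩ := h5
    have key := h.cutLabel t k₀ s (fun u hu v hv htu htv b c hbc hk => by
      have := hch u hu v hv htu htv b c hbc (hk₀ _ hk)
      rwa [ea3 u b (htp u htu).1 (by simp [(htq u htu).2.1]),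
        ed2 v c (by simp [(htq v htv).1])] at this)
    have hsub : ∀ u ∈ W', l u = some t → u ∈ W := by
      intro u hu htu
      rcases hu with rfl | rfl | hu
      · exact absurd rfl (htq _ htu).2.2
      · exact absurd rfl (htp _ htu).2
      · exact hu
    intro u hu v hv htu htv
    exact key u (hsub u hu htu) v (hsub v hv htv) htu htv
  · intro t p₀ s hs1 hs2
    have hch : ∀ u ∈ W, ∀ v ∈ W, l u = some t → l v = some t → ∀ b c, fa u b = fd v c →
        s (ea u b) b = true → s (ed v c) c = true := by
      intro u hu v hv htu htv b c hbc
      obtain ⟨m1, l1, f1⟩ := ha u hu b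
      obtain ⟨m2, l2, f2⟩ := hd v hv c
      exact hs2 _ m1 _ m2 (l1 ▸ htu) (l2 ▸ htv) b c (by rw [f1, f2, hbc])
    by_cases ht0 : t = t₀
    · subst ht0
      have htq : ∀ u, l u = some t → u ≠ q ∧ u ≠ r ∧ u ≠ q' :=
        fun u hu => ⟨hne hu hlq ht, hne hu hlr ht, hne hu hlq' ht⟩
      have hpp : ∀ b, s p b = true → s p' b = true := by
        intro b
        cases b
        · exact hs2 p (hWI p hp) p' hpI hlp hlp' false false (by rw [a1, d1])
        · exact hs2 p (hWI p hp) p' hpI hlp hlp' true true (by rw [a2, d2])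
      have hch' : ∀ u ∈ W, ∀ v ∈ W, l u = some t → l v = some t → ∀ b c, fa u b = fd v c →
          (if u = p then s p' b else s u b) = true → s v c = true := by
        intro u hu v hv htu htv b c hbc hsu
        have := hch u hu v hv htu htv b c hbc
        rw [ed2 v c (by simp [(htq v htv).1])] at this
        apply this
        by_cases hup : u = p
        · subst hup; simpa [ea1] using hsu
        · rw [ea3 u b hup (by simp [(htq u htu).2.1])]
          simpa [hup] using hsu
      -- The old colouring at `p` is that of `p'`, so a split of `p'` becomes a split of the old
      -- `p`.
      have hW₀ := h.cutPosition t (if p₀ = p' then p else p₀)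
        (fun u b => if u = p then s p' b else s u b)
        (fun u hu htu hup => by
          by_cases hup' : u = p
          · subst hup'
            simpa using hs1 p' hpI hlp' (fun e => hup (by simp [← e]))
          · by_cases hp0 : p₀ = p'
            · simpa [hup'] using hs1 u (hWI u hu) htu (fun e => hpW u hu (e.trans hp0))
            · simpa [hup'] using hs1 u (hWI u hu) htu (by simpa [hp0] using hup))
        (fun u hu v hv htu htv b c hbc hsu => by
            have := hch' u hu v hv htu htv b c hbc hsu
            by_cases hvp : v = p
            · subst hvp; simpa using hpp c this
            · simpa [hvp] using this)
      have hW₁ : ∀ u ∈ W, l u = some t → ∀ b c, (if u = p then s p' b else s u b) = s p' c := by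
        intro u hu htu b c
        simpa using hW₀ u hu p hp htu hlp b c
      have hppe : ∀ c, s p c = s p' c := by
        intro c
        rw [Bool.eq_iff_iff]
        refine ⟨hpp c, fun hs' => ?_⟩
        obtain ⟨u, hu, htu, b, hb⟩ := h.exa p hp t hlp c
        exact hch' u hu p hp htu hlp b c hb (by rw [hW₁ u hu htu b c, hs'])
      have hall : ∀ u ∈ W', l u = some t → ∀ b, s u b = s p' true := by
        intro u hu htu b
        rcases hu with rfl | rfl | hu
        · exact absurd rfl (htq _ htu).2.2
        · simpa using hW₁ p hp hlp b true
        · have := hW₁ u hu htu b true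
          by_cases hup : u = p
          · subst hup
            rw [hppe]
            simpa using this
          · simpa [hup] using this
      intro u hu v hv htu htv b c
      rw [hall u hu htu, hall v hv htv]
    have htp : ∀ u, l u = some t → u ≠ p ∧ u ≠ p' :=
      fun u hu => ⟨hne hu hlp ht0, hne hu hlp' ht0⟩
    by_cases ht1 : t = t₁
    · subst ht1
      have e1 : s q' true = true → s q true = true :=
        hs2 q' hqI q (hWI q hq) hlq' hlq true true (by rw [a6, d5])
      have e2 : s r false = true → s q' false = true :=
        hs2 r (hWI r hr) q' hqI hlr hlq' false false (by rw [a7, d3])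
      have hrq : fa r false ≠ fd q true := by rw [← h3, h1]; exact p3.symm
      have hch' : ∀ u ∈ W, ∀ v ∈ W, l u = some t → l v = some t → ∀ b c, fa u b = fd v c →
          s u b = true → s v c = true := by
        intro u hu v hv htu htv b c hbc hsu
        have h5 := hch u hu v hv htu htv b c hbc
        have h6 : s (ea u b) b = true := by
          by_cases hur : u = r ∧ b = false
          · obtain ⟨rfl, rfl⟩ := hur
            rw [ea2]
            exact e2 hsu
          · rwa [ea3 u b (htp u htu).1 hur]
        have h7 := h5 h6
        by_cases hvq : v = q ∧ c = true
        · obtain ⟨rfl, rfl⟩ := hvq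
          rw [ed1] at h7
          exact e1 h7
        · rwa [ed2 v c hvq] at h7
      have hW₀ := h.cutPosition t p₀ s (fun u hu => hs1 u (hWI u hu)) hch'
      have hqe : ∀ b, s q' b = s q true := by
        intro b
        rw [Bool.eq_iff_iff]
        cases b
        · constructor
          · obtain ⟨v, hv, htv, c, hc⟩ := h.exd r hr t hlr false
            have h5 := hch r hr v hv hlr htv false c hc.symm
            rw [ea2, ed2 v c (by rintro ⟨rfl, rfl⟩; exact hrq hc.symm)] at h5
            rwa [hW₀ q hq v hv hlq htv true c]
          · rw [hW₀ q hq r hr hlq hlr true false]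
            exact e2
        · refine ⟨e1, ?_⟩
          obtain ⟨u, hu, htu, b, hb⟩ := h.exa q hq t hlq true
          have h5 := hch u hu q hq htu hlq b true hb
          rw [ed1, ea3 u b (htp u htu).1 (by rintro ⟨rfl, rfl⟩; exact hrq hb)] at h5
          rwa [hW₀ q hq u hu hlq htu true b]
      have hall : ∀ u ∈ W', l u = some t → ∀ b, s u b = s q true := by
        intro u hu htu b
        rcases hu with rfl | rfl | hu
        · exact hqe b
        · exact absurd rfl (htp _ htu).2
        · exact hW₀ u hu q hq htu hlq b true
      intro u hu v hv htu htv b c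
      rw [hall u hu htu, hall v hv htv]
    have htq : ∀ u, l u = some t → u ≠ q ∧ u ≠ r ∧ u ≠ q' :=
      fun u hu => ⟨hne hu hlq ht1, hne hu hlr ht1, hne hu hlq' ht1⟩
    have key := h.cutPosition t p₀ s (fun u hu => hs1 u (hWI u hu))
      (fun u hu v hv htu htv b c hbc => by
        have := hch u hu v hv htu htv b c hbc
        rwa [ea3 u b (htp u htu).1 (by simp [(htq u htu).2.1]),
          ed2 v c (by simp [(htq v htv).1])] at this)
    have hsub : ∀ u ∈ W', l u = some t → u ∈ W := by
      intro u hu htu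
      rcases hu with rfl | rfl | hu
      · exact absurd rfl (htq _ htu).2.2
      · exact absurd rfl (htp _ htu).2
      · exact hu
    intro u hu v hv htu htv
    exact key u (hsub u hu htu) v (hsub v hv htv) htu htv

/-- A word with two positions that have the same letter. -/
theorem GoodLabelling.pair {A B : Type*} {l : A → Option B} {W : Set A} {N : A → A → Prop}
    {a b : A} (hab : a ≠ b) {t : B} (hla : l a = some t) (hlb : l b = some t)
    (hW : ∀ u, u ∈ W ↔ u = a ∨ u = b)
    (hN : ∀ u v, N u v ↔ (u = a ∧ v = b) ∨ (u = b ∧ v = a)) :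
    ∃ fa fd : A → Bool → Fin 4, GoodLabelling l W N fa fd := by
  classical
  -- Each of the four directed arcs is closed by a chord into a dicycle of its own.
  obtain ⟨fa, a1, a2, a3, a4⟩ : ∃ f : A → Bool → Fin 4, f b false = 0 ∧ f a true = 1 ∧
      f a false = 2 ∧ f b true = 3 :=
    ⟨fun u c => if u = a then (if c then 1 else 2) else (if c then 3 else 0),
      by simp [hab.symm], by simp, by simp, by simp [hab.symm]⟩
  obtain ⟨fd, d1, d2, d3, d4⟩ : ∃ f : A → Bool → Fin 4, f a true = 0 ∧ f b false = 1 ∧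
      f b true = 2 ∧ f a false = 3 :=
    ⟨fun u c => if u = a then (if c then 0 else 3) else (if c then 2 else 1),
      by simp, by simp [hab.symm], by simp [hab.symm], by simp⟩
  have ha : a ∈ W := (hW a).2 (Or.inl rfl)
  have hb : b ∈ W := (hW b).2 (Or.inr rfl)
  have hlt : ∀ u ∈ W, l u = some t := by
    intro u hu
    rcases (hW u).1 hu with rfl | rfl <;> assumption
  have hall : ∀ s : A → Bool, s a = s b → ∀ u ∈ W, ∀ v ∈ W, s u = s v := by
    intro s hs u hu v hv
    rcases (hW u).1 hu with rfl | rfl <;> rcases (hW v).1 hv with rfl | rfl <;> simp [hs]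
  have hch : ∀ k, ∀ s : A → Bool, (∀ u ∈ W, ∀ v ∈ W, ∀ t b c, l u = some t → l v = some t →
      fa u b = k → fd v c = k → s u = s v) → s a = s b := by
    intro k s h
    match k with
    | 0 => exact (h b hb a ha t false true hlb hla a1 d1).symm
    | 1 => exact h a ha b hb t true false hla hlb a2 d2
    | 2 => exact h a ha b hb t false true hla hlb a3 d3
    | 3 => exact (h b hb a ha t true false hlb hla a4 d4).symm
  have hmem : ∀ u v, N u v → u ∈ W := by
    intro u v huv
    rcases (hN u v).1 huv with ⟨rfl, rfl⟩ | ⟨rfl, rfl⟩ <;> assumption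
  refine ⟨fa, fd, ⟨⟨?_, ?_, ?_, ?_, ?_, ?_, ?_, ?_, ?_⟩, ?_, ?_, ?_, ?_⟩⟩
  · intro u v huv
    rcases (hN u v).1 huv with ⟨rfl, rfl⟩ | ⟨rfl, rfl⟩ <;> simp [*]
  · intro u v huv
    rcases (hN u v).1 huv with ⟨rfl, rfl⟩ | ⟨rfl, rfl⟩ <;> simp [*]
  · intro u hu hlu
    rw [hlt u hu] at hlu
    cases hlu
  · intro u hu c
    rcases (hW u).1 hu with rfl | rfl <;> cases c <;> simp [*]
  · intro u hu t ht c d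
    rcases (hW u).1 hu with rfl | rfl <;> cases c <;> cases d <;> simp [*]
  · intro u hu v hv t _ _ c d
    rcases (hW u).1 hu with rfl | rfl <;> rcases (hW v).1 hv with rfl | rfl <;> cases c <;>
      cases d <;> simp [a1, a2, a3, a4]
  · intro u hu v hv t _ _ c d
    rcases (hW u).1 hu with rfl | rfl <;> rcases (hW v).1 hv with rfl | rfl <;> cases c <;>
      cases d <;> simp [d1, d2, d3, d4]
  · intro u hu t' ht' c
    rcases (hW u).1 hu with rfl | rfl
    · refine ⟨b, hb, by rw [hlb, ← ht', hla], !c, ?_⟩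
      cases c <;> simp [*]
    · refine ⟨a, ha, by rw [hla, ← ht', hlb], !c, ?_⟩
      cases c <;> simp [*]
  · intro u hu t' ht' c
    rcases (hW u).1 hu with rfl | rfl
    · refine ⟨b, hb, by rw [hlb, ← ht', hla], !c, ?_⟩
      cases c <;> simp [*]
    · refine ⟨a, ha, by rw [hla, ← ht', hlb], !c, ?_⟩
      cases c <;> simp [*]
  · intro k s _ h2 u v u' v' huv _ huv' _
    exact hall s (hch k s h2) u (hmem u v huv) u' (hmem u' v' huv')
  · intro w _ c s _ h2 u v u' v' huv _ huv' _
    exact hall s (hch _ s h2) u (hmem u v huv) u' (hmem u' v' huv')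
  · intro t' k s hs u hu v hv htu htv
    obtain rfl : t' = t := Option.some.inj (htu.symm.trans (hlt u hu))
    refine hall s ?_ u hu v hv
    rw [Bool.eq_iff_iff]
    constructor
    · by_cases hk : k = 1
      · exact hs a ha b hb hla hlb false true (by rw [a3, d3]) (by rw [a3, hk]; decide)
      · exact hs a ha b hb hla hlb true false (by rw [a2, d2]) (by rw [a2]; exact Ne.symm hk)
    · by_cases hk : k = 0
      · exact hs b hb a ha hlb hla true false (by rw [a4, d4]) (by rw [a4, hk]; decide)
      · exact hs b hb a ha hlb hla false true (by rw [a1, d1]) (by rw [a1]; exact Ne.symm hk)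
  · intro t' p₀ s hs1 hs2 u hu v hv htu htv c d
    obtain rfl : t' = t := Option.some.inj (htu.symm.trans (hlt u hu))
    have e1 : s a false = s b true := Bool.eq_iff_iff.2
      ⟨hs2 a ha b hb hla hlb false true (by rw [a3, d3]),
        hs2 b hb a ha hlb hla true false (by rw [a4, d4])⟩
    have e2 : s a true = s b false := Bool.eq_iff_iff.2
      ⟨hs2 a ha b hb hla hlb true false (by rw [a2, d2]),
        hs2 b hb a ha hlb hla false true (by rw [a1, d1])⟩
    have e3 : s a true = s a false := by
      by_cases h0 : a = p₀
      · rw [e2, e1]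
        exact (hs1 b hb hlb (fun e => hab (h0.trans e.symm))).symm
      · exact hs1 a ha hla h0
    have key : ∀ u ∈ W, ∀ c, s u c = s a false := by
      intro u hu c
      rcases (hW u).1 hu with rfl | rfl <;> cases c
      · rfl
      · exact e3
      · rw [← e2, e3]
      · rw [← e1]
    rw [key u hu, key v hv]

/-! ### Cyclic words as lists up to rotation -/

/-- The pairs of consecutive entries of a list. -/
def arcPairs {A : Type*} : List A → List (A × A)
  | a :: b :: w => (a, b) :: arcPairs (b :: w)
  | _ => []

/-- `v` follows `u` in the cyclic word `w`. -/
def CyclicNext {A : Type*} : List A → A → A → Prop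
  | [], _, _ => False
  | a :: w, u, v => (u, v) ∈ arcPairs (a :: (w ++ [a]))

theorem mem_arcPairs_cons {A : Type*} {a u v : A} {w : List A} :
    (u, v) ∈ arcPairs (a :: w) ↔ (u = a ∧ w.head? = some v) ∨ (u, v) ∈ arcPairs w := by
  cases w with
  | nil => simp [arcPairs]
  | cons b w => simp [arcPairs, eq_comm]

theorem mem_arcPairs_concat {A : Type*} {a u v : A} {w : List A} :
    (u, v) ∈ arcPairs (w ++ [a]) ↔ (u, v) ∈ arcPairs w ∨ (w.getLast? = some u ∧ v = a) := by
  induction w with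
  | nil => simp [arcPairs]
  | cons b w ih =>
    rw [List.cons_append, mem_arcPairs_cons, mem_arcPairs_cons, ih]
    cases w with
    | nil => simp [arcPairs, eq_comm]
    | cons c w => simp [List.getLast?_cons_cons, or_assoc]

theorem mem_of_mem_arcPairs {A : Type*} {u v : A} {w : List A} (h : (u, v) ∈ arcPairs w) :
    u ∈ w ∧ v ∈ w := by
  induction w with
  | nil => simp [arcPairs] at h
  | cons a w ih =>
    rcases mem_arcPairs_cons.1 h with ⟨rfl, h'⟩ | h
    · exact ⟨by simp, List.mem_cons_of_mem _ (List.mem_of_mem_head? h')⟩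
    · exact ⟨List.mem_cons_of_mem _ (ih h).1, List.mem_cons_of_mem _ (ih h).2⟩

theorem eq_of_arcPairs {A : Type*} {w : List A} {s : A → Bool}
    (h : ∀ u v, (u, v) ∈ arcPairs w → s u = s v) : ∀ u ∈ w, ∀ v ∈ w, s u = s v := by
  induction w with
  | nil => simp
  | cons a w ih =>
    have ih' := ih fun u v huv => h u v (mem_arcPairs_cons.2 (Or.inr huv))
    cases w with
    | nil => simp
    | cons b w =>
      have hab := h a b (by simp [arcPairs])
      have key : ∀ u ∈ a :: b :: w, s u = s b := by
        intro u hu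
        rcases List.mem_cons.1 hu with rfl | hu
        · exact hab
        · exact ih' u hu b (by simp)
      intro u hu v hv
      rw [key u hu, key v hv]

theorem cyclicNext_cons {A : Type*} {a u v : A} {w : List A} :
    CyclicNext (a :: w) u v ↔ (u, v) ∈ arcPairs (a :: (w ++ [a])) := Iff.rfl

theorem eq_of_cyclicNext {A : Type*} {w : List A} {s : A → Bool}
    (h : ∀ u v, CyclicNext w u v → s u = s v) : ∀ u ∈ w, ∀ v ∈ w, s u = s v := by
  cases w with
  | nil => simp
  | cons a w =>
    have := eq_of_arcPairs (w := a :: (w ++ [a])) h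
    intro u hu v hv
    exact this u (by simp at hu ⊢; tauto) v (by simp at hv ⊢; tauto)

theorem cyclicNext_rotate_one {A : Type*} {a u v : A} {w : List A} :
    CyclicNext (w ++ [a]) u v ↔ CyclicNext (a :: w) u v := by
  cases w with
  | nil => rfl
  | cons b w =>
    change (u, v) ∈ arcPairs ((b :: (w ++ [a])) ++ [b]) ↔
      (u, v) ∈ arcPairs (a :: ((b :: w) ++ [a]))
    rw [mem_arcPairs_cons (a := a), mem_arcPairs_concat]
    have e : (b :: (w ++ [a])).getLast? = some a := by
      rw [← List.cons_append, List.getLast?_concat]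
    rw [e]
    simp only [List.cons_append, List.head?_cons, Option.some.injEq]
    grind

theorem cyclicNext_isRotated {A : Type*} {w w' : List A} (h : w ~r w') {u v : A} :
    CyclicNext w u v ↔ CyclicNext w' u v := by
  obtain ⟨n, rfl⟩ := h
  induction n with
  | zero => simp
  | succ n ih =>
    rw [ih, ← List.rotate_rotate]
    generalize w.rotate n = w
    cases w with
    | nil => simp
    | cons a w => simp [cyclicNext_rotate_one]

/-- The cyclic word `w` has a good labelling. -/
def HasGoodLabelling {A B : Type*} (l : A → Option B) (w : List A) : Prop :=
  ∃ (K : Type) (fa fd : A → Bool → K), GoodLabelling l {x | x ∈ w} (CyclicNext w) fa fd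

theorem HasGoodLabelling.of_isRotated {A B : Type*} {l : A → Option B} {w w' : List A}
    (h : HasGoodLabelling l w) (hr : w ~r w') : HasGoodLabelling l w' := by
  obtain ⟨K, fa, fd, h⟩ := h
  have e1 : {x | x ∈ w'} = {x | x ∈ w} := by ext x; exact hr.mem_iff.symm
  have e2 : CyclicNext w' = CyclicNext w := by
    ext u v; exact (cyclicNext_isRotated hr).symm
  exact ⟨K, fa, fd, by rwa [e1, e2]⟩

theorem HasGoodLabelling.cons_none {A B : Type*} {l : A → Option B} {w : List A} {z : A}
    (h : HasGoodLabelling l w) (hw : w ≠ []) (hz : z ∉ w) (hl : l z = none) :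
    HasGoodLabelling l (z :: w) := by
  obtain ⟨K, fa, fd, h⟩ := h
  have hy := List.head?_eq_some_head hw
  have hx := List.getLast?_eq_some_getLast hw
  -- The arcs within the list are kept as `I`; only the closing arc from the last entry to the first
  -- is subdivided.
  obtain ⟨fa', fd', h'⟩ := h.insert_none (N' := CyclicNext (z :: w)) (z := z)
    (I := fun u v => (u, v) ∈ arcPairs w) (x := w.getLast hw) (y := w.head hw)
    (fun u v huv => mem_of_mem_arcPairs huv) (by simp) (by simp) hz
    (by
      intro u v
      cases w with
      | nil => exact absurd rfl hw
      | cons a w =>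
        rw [cyclicNext_cons, ← List.cons_append, mem_arcPairs_concat, hx]
        simp [eq_comm])
    (by
      intro u v
      rw [cyclicNext_cons, mem_arcPairs_cons, mem_arcPairs_concat, hx]
      simp only [List.head?_append, hy, Option.some_or, Option.some.injEq]
      grind) hl
  refine ⟨K, fa', fd', ?_⟩
  convert h' using 1
  ext u; simp

theorem HasGoodLabelling.cons_same {A B : Type*} {l : A → Option B} {w : List A} {p q : A}
    (h : HasGoodLabelling l (p :: w)) (hw : w ≠ []) (hp : p ∉ w) (hq : q ∉ p :: w) {t : B}
    (hlp : l p = some t) (hlq : l q = some t) : HasGoodLabelling l (p :: q :: w) := by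
  obtain ⟨K, fa, fd, h⟩ := h
  have hy := List.head?_eq_some_head hw
  have hx := List.getLast?_eq_some_getLast hw
  have hy' : w.head hw ∈ w := by simp
  have hx' : w.getLast hw ∈ w := by simp
  obtain ⟨fa', fd', h'⟩ := h.insert_same (N' := CyclicNext (p :: q :: w)) (q := q) (p := p)
    (I := fun u v => (u, v) ∈ arcPairs w ∨ (u = w.getLast hw ∧ v = p)) (x := w.getLast hw)
    (y := w.head hw)
    (by
      rintro u v (huv | ⟨rfl, rfl⟩)
      · have := mem_of_mem_arcPairs huv
        exact ⟨List.mem_cons_of_mem _ this.1, List.mem_cons_of_mem _ this.2,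
          fun e => hp (e ▸ this.1)⟩
      · exact ⟨List.mem_cons_of_mem _ hx', by simp, fun e => hp (e ▸ hx')⟩)
    (by simp) (List.mem_cons_of_mem _ hy') hq (fun e => hp (e ▸ hy')) (Or.inr ⟨rfl, rfl⟩)
    (by
      intro u v
      rw [cyclicNext_cons, mem_arcPairs_cons, mem_arcPairs_concat, hx]
      simp only [List.head?_append, hy, Option.some_or, Option.some.injEq]
      grind)
    (by
      intro u v
      rw [cyclicNext_cons, List.cons_append, mem_arcPairs_cons, mem_arcPairs_cons,
        mem_arcPairs_concat, hx]
      simp only [List.head?_append, List.head?_cons, hy, Option.some_or, Option.some.injEq]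
      grind) (fun s hs => eq_of_cyclicNext hs) hlp hlq
  refine ⟨K ⊕ Bool, fa', fd', ?_⟩
  convert h' using 1
  ext u; simp; tauto

theorem HasGoodLabelling.cons_around {A B : Type*} {l : A → Option B} {w : List A} {q p r : A}
    (h : HasGoodLabelling l (p :: w)) (hw : w ≠ []) (hp : p ∉ w) (hq : q ∉ p :: w)
    (hr : r ∉ p :: w) (hqr : q ≠ r) {t₀ t₁ : B} (hlp : l p = some t₀) (hlq : l q = some t₁)
    (hlr : l r = some t₁) (hlw : ∀ u ∈ p :: w, l u ≠ some t₁) :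
    HasGoodLabelling l (q :: p :: r :: w) := by
  obtain ⟨K, fa, fd, h⟩ := h
  have hy := List.head?_eq_some_head hw
  have hx := List.getLast?_eq_some_getLast hw
  have hy' : w.head hw ∈ w := by simp
  have hx' : w.getLast hw ∈ w := by simp
  obtain ⟨fa', fd', h'⟩ := h.insert_around (N' := CyclicNext (q :: p :: r :: w)) (q := q) (p := p)
    (r := r) (I := fun u v => (u, v) ∈ arcPairs w) (x := w.getLast hw) (y := w.head hw)
    (by
      intro u v huv
      have := mem_of_mem_arcPairs huv
      exact ⟨List.mem_cons_of_mem _ this.1, List.mem_cons_of_mem _ this.2,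
          fun e => hp (e ▸ this.1), fun e => hp (e ▸ this.2)⟩)
    (by simp) (List.mem_cons_of_mem _ hx') (List.mem_cons_of_mem _ hy') (fun e => hp (e ▸ hx'))
    (fun e => hp (e ▸ hy')) hq hr hqr
    (by
      intro u v
      rw [cyclicNext_cons, mem_arcPairs_cons, mem_arcPairs_concat, hx]
      simp only [List.head?_append, hy, Option.some_or, Option.some.injEq]
      grind)
    (by
      intro u v
      rw [cyclicNext_cons, List.cons_append, List.cons_append, mem_arcPairs_cons,
        mem_arcPairs_cons, mem_arcPairs_cons, mem_arcPairs_concat, hx]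
      simp only [List.head?_append, List.head?_cons, hy, Option.some_or, Option.some.injEq]
      grind) hlp hlq hlr hlw
  refine ⟨K, fa', fd', ?_⟩
  convert h' using 1
  ext u; simp; tauto

theorem HasGoodLabelling.cons_alternating {A B : Type*} {l : A → Option B} {w : List A}
    {q p r q' p' : A} (h : HasGoodLabelling l (q :: p :: r :: w)) (hn : (q :: p :: r :: w).Nodup)
    (hq' : q' ∉ q :: p :: r :: w) (hp' : p' ∉ q :: p :: r :: w) {t₀ t₁ : B} (ht : t₀ ≠ t₁)
    (hlp : l p = some t₀) (hlp' : l p' = some t₀)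
    (hlq : l q = some t₁) (hlr : l r = some t₁) (hlq' : l q' = some t₁) :
    HasGoodLabelling l (q :: p :: q' :: p' :: r :: w) := by
  obtain ⟨K, fa, fd, h⟩ := h
  obtain ⟨y, hy⟩ : ∃ y, (w ++ [q]).head? = some y := ⟨_, List.head?_eq_some_head (by simp)⟩
  obtain ⟨x, hx⟩ : ∃ x, (r :: w).getLast? = some x := ⟨_, List.getLast?_eq_some_getLast (by simp)⟩
  have hx' : x ∈ r :: w := List.mem_of_mem_getLast? hx
  have key : ∀ u v, (u, v) ∈ arcPairs (r :: (w ++ [q])) →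
      u ∈ q :: p :: r :: w ∧ v ∈ q :: p :: r :: w ∧ u ≠ p ∧ v ≠ p ∧ u ≠ q ∧ v ≠ r := by
    intro u v huv
    have hn1 : ∀ v', (r :: (w ++ [q])).Nodup → (u, v') ∈ arcPairs (r :: (w ++ [q])) → v' ≠ r := by
      rintro v' hn' huv rfl
      rcases mem_arcPairs_cons.1 huv with ⟨-, h⟩ | h
      · exact (List.nodup_cons.1 hn').1 (List.mem_of_mem_head? h)
      · exact (List.nodup_cons.1 hn').1 (mem_of_mem_arcPairs h).2
    have hn2 : (r :: (w ++ [q])).Nodup := by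
      simp at hn ⊢; grind
    have hv := hn1 v hn2 huv
    have h1 := mem_of_mem_arcPairs huv
    have hu : u ≠ q := by
      rintro rfl
      rw [← List.cons_append, mem_arcPairs_concat, ] at huv
      simp at hn
      rcases huv with huv | ⟨huv, -⟩
      · have := (mem_of_mem_arcPairs huv).1
        simp at this; grind
      · have := List.mem_of_mem_getLast? huv
        simp at this; grind
    simp at hn h1 ⊢
    grind
  obtain ⟨fa', fd', h'⟩ := h.insert_alternating (N' := CyclicNext (q :: p :: q' :: p' :: r :: w))
    (q := q) (p := p) (r := r) (q' := q') (p' := p')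
    (I := fun u v => (u, v) ∈ arcPairs (r :: (w ++ [q]))) (x := x) (y := y)
    key (by simp) (by simp) (by simp) (by simp at hn; tauto)
    (by rw [← List.cons_append, mem_arcPairs_concat]; exact Or.inr ⟨hx, rfl⟩)
    (mem_arcPairs_cons.2 (Or.inl ⟨rfl, hy⟩)) hq' hp'
    (by
      intro u v
      rw [cyclicNext_cons, List.cons_append, List.cons_append, mem_arcPairs_cons,
        mem_arcPairs_cons (a := p)]
      simp only [List.head?_cons, Option.some.injEq]
      grind)
    (by
      intro u v
      rw [cyclicNext_cons]
      simp only [List.cons_append]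
      rw [mem_arcPairs_cons, mem_arcPairs_cons (a := p), mem_arcPairs_cons (a := q'),
        mem_arcPairs_cons (a := p')]
      simp only [List.head?_cons, Option.some.injEq]
      grind) (fun s hs => eq_of_cyclicNext hs) ht hlp hlp' hlq hlr hlq'
  refine ⟨K ⊕ Bool, fa', fd', ?_⟩
  convert h' using 1
  ext u; simp; tauto

theorem HasGoodLabelling.pair {A B : Type*} {l : A → Option B} {p q : A} (hpq : p ≠ q) {t : B}
    (hlp : l p = some t) (hlq : l q = some t) : HasGoodLabelling l [p, q] := by
  obtain ⟨fa, fd, h⟩ := GoodLabelling.pair (W := {x | x ∈ [p, q]}) (N := CyclicNext [p, q]) hpq hlp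
    hlq (by simp) (by simp [cyclicNext_cons, arcPairs])
  exact ⟨_, fa, fd, h⟩

/-! ### Crossing letters, tree words and their shortenings -/

/-- Two distinct letters cross in a cyclic word if their occurrences alternate somewhere. -/
def Crosses {B : Type*} (w : List B) (a b : B) : Prop :=
  a ≠ b ∧ (List.Sublist [a, b, a, b] w ∨ List.Sublist [b, a, b, a] w)

theorem Crosses.symm {B : Type*} {w : List B} {a b : B} (h : Crosses w a b) : Crosses w b a :=
  ⟨h.1.symm, h.2.symm⟩

theorem Crosses.mem {B : Type*} {w : List B} {a b : B} (h : Crosses w a b) : a ∈ w ∧ b ∈ w := by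
  rcases h.2 with h | h <;> exact ⟨h.subset (by simp), h.subset (by simp)⟩

/-- Moving the first letter to the end turns a pattern `a b a b` that uses it into `b a b a`; with
both patterns allowed, crossing is a property of the cyclic word. -/
theorem crosses_rotate_one {B : Type*} {w : List B} {a b c : B} :
    Crosses (w ++ [c]) a b ↔ Crosses (c :: w) a b := by
  have h1 : ∀ a b : B, List.Sublist [a, b, a, b] (c :: w) →
      List.Sublist [a, b, a, b] (w ++ [c]) ∨ List.Sublist [b, a, b, a] (w ++ [c]) := by
    intro a b h
    rcases List.sublist_cons_iff.1 h with h | ⟨r, hr, h⟩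
    · exact Or.inl (h.trans (List.sublist_append_left _ _))
    · cases hr
      exact Or.inr (h.append (List.Sublist.refl [c]))
  have h2 : ∀ a b : B, List.Sublist [a, b, a, b] (w ++ [c]) →
      List.Sublist [a, b, a, b] (c :: w) ∨ List.Sublist [b, a, b, a] (c :: w) := by
    intro a b h
    obtain ⟨l₁, l₂, e, h1, h2⟩ := List.sublist_append_iff.1 h
    rcases List.sublist_cons_iff.1 h2 with hs | ⟨r, rfl, hs⟩
    · rw [List.sublist_nil.1 hs, List.append_nil] at e
      exact Or.inl ((e ▸ h1).trans (List.sublist_cons_self _ _))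
    · obtain rfl := List.sublist_nil.1 hs
      have e' : [a, b, a] ++ [b] = l₁ ++ [c] := e
      obtain ⟨rfl, e''⟩ := List.append_inj' e' rfl
      cases e''
      exact Or.inr (h1.cons_cons _)
  exact and_congr_right fun _ => ⟨fun h => h.elim (h2 a b) fun h => (h2 b a h).symm,
    fun h => h.elim (h1 a b) fun h => (h1 b a h).symm⟩

theorem isRotated_induction {B : Type*} {P : List B → Prop} (h : ∀ c w, P (c :: w) → P (w ++ [c]))
    {w w' : List B} (hr : w ~r w') (hw : P w) : P w' := by
  obtain ⟨n, rfl⟩ := hr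
  induction n with
  | zero => simpa using hw
  | succ n ih =>
    rw [← List.rotate_rotate]
    generalize w.rotate n = w at *
    cases w with
    | nil => simpa using ih
    | cons a w => simpa using h a w ih

theorem crosses_isRotated {B : Type*} {w w' : List B} (hr : w ~r w') {a b : B} :
    Crosses w a b ↔ Crosses w' a b :=
  isRotated_induction (P := fun w' => Crosses w a b ↔ Crosses w' a b)
    (fun _ _ h => h.trans crosses_rotate_one.symm) hr Iff.rfl

/-- Every letter of the word occurs at least twice, and the crossing graph of its letters is a
tree. -/
structure IsTreeWord {B : Type*} (w : List B) : Prop where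
  two : ∀ a ∈ w, List.Sublist [a, a] w
  conn : ∀ s : B → Bool, (∀ a b, Crosses w a b → s a = s b) → ∀ a ∈ w, ∀ b ∈ w, s a = s b
  -- This stands for acyclicity: a forest with at least two vertices has at least two vertices of
  -- degree at most one, hence one different from `t`.
  leaf : ∀ (S : Finset B) (t : B), t ∈ S → 2 ≤ S.card →
    ∃ v ∈ S, v ≠ t ∧ ∀ x ∈ S, ∀ y ∈ S, Crosses w v x → Crosses w v y → x = y

theorem IsTreeWord.of_isRotated {B : Type*} {w w' : List B} (h : IsTreeWord w) (hr : w ~r w') :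
    IsTreeWord w' := by
  refine ⟨?_, ?_, ?_⟩
  · refine isRotated_induction (P := fun w => ∀ a ∈ w, List.Sublist [a, a] w) ?_ hr h.two
    intro c w h a ha
    have := h a (by simp at ha ⊢; tauto)
    rcases List.sublist_cons_iff.1 this with h | ⟨r, hr, h⟩
    · exact h.trans (List.sublist_append_left _ _)
    · cases hr
      exact h.append (List.Sublist.refl [c])
  · intro s hs a ha b hb
    exact h.conn s (fun a b hab => hs a b ((crosses_isRotated hr).1 hab)) a (hr.mem_iff.2 ha) b
      (hr.mem_iff.2 hb)
  · intro S t ht hS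
    obtain ⟨v, hv, hvt, h⟩ := h.leaf S t ht hS
    refine ⟨v, hv, hvt, fun x hx y hy hx' hy' => h x hx y hy ((crosses_isRotated hr).2 hx')
      ((crosses_isRotated hr).2 hy')⟩

/-- An alternating pattern uses at most one of two equal neighbours, so the crossings are unchanged;
the `p` in `w` keeps a second occurrence. -/
theorem IsTreeWord.remove_same {B : Type*} {p : B} {w : List B} (h : IsTreeWord (p :: p :: w))
    (hp : p ∈ w) : IsTreeWord (p :: w) := by
  have hc : ∀ a b, Crosses (p :: p :: w) a b ↔ Crosses (p :: w) a b := by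
    intro a b
    unfold Crosses
    refine and_congr_right fun hab => ?_
    refine or_congr ⟨fun h => ?_, fun h => h.trans (List.sublist_cons_self _ _)⟩
      ⟨fun h => ?_, fun h => h.trans (List.sublist_cons_self _ _)⟩
    · rcases List.sublist_cons_iff.1 h with h | ⟨r, hr, h⟩
      · exact h
      · cases hr
        rcases List.sublist_cons_iff.1 h with h | ⟨r, hr, h⟩
        · exact h.cons_cons _
        · cases hr; exact absurd rfl hab
    · rcases List.sublist_cons_iff.1 h with h | ⟨r, hr, h⟩
      · exact h
      · cases hr
        rcases List.sublist_cons_iff.1 h with h | ⟨r, hr, h⟩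
        · exact h.cons_cons _
        · cases hr; exact absurd rfl hab
  refine ⟨?_, ?_, ?_⟩
  · intro a ha
    by_cases hap : a = p
    · subst hap
      exact (List.singleton_sublist.2 hp).cons_cons _
    · have := h.two a (List.mem_cons_of_mem _ ha)
      rcases List.sublist_cons_iff.1 this with h | ⟨r, hr, h⟩
      · exact h
      · cases hr; exact absurd rfl hap
  · intro s hs a ha b hb
    exact h.conn s (fun a b hab => hs a b ((hc a b).1 hab)) a (List.mem_cons_of_mem _ ha) b
      (List.mem_cons_of_mem _ hb)
  · intro S t ht hS
    obtain ⟨v, hv, hvt, h⟩ := h.leaf S t ht hS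
    exact ⟨v, hv, hvt, fun x hx y hy hx' hy' => h x hx y hy ((hc _ _).2 hx') ((hc _ _).2 hy')⟩

theorem sublist_cons_of_ne {B : Type*} {a q : B} {u w : List B} (h : a ≠ q)
    (hs : List.Sublist (a :: u) (q :: w)) : List.Sublist (a :: u) w := by
  rcases List.sublist_cons_iff.1 hs with h' | ⟨r, hr, h'⟩
  · exact h'
  · cases hr; exact absurd rfl h

/-- Only `p` stands between the two occurrences of `q`, so `q` crosses at most `p`, and deleting a
leaf preserves a tree. -/
theorem IsTreeWord.remove_around {B : Type*} {q p : B} {w : List B} (hqp : q ≠ p)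
    (h : IsTreeWord (q :: p :: q :: w)) (hq : q ∉ w) : IsTreeWord (p :: w) := by
  classical
  have hsub : List.Sublist (p :: w) (q :: p :: q :: w) :=
    ((List.sublist_cons_self q w).cons_cons p).cons q
  have hred : ∀ u : List B, q ∉ u → List.Sublist u (q :: p :: q :: w) → List.Sublist u (p :: w) := by
    intro u hu hs
    have hqs : ∀ {u v : List B}, q ∉ u → List.Sublist u (q :: v) → List.Sublist u v := by
      intro u v hu hs
      rcases List.sublist_cons_iff.1 hs with hs | ⟨r, rfl, hs⟩
      · exact hs
      · simp at hu
    rcases List.sublist_cons_iff.1 (hqs hu hs) with ht | ⟨r, rfl, ht⟩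
    · exact (hqs hu ht).cons _
    · exact (hqs (fun h => hu (List.mem_cons_of_mem _ h)) ht).cons_cons _
  have hc : ∀ a b, a ≠ q → b ≠ q → (Crosses (q :: p :: q :: w) a b ↔ Crosses (p :: w) a b) := by
    intro a b ha hb
    unfold Crosses
    have e1 : q ∉ [a, b, a, b] := by simp [ha.symm, hb.symm]
    have e2 : q ∉ [b, a, b, a] := by simp [ha.symm, hb.symm]
    exact and_congr_right fun _ => or_congr ⟨hred _ e1, fun h => h.trans hsub⟩
      ⟨hred _ e2, fun h => h.trans hsub⟩
  have hq1 : ∀ b, Crosses (q :: p :: q :: w) q b → b = p := by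
    rintro b ⟨hb, hs | hs⟩
    · rcases List.sublist_cons_iff.1 hs with hs | ⟨r, hr, hs⟩
      · have hs := sublist_cons_of_ne hqp hs
        rcases List.sublist_cons_iff.1 hs with hs | ⟨r, hr, hs⟩
        · exact absurd (hs.subset (by simp)) hq
        · cases hr
          exact absurd (hs.subset (by simp)) hq
      · cases hr
        by_contra hbp
        have hs := sublist_cons_of_ne hb.symm (sublist_cons_of_ne hbp hs)
        exact absurd (hs.subset (by simp)) hq
    · by_contra hbp
      have hs := sublist_cons_of_ne hbp (sublist_cons_of_ne hb.symm hs)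
      have hs := sublist_cons_of_ne hb.symm hs
      exact absurd (hs.subset (by simp)) hq
  have hne : ∀ a ∈ p :: w, a ≠ q := by
    rintro a ha rfl
    rcases List.mem_cons.1 ha with rfl | ha
    · exact hqp rfl
    · exact hq ha
  refine ⟨?_, ?_, ?_⟩
  · intro a ha
    exact hred _ (by simpa using (hne a ha).symm) (h.two a (hsub.subset ha))
  · intro s hs a ha b hb
    have := h.conn (fun x => if x = q then s p else s x) (fun a b hab => by
      by_cases haq : a = q
      · subst haq
        rw [hq1 b hab, if_pos rfl, if_neg hqp.symm]
      by_cases hbq : b = q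
      · subst hbq
        rw [hq1 a hab.symm, if_pos rfl, if_neg hqp.symm]
      rw [if_neg haq, if_neg hbq]
      exact hs a b ((hc a b haq hbq).1 hab)) a (hsub.subset ha) b (hsub.subset hb)
    rwa [if_neg (hne a ha), if_neg (hne b hb)] at this
  · intro S t ht hS
    obtain ⟨v, hv, hvt, h⟩ := h.leaf S t ht hS
    have hm : ∀ {a b}, Crosses (p :: w) a b → a ≠ q ∧ b ≠ q := fun h =>
      ⟨hne _ h.mem.1, hne _ h.mem.2⟩
    exact ⟨v, hv, hvt, fun x hx y hy hx' hy' =>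
      h x hx y hy ((hc _ _ (hm hx').1 (hm hx').2).2 hx') ((hc _ _ (hm hy').1 (hm hy').2).2 hy')⟩

/-- A further `p` in `w` keeps `q` and `p` crossing. Any other pair of letters contains at most one
of them and sees the block as a run of equal letters, whose length does not matter. -/
theorem IsTreeWord.remove_alternating {B : Type*} {q p : B} {w : List B} (hqp : q ≠ p)
    (h : IsTreeWord (q :: p :: q :: p :: q :: w)) (hp : p ∈ w) : IsTreeWord (q :: p :: q :: w) := by
  have hsub : List.Sublist (q :: p :: q :: w) (q :: p :: q :: p :: q :: w) :=
    ((List.sublist_cons_self _ _).cons _).cons_cons _ |>.cons_cons _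
  have hpq : Crosses (q :: p :: q :: w) q p :=
    ⟨hqp, Or.inl ((((List.singleton_sublist.2 hp).cons_cons _).cons_cons _).cons_cons _)⟩
  have hred : ∀ a b, a ≠ b → ¬ (a = q ∧ b = p) → ¬ (a = p ∧ b = q) →
      List.Sublist [a, b, a, b] (q :: p :: q :: p :: q :: w) →
      List.Sublist [a, b, a, b] (q :: p :: q :: w) := by
    intro a b hab h1 h2 hs
    by_cases haq : a = q
    · have hbp : b ≠ p := fun e => h1 ⟨haq, e⟩
      have hbq : b ≠ q := fun e => hab (haq.trans e.symm)
      subst haq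
      have hs := List.cons_sublist_cons.1 hs
      exact ((((sublist_cons_of_ne hbq (sublist_cons_of_ne hbp (sublist_cons_of_ne hbq
        (sublist_cons_of_ne hbp hs)))).cons _).cons _).cons_cons _)
    by_cases hap : a = p
    · have hbq : b ≠ q := fun e => h2 ⟨hap, e⟩
      have hbp : b ≠ p := fun e => hab (hap.trans e.symm)
      subst hap
      have hs := List.cons_sublist_cons.1 (sublist_cons_of_ne haq hs)
      exact (((sublist_cons_of_ne hbq (sublist_cons_of_ne hbp (sublist_cons_of_ne hbq
        hs))).cons _).cons_cons _).cons _
    · exact ((((sublist_cons_of_ne haq (sublist_cons_of_ne hap (sublist_cons_of_ne haq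
        (sublist_cons_of_ne hap (sublist_cons_of_ne haq hs))))).cons _).cons _).cons _)
  have hc : ∀ a b, Crosses (q :: p :: q :: p :: q :: w) a b ↔ Crosses (q :: p :: q :: w) a b := by
    intro a b
    by_cases h1 : a = q ∧ b = p
    · obtain ⟨rfl, rfl⟩ := h1
      exact ⟨fun _ => hpq, fun h => ⟨h.1, h.2.imp (·.trans hsub) (·.trans hsub)⟩⟩
    by_cases h2 : a = p ∧ b = q
    · obtain ⟨rfl, rfl⟩ := h2
      exact ⟨fun _ => hpq.symm, fun h => ⟨h.1, h.2.imp (·.trans hsub) (·.trans hsub)⟩⟩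
    exact ⟨fun h => ⟨h.1, h.2.imp (hred a b h.1 h1 h2)
      (hred b a h.1.symm (fun e => h2 e.symm) (fun e => h1 e.symm))⟩,
      fun h => ⟨h.1, h.2.imp (·.trans hsub) (·.trans hsub)⟩⟩
  refine ⟨?_, ?_, ?_⟩
  · intro a ha
    by_cases haq : a = q
    · subst haq
      exact (List.singleton_sublist.2 (by simp)).cons_cons _
    by_cases hap : a = p
    · subst hap
      exact ((List.singleton_sublist.2 (by simp [hp])).cons_cons _).cons _
    have hs := h.two a (hsub.subset ha)
    exact ((((sublist_cons_of_ne haq (sublist_cons_of_ne hap (sublist_cons_of_ne haq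
        (sublist_cons_of_ne hap (sublist_cons_of_ne haq hs))))).cons _).cons _).cons _)
  · intro s hs a ha b hb
    exact h.conn s (fun a b hab => hs a b ((hc a b).1 hab)) a (hsub.subset ha) b (hsub.subset hb)
  · intro S t ht hS
    obtain ⟨v, hv, hvt, h⟩ := h.leaf S t ht hS
    exact ⟨v, hv, hvt, fun x hx y hy hx' hy' => h x hx y hy ((hc _ _).2 hx') ((hc _ _).2 hy')⟩

/-! ### Existence of a reducible factor -/

theorem exists_last_occurrence {B : Type*} {v : B} {w : List B} (h : v ∈ w) :
    ∃ α γ, w = α ++ v :: γ ∧ v ∉ γ := by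
  obtain ⟨γ, α, e, hγ⟩ := List.eq_append_cons_of_mem (List.mem_reverse.2 h)
  refine ⟨α.reverse, γ.reverse, ?_, by simpa using hγ⟩
  have := congrArg List.reverse e
  simpa using this

theorem exists_first_last_occurrence {B : Type*} {v : B} {w : List B}
    (h : List.Sublist [v, v] w) :
    ∃ α β γ, w = α ++ v :: (β ++ v :: γ) ∧ v ∉ α ∧ v ∉ γ := by
  obtain ⟨α, r, rfl, hα⟩ := List.eq_append_cons_of_mem (h.subset (List.mem_cons_self))
  have hr : v ∈ r := by
    obtain ⟨l₁, l₂, e, h1, h2⟩ := List.sublist_append_iff.1 h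
    cases l₁ with
    | nil =>
      cases e
      exact (List.cons_sublist_cons.1 h2).subset (by simp)
    | cons a l =>
      obtain ⟨rfl, _⟩ := List.cons.inj e
      exact absurd (h1.subset (by simp)) hα
  obtain ⟨β, γ, rfl, hγ⟩ := exists_last_occurrence hr
  exact ⟨α, β, γ, rfl, hα, hγ⟩

/-- A cyclic word has a rotation to which one of the reductions applies. -/
def Reducible {B : Type*} (w : List B) : Prop :=
  ∃ u, w ~r u ∧ ((∃ p x, u = p :: p :: x) ∨ (∃ q p x, q ≠ p ∧ q ∉ x ∧ u = q :: p :: q :: x) ∨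
    ∃ q p x, q ≠ p ∧ u = q :: p :: q :: p :: q :: x)

theorem isRotated_append_comm {B : Type*} (a b : List B) : (a ++ b) ~r (b ++ a) :=
  List.isRotated_append

theorem Reducible.of_adjacent {B : Type*} {w a b : List B} {p : B} (h : w ~r a ++ p :: p :: b) :
    Reducible w :=
  ⟨_, h.trans (isRotated_append_comm _ _), Or.inl ⟨p, b ++ a, by simp⟩⟩

/-- Without equal neighbours the stretch from the first to the last `Q` alternates, so it is `Q T Q`
or begins with `Q T Q T Q`. -/
theorem Reducible.of_two_letters {B : Type*} {w m r : List B} {Q T : B} (hTQ : Q ≠ T)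
    (hr : Q ∉ r) (h : w ~r Q :: (m ++ Q :: r)) (hm : ∀ x ∈ m, x = Q ∨ x = T) : Reducible w := by
  match m with
  | [] => exact Reducible.of_adjacent (a := []) h
  | c :: m =>
    rcases hm c (by simp) with rfl | rfl
    · exact Reducible.of_adjacent (a := []) h
    match m with
    | [] => exact ⟨_, h, Or.inr (Or.inl ⟨Q, c, r, hTQ, hr, rfl⟩)⟩
    | d :: m =>
      rcases hm d (by simp) with rfl | rfl
      · match m with
        | [] => exact Reducible.of_adjacent (a := [d, c]) h
        | e :: m =>
          rcases hm e (by simp) with rfl | rfl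
          · exact Reducible.of_adjacent (a := [e, c]) h
          match m with
          | [] => exact ⟨_, h, Or.inr (Or.inr ⟨d, e, r, hTQ, rfl⟩)⟩
          | f :: m =>
            rcases hm f (by simp) with rfl | rfl
            · exact ⟨_, h, Or.inr (Or.inr ⟨f, e, _, hTQ, rfl⟩)⟩
            · exact Reducible.of_adjacent (a := [d, f, d]) h
      · exact Reducible.of_adjacent (a := [Q]) h

/-- Descent on the length of the stretch `m` between the outermost occurrences of a leaf `Q`. If the
stretch contains letters besides `Q` and its neighbour `T`, then a gap between consecutive
occurrences of `Q` encloses another leaf together with its whole, shorter stretch. -/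
theorem IsTreeWord.reducible_of_leaf {B : Type*} {w : List B} (hw : IsTreeWord w) (n : ℕ) :
    ∀ (m r : List B) (Q R : B), m.length ≤ n → Q ∉ r → w ~r Q :: (m ++ Q :: r) → R ∈ w → R ≠ Q →
      (∀ x y, Crosses w Q x → Crosses w Q y → x = y) → Reducible w := by
  classical
  induction n with
  | zero =>
    intro m r Q R hm hr h _ _ _
    obtain rfl := List.length_eq_zero_iff.1 (Nat.le_zero.1 hm)
    exact Reducible.of_adjacent (a := []) h
  | succ n ih =>
    intro m r Q R hm hr h hR hRQ hleaf
    -- `R` is a second letter, so by connectivity `Q` is not isolated.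
    obtain ⟨T, hT⟩ : ∃ T, Crosses w Q T := by
      by_contra hno
      push Not at hno
      have := hw.conn (fun x => decide (x = Q)) (fun a b hab => by
        have h1 : a ≠ Q := fun e => hno b (e ▸ hab)
        have h2 : b ≠ Q := fun e => hno a (e ▸ hab.symm)
        simp [h1, h2]) R hR Q (h.mem_iff.2 (by simp))
      simp [hRQ] at this
    by_cases hall : ∀ x ∈ m, x = Q ∨ x = T
    · exact Reducible.of_two_letters hT.1 hr h hall
    push Not at hall
    obtain ⟨Y, hY, hYQ, hYT⟩ := hall
    -- `μ` is the gap between two consecutive occurrences of `Q` that contains `Y`.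
    obtain ⟨μ, ν, hμ, hYμ, hlen, hrot⟩ : ∃ μ ν, Q ∉ μ ∧ Y ∈ μ ∧ μ.length ≤ m.length ∧
        w ~r Q :: (μ ++ Q :: ν) := by
      obtain ⟨m₁, m₂, rfl⟩ := List.append_of_mem hY
      obtain ⟨a, b, e, hb⟩ := exists_last_occurrence (v := Q) (w := Q :: m₁) (by simp)
      obtain ⟨c, d, e', hc⟩ := List.eq_append_cons_of_mem
        (show Q ∈ m₂ ++ Q :: r by simp)
      obtain ⟨c', d', e'', hc'⟩ := List.eq_append_cons_of_mem
        (show Q ∈ m₂ ++ [Q] by simp)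
      have hcl : c'.length ≤ m₂.length := by
        have := congrArg List.length e''
        simp at this; omega
      have hbl : b.length ≤ m₁.length := by
        have := congrArg List.length e
        simp at this; omega
      refine ⟨b ++ Y :: c', d' ++ r ++ a, ?_, by simp, by simp; omega, ?_⟩
      · simp [hb, hc', hYQ.symm]
      · have e3 : Q :: ((m₁ ++ Y :: m₂) ++ Q :: r) =
            a ++ (Q :: (b ++ Y :: c' ++ Q :: (d' ++ r))) := by
          have : Q :: ((m₁ ++ Y :: m₂) ++ Q :: r) = (Q :: m₁) ++ Y :: ((m₂ ++ [Q]) ++ r) := by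
            simp
          rw [this, e, e'']
          simp
        rw [e3] at h
        refine (h.trans (isRotated_append_comm _ _)).trans ?_
        simp [List.IsRotated.refl]
    -- A letter occurring both inside and outside the gap crosses `Q`, and only `T` does.
    have hν : ∀ z ∈ μ, z ≠ T → z ∉ ν := by
      intro z hz hzT hzν
      refine hzT (hleaf z T ((crosses_isRotated hrot).2 ⟨?_, Or.inl ?_⟩) hT)
      · rintro rfl; exact hμ hz
      · have : List.Sublist ([z] ++ [Q, z]) (μ ++ Q :: ν) :=
          (List.singleton_sublist.2 hz).append ((List.singleton_sublist.2 hzν).cons_cons _)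
        exact this.cons_cons _
    -- As `v ≠ T`, all occurrences of `v` lie in `μ`, and so every letter crossing `v` occurs in
    -- `μ`. Hence `v` is a leaf of the whole crossing graph, not only within the chosen set.
    obtain ⟨v, hv, hvT, hvl⟩ := hw.leaf (insert T μ.toFinset) T (by simp) (by
      rw [← Finset.card_pair hYT]
      exact Finset.card_le_card (by intro x; simp; rintro (rfl | rfl) <;> simp [hYμ]))
    have hvμ : v ∈ μ := by simpa [hvT] using hv
    have hvν : v ∉ Q :: ν := by
      have : v ≠ Q := by rintro rfl; exact hμ hvμ
      simp [this, hν v hvμ hvT]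
    have hvQ : v ≠ Q := by rintro rfl; exact hμ hvμ
    have hsub : ∀ x : List B, List.Sublist (v :: (x ++ [v])) (Q :: (μ ++ Q :: ν)) →
        List.Sublist (v :: (x ++ [v])) μ := by
      intro x hx
      obtain ⟨l₁, l₂, e, h1, h2⟩ := List.sublist_append_iff.1 (sublist_cons_of_ne hvQ hx)
      rcases List.eq_nil_or_concat l₂ with rfl | ⟨l, a, rfl⟩
      · rw [e, List.append_nil]; exact h1
      · have : (v :: x) ++ [v] = (l₁ ++ l) ++ [a] := by simpa using e
        obtain ⟨_, e'⟩ := List.append_inj' this rfl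
        cases e'
        exact absurd (h2.subset (by simp)) hvν
    have hnb : ∀ x, Crosses w v x → x ∈ insert T μ.toFinset := by
      intro x hx
      obtain ⟨_, hx⟩ := (crosses_isRotated hrot).1 hx
      have : List.Sublist (v :: ([x] ++ [v])) (Q :: (μ ++ Q :: ν)) := by
        rcases hx with hx | hx
        · exact (List.sublist_append_left [v, x, v] [x]).trans hx
        · exact (List.sublist_cons_self x [v, x, v]).trans hx
      have := (hsub _ this).subset (show x ∈ _ by simp)
      simp [this]
    have hvv : List.Sublist [v, v] μ :=
      hsub [] ((hw.of_isRotated hrot).two v (by simp [hvμ]))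
    obtain ⟨α, β, γ, rfl, hα, hγ⟩ := exists_first_last_occurrence hvv
    refine ih β (γ ++ Q :: ν ++ Q :: α) v Q ?_ ?_ ?_ ?_ hvQ.symm ?_
    · simp at hlen; omega
    · simp at hvν ⊢; tauto
    · refine hrot.trans ?_
      have e : Q :: (α ++ v :: (β ++ v :: γ) ++ Q :: ν) =
        (Q :: α) ++ v :: (β ++ v :: (γ ++ Q :: ν)) := by simp
      rw [e]
      refine (isRotated_append_comm _ _).trans ?_
      simp [List.IsRotated.refl]
    · exact hrot.mem_iff.2 (by simp)
    · intro x y hx hy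
      exact hvl x (hnb x hx) y (hnb y hy) hx hy

theorem IsTreeWord.reducible {B : Type*} {w : List B} (hw : IsTreeWord w) (hne : w ≠ []) :
    Reducible w := by
  classical
  obtain ⟨a, w', rfl⟩ := List.exists_cons_of_ne_nil hne
  by_cases hb : ∃ b ∈ a :: w', b ≠ a
  · obtain ⟨b, hb, hba⟩ := hb
    obtain ⟨v, hv, hva, h⟩ := hw.leaf (a :: w').toFinset a (by simp) (by
      rw [← Finset.card_pair hba]
      exact Finset.card_le_card (by intro x; simp; rintro (rfl | rfl) <;> simp_all))
    obtain ⟨α, β, γ, e, hα, hγ⟩ := exists_first_last_occurrence (hw.two v (by simpa using hv))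
    refine hw.reducible_of_leaf _ β (γ ++ α) v a le_rfl (by simp [hα, hγ]) ?_ (by simp) hva.symm
      fun x y hx hy => h x (by simpa using hx.mem.2) y (by simpa using hy.mem.2) hx hy
    rw [e]
    refine (isRotated_append_comm _ _).trans ?_
    simp [List.IsRotated.refl]
  · push Not at hb
    have h2 := hw.two a (by simp)
    cases w' with
    | nil => exact absurd h2.length_le (by simp)
    | cons b w' =>
      obtain rfl := hb b (by simp)
      exact Reducible.of_adjacent (a := []) (List.IsRotated.refl _)

/-! ### Good labellings of tree words by induction -/

theorem exists_isRotated_filterMap {A B : Type*} {l : A → Option B} {w : List A} {u : List B}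
    (h : w.filterMap l ~r u) : ∃ w', w ~r w' ∧ w'.filterMap l = u := by
  refine isRotated_induction (P := fun u => ∃ w', w ~r w' ∧ w'.filterMap l = u) ?_ h
    ⟨w, List.IsRotated.refl _, rfl⟩
  rintro c v ⟨w', hr, hw'⟩
  obtain ⟨l₁, a, l₂, rfl, h1, h2, h3⟩ := List.filterMap_eq_cons_iff.1 hw'
  refine ⟨l₂ ++ (l₁ ++ [a]), hr.trans ?_, ?_⟩
  · have : l₁ ++ a :: l₂ = (l₁ ++ [a]) ++ l₂ := by simp
    rw [this]
    exact isRotated_append_comm _ _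
  · have : l₁.filterMap l = [] := List.filterMap_eq_nil_iff.2 h1
    simp [h3, this, h2]

theorem exists_cons_of_filterMap_eq {A B : Type*} {l : A → Option B} {w : List A} {c : B}
    {v : List B} (hw : ∀ a ∈ w, l a ≠ none) (h : w.filterMap l = c :: v) :
    ∃ a w', w = a :: w' ∧ l a = some c ∧ w'.filterMap l = v ∧ ∀ a ∈ w', l a ≠ none := by
  obtain ⟨l₁, a, l₂, rfl, h1, h2, h3⟩ := List.filterMap_eq_cons_iff.1 h
  cases l₁ with
  | nil => exact ⟨a, l₂, rfl, h2, h3, fun x hx => hw x (by simp [hx])⟩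
  | cons x l₁ => exact absurd (h1 x (by simp)) (hw x (by simp))

theorem mem_of_two_sublist {B : Type*} {p : B} {x : List B}
    (h : List.Sublist [p, p] (p :: x)) : p ∈ x :=
  (List.cons_sublist_cons.1 h).subset (by simp)

theorem HasGoodLabelling.of_around {A B : Type*} {l : A → Option B} {w : List A} {q p : B}
    {x : List B} (ih : ∀ w' : List A, w'.length < w.length → w'.Nodup →
      IsTreeWord (w'.filterMap l) → (∀ a ∈ w', l a ≠ none) → w' ≠ [] → HasGoodLabelling l w')
    (hnd : w.Nodup) (hnone : ∀ a ∈ w, l a ≠ none) (ht : IsTreeWord (w.filterMap l))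
    (hw : w.filterMap l = q :: p :: q :: x) (hqp : q ≠ p) (hq : q ∉ x) :
    HasGoodLabelling l w := by
  rw [hw] at ht
  obtain ⟨a, w, rfl, ha, hw, hnone⟩ := exists_cons_of_filterMap_eq hnone hw
  obtain ⟨b, w, rfl, hb, hw, hnone⟩ := exists_cons_of_filterMap_eq hnone hw
  obtain ⟨c, w, rfl, hc, hw, hnone⟩ := exists_cons_of_filterMap_eq hnone hw
  have ht' := ht.remove_around hqp hq
  have hpx : p ∈ x := mem_of_two_sublist (ht'.two p (by simp))
  have hw0 : w ≠ [] := by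
    rintro rfl
    simp at hw
    simp [hw] at hpx
  simp only [List.nodup_cons, List.mem_cons, not_or] at hnd
  have hn' : (b :: w).Nodup := List.nodup_cons.2 ⟨hnd.2.1.2, hnd.2.2.2⟩
  have e : (b :: w).filterMap l = p :: x := by rw [List.filterMap_cons_some hb, hw]
  refine (ih (b :: w) (by simp) hn' (e ▸ ht')
    (by simpa [hb] using hnone) (by simp)).cons_around hw0 hnd.2.1.2
    (by simp; exact ⟨hnd.1.1, hnd.1.2.2⟩) (by simp; exact ⟨Ne.symm hnd.2.1.1, hnd.2.2.1⟩)
    hnd.1.2.1 hb ha hc ?_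
  intro u hu hlu
  have : q ∈ (b :: w).filterMap l := List.mem_filterMap.2 ⟨u, hu, hlu⟩
  rw [e] at this
  simp [hqp, hq] at this

/-- A word whose crossing graph is a tree has a good labelling. -/
theorem IsTreeWord.hasGoodLabelling {A B : Type*} {l : A → Option B} (n : ℕ) :
    ∀ w : List A, w.length = n → w.Nodup → IsTreeWord (w.filterMap l) → w.filterMap l ≠ [] →
      HasGoodLabelling l w := by
  induction n using Nat.strong_induction_on with
  | _ n ih =>
  intro w hn hnd ht hne
  by_cases hnone : ∃ a ∈ w, l a = none
  · obtain ⟨a, ha, hla⟩ := hnone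
    obtain ⟨α, β, rfl⟩ := List.append_of_mem ha
    have hr : a :: (β ++ α) ~r α ++ a :: β := (isRotated_append_comm (a :: β) α)
    have hr' : β ++ α ~r α ++ β := isRotated_append_comm _ _
    refine HasGoodLabelling.of_isRotated ?_ hr
    have hnd' := hr.nodup_iff.2 hnd
    have e : (α ++ a :: β).filterMap l = α.filterMap l ++ β.filterMap l := by
      simp [hla]
    rw [e] at ht hne
    have e2 : (β ++ α).filterMap l = β.filterMap l ++ α.filterMap l := by simp
    have hne2 : (β ++ α).filterMap l ≠ [] := by
      rw [e2]; simpa [and_comm] using hne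
    refine HasGoodLabelling.cons_none (ih _ ?_ (β ++ α) rfl (List.nodup_cons.1 hnd').2 ?_ hne2)
      ?_ (List.nodup_cons.1 hnd').1 hla
    · rw [← hn]; simp; omega
    · rw [e2]; exact ht.of_isRotated (isRotated_append_comm _ _)
    · intro h; rw [h] at hne2; exact hne2 rfl
  push Not at hnone
  obtain ⟨u, hu, hpat⟩ := ht.reducible hne
  obtain ⟨w', hr, rfl⟩ := exists_isRotated_filterMap hu
  refine HasGoodLabelling.of_isRotated ?_ hr.symm
  replace ht := ht.of_isRotated hu
  replace hnd := hr.nodup_iff.1 hnd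
  replace hnone : ∀ a ∈ w', l a ≠ none := fun a ha => hnone a (hr.mem_iff.2 ha)
  rw [hr.perm.length_eq] at hn
  subst hn
  replace ih : ∀ w'' : List A, w''.length < w'.length → w''.Nodup →
      IsTreeWord (w''.filterMap l) → (∀ a ∈ w'', l a ≠ none) → w'' ≠ [] →
      HasGoodLabelling l w'' := by
    intro w'' hl hn ht hno h
    refine ih _ hl w'' rfl hn ht ?_
    obtain ⟨a, v, rfl⟩ := List.exists_cons_of_ne_nil h
    intro hnil
    exact hno a (by simp) (List.filterMap_eq_nil_iff.1 hnil a (by simp))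
  clear hu hr hne
  rcases hpat with ⟨p, x, hw⟩ | ⟨q, p, x, hqp, hq, hw⟩ | ⟨q, p, x, hqp, hw⟩
  · have htw := hw ▸ ht
    obtain ⟨a, w, rfl, ha, hw, hno⟩ := exists_cons_of_filterMap_eq hnone hw
    obtain ⟨b, w, rfl, hb, hw, hno⟩ := exists_cons_of_filterMap_eq hno hw
    simp only [List.nodup_cons, List.mem_cons, not_or] at hnd
    by_cases hp : p ∈ x
    · have e : (a :: w).filterMap l = p :: x := by rw [List.filterMap_cons_some ha, hw]
      have hw0 : w ≠ [] := by
        rintro rfl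
        simp at hw
        simp [hw] at hp
      exact (ih (a :: w) (by simp) (List.nodup_cons.2 ⟨hnd.1.2, hnd.2.2⟩)
        (e ▸ htw.remove_same hp) (by simpa [ha] using hno) (by simp)).cons_same hw0 hnd.1.2
        (by simp; exact ⟨Ne.symm hnd.1.1, hnd.2.1⟩) ha hb
    · cases x with
      | nil =>
        cases w with
        | nil => exact HasGoodLabelling.pair hnd.1.1 ha hb
        | cons c w =>
          exact absurd (List.filterMap_eq_nil_iff.1 hw c (by simp)) (hno c (by simp))
      | cons c x =>
        -- A letter whose only occurrences are adjacent crosses nothing, which contradicts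
        -- connectivity as soon as there is another letter.
        have hne : ∀ b, ¬ Crosses (p :: p :: c :: x) p b := by
          rintro b ⟨hpb, h | h⟩
          · have := sublist_cons_of_ne hpb.symm (List.cons_sublist_cons.1 h)
            exact hp (this.subset (by simp))
          · have := sublist_cons_of_ne hpb.symm (sublist_cons_of_ne hpb.symm h)
            exact hp (this.subset (by simp))
        classical
        have := htw.conn (fun z => decide (z = p)) (fun a b hab => by
          have h1 : a ≠ p := fun e => hne b (e ▸ hab)
          have h2 : b ≠ p := fun e => hne a (e ▸ hab.symm)
          simp [h1, h2]) p (by simp) c (by simp)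
        have hcp : c = p := by simpa using this
        exact absurd (hcp ▸ List.mem_cons_self) hp
  · exact HasGoodLabelling.of_around ih hnd hnone ht hw hqp hq
  · by_cases hp : p ∈ x
    · have htw := hw ▸ ht
      obtain ⟨a, w, rfl, ha, hw, hno⟩ := exists_cons_of_filterMap_eq hnone hw
      obtain ⟨b, w, rfl, hb, hw, hno⟩ := exists_cons_of_filterMap_eq hno hw
      obtain ⟨c, w, rfl, hc, hw, hno⟩ := exists_cons_of_filterMap_eq hno hw
      obtain ⟨d, w, rfl, hd, hw, hno⟩ := exists_cons_of_filterMap_eq hno hw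
      obtain ⟨e, w, rfl, he, hw, hno⟩ := exists_cons_of_filterMap_eq hno hw
      have hf : (a :: b :: e :: w).filterMap l = q :: p :: q :: x := by
        rw [List.filterMap_cons_some ha, List.filterMap_cons_some hb,
          List.filterMap_cons_some he, hw]
      simp only [List.nodup_cons, List.mem_cons, not_or] at hnd
      have hn : (a :: b :: e :: w).Nodup := by
        simp only [List.nodup_cons, List.mem_cons, not_or]
        tauto
      exact (ih (a :: b :: e :: w) (by simp) hn (hf ▸ htw.remove_alternating hqp hp)
        (by simpa [ha, hb, he] using hno) (by simp)).cons_alternating hn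
        (by simp only [List.mem_cons, not_or]; tauto)
        (by simp only [List.mem_cons, not_or]; tauto) hqp.symm hb hd ha he hc
    -- Without a further `p`, rotation brings `p q p` to the front, and the case of a letter
    -- enclosing a single position applies with `p` and `q` exchanged.
    · have hrot : w'.filterMap l ~r p :: q :: p :: (q :: (x ++ [q])) := by
        rw [hw]
        exact (isRotated_append_comm [q] _).trans (by simp [List.IsRotated.refl])
      obtain ⟨w₁, hr, hw₁⟩ := exists_isRotated_filterMap hrot
      refine HasGoodLabelling.of_isRotated ?_ hr.symm
      rw [hr.perm.length_eq] at ih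
      exact HasGoodLabelling.of_around ih (hr.nodup_iff.1 hnd)
        (fun a ha => hnone a (hr.mem_iff.2 ha)) (hw₁ ▸ ht.of_isRotated hrot) hw₁ hqp.symm
        (by simp [hp, hqp.symm])

/-! ### The cyclic word of a cycle and separation of attachments -/

theorem mem_arcPairs_append {A : Type*} {z u v : A} {α β : List A} :
    (u, v) ∈ arcPairs (α ++ z :: β) ↔ (u, v) ∈ arcPairs (α ++ [z]) ∨ (u, v) ∈ arcPairs (z :: β) := by
  induction α with
  | nil => simp [arcPairs]
  | cons a α ih =>
    rw [List.cons_append, mem_arcPairs_cons, List.cons_append, mem_arcPairs_cons, ih, or_assoc]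
    cases α <;> rfl

theorem mem_arcPairs_support {V : Type*} {G : SimpleGraph V} {x y a b : V} (p : G.Walk x y) :
    (a, b) ∈ arcPairs p.support ↔ ∃ d ∈ p.darts, d.fst = a ∧ d.snd = b := by
  induction p with
  | nil => simp [arcPairs]
  | @cons _ v _ h p ih =>
    rw [SimpleGraph.Walk.support_cons, mem_arcPairs_cons, ih]
    have : p.support.head? = some v := by
      rw [List.head?_eq_some_head (by simp), SimpleGraph.Walk.head_support]
    rw [this]
    simp only [SimpleGraph.Walk.darts_cons, List.mem_cons, exists_eq_or_imp, Option.some.injEq,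
      eq_comm]

/-- The vertices of a closed walk, in cyclic order. -/
def cyclicWord {V : Type*} {G : SimpleGraph V} {u : V} (L : G.Walk u u) : List V :=
  L.support.dropLast

theorem cyclicWord_concat {V : Type*} {G : SimpleGraph V} {u : V} (L : G.Walk u u) :
    cyclicWord L ++ [u] = L.support := L.dropLast_support_concat

theorem cyclicNext_cyclicWord {V : Type*} {G : SimpleGraph V} {u a b : V} {L : G.Walk u u}
    (hL : ¬ L.Nil) :
    CyclicNext (cyclicWord L) a b ↔ ∃ d ∈ L.darts, d.fst = a ∧ d.snd = b := by
  rw [← mem_arcPairs_support, ← cyclicWord_concat]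
  cases L with
  | nil => simp at hL
  | cons h p =>
    have : cyclicWord (SimpleGraph.Walk.cons h p) = u :: p.support.dropLast := by
      rw [cyclicWord, SimpleGraph.Walk.support_cons, List.dropLast_cons_of_ne_nil (by simp)]
    rw [this]
    rfl

theorem mem_cyclicWord {V : Type*} {G : SimpleGraph V} {u x : V} {L : G.Walk u u}
    (hL : ¬ L.Nil) : x ∈ cyclicWord L ↔ x ∈ L.support := by
  rw [← cyclicWord_concat]
  cases L with
  | nil => simp at hL
  | cons h p =>
    have : cyclicWord (SimpleGraph.Walk.cons h p) = u :: p.support.dropLast := by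
      rw [cyclicWord, SimpleGraph.Walk.support_cons, List.dropLast_cons_of_ne_nil (by simp)]
    rw [this]
    simp only [List.mem_cons, List.mem_append, List.not_mem_nil, or_false]
    tauto

theorem cyclicWord_eq_map {V : Type*} {G : SimpleGraph V} {u : V} (L : G.Walk u u) :
    cyclicWord L = L.darts.map (·.fst) := L.map_fst_darts.symm

theorem cyclicWord_nodup {V : Type*} {G : SimpleGraph V} {u : V} {L : G.Walk u u}
    (hL : L.IsCycle) : (cyclicWord L).Nodup := hL.nodup_dropLast_support

theorem eq_of_isRotated_cons {A : Type*} {x : A} {w w' : List A} (h : x :: w ~r x :: w')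
    (hn : (x :: w).Nodup) : w = w' := by
  obtain ⟨n, hlt, hr⟩ := List.isRotated_iff_mod.1 h
  rcases hlt.lt_or_eq with hlt | rfl
  · have h0 : ((x :: w).rotate n).head? = (x :: w)[n]? := List.head?_rotate hlt
    rw [hr, List.head?_cons, List.getElem?_eq_getElem hlt, Option.some.injEq] at h0
    have : 0 = n := (List.Nodup.getElem_inj_iff hn (hi := by simp) (hj := hlt)).1 (by simpa using h0)
    subst this
    simpa using hr
  · rw [List.rotate_length] at hr
    simpa using hr

/-- Cutting the cycle at the first vertices of `α` and `β` gives the two paths: each contains one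
block and ends at the first vertex of the other. -/
theorem avoid_of_split {V : Type*} {G : SimpleGraph V} {u : V} {L : G.Walk u u} (hL : L.IsCycle)
    {B₁ B₂ : G.Subgraph} {α β : List V} (hr : cyclicWord L ~r α ++ β) (hα : α ≠ []) (hβ : β ≠ [])
    (h1 : ∀ x ∈ attachments L.toSubgraph B₁, x ∈ α)
    (h2 : ∀ x ∈ attachments L.toSubgraph B₂, x ∈ β) : Avoid L B₁ B₂ := by
  classical
  obtain ⟨x, α, rfl⟩ := List.exists_cons_of_ne_nil hα
  obtain ⟨y, β, rfl⟩ := List.exists_cons_of_ne_nil hβ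
  have hxL : x ∈ L.support := (mem_cyclicWord hL.not_nil).1 (hr.mem_iff.2 (by simp))
  have hnd : (x :: α ++ y :: β).Nodup := hr.nodup_iff.1 (cyclicWord_nodup hL)
  set R := L.rotate x hxL with hR
  have hRc : R.IsCycle := hL.rotate hxL
  have hRw : cyclicWord R = x :: α ++ y :: β := by
    have h : cyclicWord R ~r x :: (α ++ y :: β) := by
      refine List.IsRotated.trans ?_ hr
      rw [cyclicWord_eq_map, cyclicWord_eq_map]
      exact (L.rotate_darts x hxL).map _
    have e : ∃ t, cyclicWord R = x :: t := by
      have hn := hRc.not_nil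
      cases hRR : R with
      | nil => rw [hRR] at hn; simp at hn
      | cons h p =>
        exact ⟨p.support.dropLast, by
          rw [cyclicWord, SimpleGraph.Walk.support_cons, List.dropLast_cons_of_ne_nil (by simp)]⟩
    obtain ⟨t, e⟩ := e
    rw [e] at h ⊢
    rw [eq_of_isRotated_cons h (h.nodup_iff.2 hnd)]
    rfl
  have hyR : y ∈ R.support := (mem_cyclicWord hRc.not_nil).1 (by rw [hRw]; simp)
  have hxy : x ≠ y := by
    rintro rfl
    simp at hnd
  have hspec := R.take_spec hyR
  have hsup : R.support = x :: α ++ y :: (β ++ [x]) := by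
    rw [← cyclicWord_concat, hRw]; simp
  set P := R.takeUntil y hyR
  set Q := R.dropUntil y hyR
  have hPQ : P.support.dropLast ++ Q.support = x :: α ++ y :: (β ++ [x]) := by
    rw [← hsup, ← hspec, SimpleGraph.Walk.support_append_eq_support_dropLast_append]
  have hPp : P.IsPath := hRc.isPath_takeUntil hyR
  have hyP : y ∉ P.support.dropLast := by
    have := hPp.support_nodup
    rw [← List.dropLast_append_getLast P.support_ne_nil, SimpleGraph.Walk.getLast_support,
      List.nodup_append] at this
    exact fun h => this.2.2 y h y (by simp) rfl
  have hyα : y ∉ x :: α := by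
    intro h
    exact (List.nodup_append.1 hnd).2.2 y h y (by simp) rfl
  have hQs : Q.support = y :: Q.support.tail := Q.cons_tail_support.symm
  -- Both decompositions of the support cut it immediately before the first `y`, so they coincide.
  have hPα : P.support.dropLast = x :: α ∧ Q.support = y :: (β ++ [x]) := by
    rw [hQs] at hPQ
    rcases List.append_eq_append_iff.1 hPQ with ⟨c, e1, e2⟩ | ⟨c, e1, e2⟩
    · cases c with
      | nil => simp at e1 e2; exact ⟨e1.symm, e2⟩
      | cons z c =>
        obtain ⟨rfl, _⟩ := List.cons.inj e2
        exact absurd (by rw [e1]; simp) hyα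
    · cases c with
      | nil => simp at e1 e2; exact ⟨e1, e2.symm⟩
      | cons z c =>
        obtain ⟨rfl, _⟩ := List.cons.inj e2
        exact absurd (by rw [e1]; simp) hyP
  have hQp : Q.IsPath := by
    have : (P.append Q).IsCycle := by rw [hspec]; exact hRc
    exact this.isPath_of_append_right (SimpleGraph.Walk.not_nil_of_ne hxy)
  refine ⟨x, y, P, Q.reverse, hPp, hQp.reverse, ?_, ?_, ?_, ?_⟩
  · have : (P.append Q).edges.Nodup := by rw [hspec]; exact hRc.edges_nodup
    rw [SimpleGraph.Walk.edges_append, List.nodup_append] at this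
    rw [Set.disjoint_left]
    intro e he he'
    refine this.2.2 e (by simpa using he) e ?_ rfl
    simpa using he'
  · rw [SimpleGraph.Walk.toSubgraph_reverse, ← SimpleGraph.Walk.toSubgraph_append, hspec,
      SimpleGraph.Walk.toSubgraph_rotate]
  · intro z hz
    have := h1 z hz
    rw [← hPα.1] at this
    exact List.mem_of_mem_dropLast this
  · intro z hz
    have := h2 z hz
    rw [Set.mem_ofPred_eq, SimpleGraph.Walk.support_reverse, List.mem_reverse, hPα.2]
    simp at this ⊢
    tauto

theorem eq_of_arcPairs_interior_left {A : Type*} {Y : Set A} {c : A → Bool} {t : List A} {y : A}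
    (hY : ∀ v ∈ t, v ∉ Y)
    (h : ∀ u v, (u, v) ∈ arcPairs (t ++ [y]) → u ∉ Y → v ∉ Y → c u = c v) :
    ∀ u ∈ t ++ [y], u ∉ Y → ∀ v ∈ t ++ [y], v ∉ Y → c u = c v := by
  by_cases hy : y ∈ Y
  · have := eq_of_arcPairs (w := t) (s := c) fun u v huv =>
      h u v (mem_arcPairs_concat.2 (Or.inl huv)) (hY u (mem_of_mem_arcPairs huv).1)
        (hY v (mem_of_mem_arcPairs huv).2)
    intro u hu huY v hv hvY
    refine this u ?_ v ?_
    · have : u ≠ y := by rintro rfl; exact huY hy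
      simpa [this] using hu
    · have : v ≠ y := by rintro rfl; exact hvY hy
      simpa [this] using hv
  · have hY' : ∀ v ∈ t ++ [y], v ∉ Y := by
      intro v hv
      rcases List.mem_append.1 hv with hv | hv
      · exact hY v hv
      · simp at hv; exact hv ▸ hy
    have := eq_of_arcPairs (w := t ++ [y]) (s := c) fun u v huv =>
      h u v huv (hY' u (mem_of_mem_arcPairs huv).1) (hY' v (mem_of_mem_arcPairs huv).2)
    exact fun u hu _ v hv _ => this u hu v hv

/-- A colouring that is constant along the arcs of a list that avoid a set `Y`, where `Y` meets the
list in its two ends only, is constant on the entries of the list outside `Y`. -/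
theorem eq_of_arcPairs_interior {A : Type*} {Y : Set A} {c : A → Bool} {t : List A} {x y : A}
    (hY : ∀ v ∈ t, v ∉ Y)
    (h : ∀ u v, (u, v) ∈ arcPairs (x :: (t ++ [y])) → u ∉ Y → v ∉ Y → c u = c v) :
    ∀ u ∈ x :: (t ++ [y]), u ∉ Y → ∀ v ∈ x :: (t ++ [y]), v ∉ Y → c u = c v := by
  by_cases hx : x ∈ Y
  · have := eq_of_arcPairs_interior_left (c := c) (y := y) hY fun u v huv =>
      h u v (mem_arcPairs_cons.2 (Or.inr huv))
    intro u hu huY v hv hvY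
    have h1 : u ≠ x := by rintro rfl; exact huY hx
    have h2 : v ≠ x := by rintro rfl; exact hvY hx
    exact this u ((List.mem_cons.1 hu).resolve_left h1) huY v
      ((List.mem_cons.1 hv).resolve_left h2) hvY
  · refine eq_of_arcPairs_interior_left (t := x :: t) ?_ h
    intro v hv
    rcases List.mem_cons.1 hv with rfl | hv
    · exact hx
    · exact hY v hv

theorem adj_of_mem_arcPairs_support {V : Type*} {G : SimpleGraph V} {x y a b : V} (p : G.Walk x y)
    (h : (a, b) ∈ arcPairs p.support) : p.toSubgraph.Adj a b := by
  obtain ⟨d, hd, rfl, rfl⟩ := (mem_arcPairs_support p).1 h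
  rw [SimpleGraph.Walk.adj_toSubgraph_iff_mem_edges]
  exact List.mem_map_of_mem hd

theorem cyclicNext_of_adj {V : Type*} {G : SimpleGraph V} {u a b : V} {L : G.Walk u u}
    (hL : ¬ L.Nil) (h : L.toSubgraph.Adj a b) :
    CyclicNext (cyclicWord L) a b ∨ CyclicNext (cyclicWord L) b a := by
  rw [cyclicNext_cyclicWord hL, cyclicNext_cyclicWord hL]
  rw [SimpleGraph.Walk.adj_toSubgraph_iff_mem_edges] at h
  obtain ⟨d, hd, he⟩ := List.mem_map.1 h
  rcases SimpleGraph.dart_edge_eq_mk'_iff'.1 he with ⟨h1, h2⟩ | ⟨h1, h2⟩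
  · exact Or.inl ⟨d, hd, h1, h2⟩
  · exact Or.inr ⟨d, hd, h1, h2⟩

/-- Interior vertices of the first of two paths that partition a cycle do not lie on the second. -/
theorem notMem_support_of_partition {V : Type*} {G : SimpleGraph V} {u x y v : V}
    {L : G.Walk u u} (hL : L.IsCycle) {P Q : G.Walk x y} (hP : P.IsPath)
    (hd : Disjoint P.edgeSet Q.edgeSet) (hs : P.toSubgraph ⊔ Q.toSubgraph = L.toSubgraph)
    (hv : v ∈ P.support) (hvx : v ≠ x) (hvy : v ≠ y) : v ∉ Q.support := by
  classical
  intro hvQ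
  obtain ⟨w, hw⟩ : ∃ w, Q.toSubgraph.Adj v w := by
    have hn : ¬ (Q.takeUntil v hvQ).Nil := SimpleGraph.Walk.not_nil_of_ne hvx.symm
    have := (Q.takeUntil v hvQ).toSubgraph_adj_penultimate hn
    refine ⟨(Q.takeUntil v hvQ).penultimate, SimpleGraph.Subgraph.Adj.symm ?_⟩
    have h2 := congrArg SimpleGraph.Walk.toSubgraph (Q.take_spec hvQ)
    rw [SimpleGraph.Walk.toSubgraph_append] at h2
    rw [← h2]
    exact Or.inl this
  obtain ⟨i, rfl, hi⟩ := SimpleGraph.Walk.mem_support_iff_exists_getVert.1 hv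
  have hi0 : i ≠ 0 := by rintro rfl; exact hvx P.getVert_zero
  have hil : i < P.length := by
    refine lt_of_le_of_ne hi ?_
    rintro rfl; exact hvy P.getVert_length
  -- An interior vertex of `P` has both its neighbours on `L` along `P`, so an edge of `Q` at it
  -- would be an edge of `P` too.
  have h2 := hP.ncard_neighborSet_toSubgraph_internal_eq_two hi0 hil
  have hPL : ∀ z, P.toSubgraph.Adj (P.getVert i) z → L.toSubgraph.Adj (P.getVert i) z :=
    fun z hz => by rw [← hs]; exact Or.inl hz
  have hQL : L.toSubgraph.Adj (P.getVert i) w := by rw [← hs]; exact Or.inr hw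
  have h3 := hL.ncard_neighborSet_toSubgraph_eq_two (v := P.getVert i) (by
    rw [← SimpleGraph.Walk.mem_verts_toSubgraph]; exact hQL.fst_mem)
  have hfin : (L.toSubgraph.neighborSet (P.getVert i)).Finite :=
    Set.finite_of_ncard_pos (by omega)
  have heq := Set.eq_of_subset_of_ncard_le (show P.toSubgraph.neighborSet (P.getVert i) ⊆
    L.toSubgraph.neighborSet (P.getVert i) from hPL) (by omega) hfin
  have hPw : P.toSubgraph.Adj (P.getVert i) w := by
    have : w ∈ L.toSubgraph.neighborSet (P.getVert i) := hQL
    rw [← heq] at this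
    exact this
  rw [SimpleGraph.Walk.adj_toSubgraph_iff_mem_edges] at hw hPw
  exact Set.disjoint_left.1 hd hPw hw

/-- The vertices `y₁` and `y₂` cut the cycle into two sides that separate `x₁` from `x₂`. A path
containing the latter two would have to pass `y₁` or `y₂` in its interior, but these lie on the
complementary path. -/
theorem not_avoid_of_sublist {V : Type*} {G : SimpleGraph V} {u : V} {L : G.Walk u u}
    (hL : L.IsCycle) {B₁ B₂ : G.Subgraph} {x₁ y₁ x₂ y₂ : V}
    (hsub : List.Sublist [x₁, y₁, x₂, y₂] (cyclicWord L))
    (hx₁ : x₁ ∈ attachments L.toSubgraph B₁) (hx₂ : x₂ ∈ attachments L.toSubgraph B₁)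
    (hy₁ : y₁ ∈ attachments L.toSubgraph B₂) (hy₂ : y₂ ∈ attachments L.toSubgraph B₂) :
    ¬ Avoid L B₁ B₂ := by
  classical
  rintro ⟨x, y, P, Q, hP, hQ, hd, hs, h1, h2⟩
  have hnd := cyclicWord_nodup hL
  have hnd4 := hsub.nodup hnd
  obtain ⟨r₁, r₂, e, hs1, hs2⟩ := List.cons_sublist_iff.1 hsub
  obtain ⟨r₃, r₄, rfl, hs3, hs4⟩ := List.cons_sublist_iff.1 hs2
  obtain ⟨α, α', e1⟩ := List.append_of_mem hs3
  obtain ⟨r₅, r₆, rfl, hs5, hs6⟩ := List.cons_sublist_iff.1 hs4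
  obtain ⟨β, γ, e2⟩ := List.append_of_mem (List.singleton_sublist.1 hs6)
  have hw : cyclicWord L ~r y₁ :: ((α' ++ r₅ ++ β) ++ y₂ :: (γ ++ r₁ ++ α)) := by
    have : cyclicWord L = (r₁ ++ α) ++ (y₁ :: ((α' ++ r₅ ++ β) ++ y₂ :: γ)) := by
      rw [e, e1, e2]; simp
    rw [this]
    refine (isRotated_append_comm _ _).trans ?_
    simp [List.IsRotated.refl]
  set S := α' ++ r₅ ++ β with hS
  set T := γ ++ r₁ ++ α with hT
  have hnd' := hw.nodup_iff.1 hnd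
  have hx2 : x₂ ∈ S := by simp [hS, hs5]
  have hx1 : x₁ ∉ S := by
    have : x₁ ∈ T := by simp [hT, hs1]
    intro h
    have := (List.nodup_append.1 (List.nodup_cons.1 hnd').2).2.2 x₁ h x₁ (by simp [this])
    exact this rfl
  have hcol : ∀ a b, CyclicNext (cyclicWord L) a b → a ∉ ({y₁, y₂} : Set V) →
      b ∉ ({y₁, y₂} : Set V) → decide (a ∈ S) = decide (b ∈ S) := by
    intro a b hab ha hb
    rw [cyclicNext_isRotated hw, cyclicNext_cons] at hab
    have e : y₁ :: (S ++ y₂ :: T ++ [y₁]) = (y₁ :: S) ++ y₂ :: (T ++ [y₁]) := by simp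
    rw [e, mem_arcPairs_append] at hab
    simp only [Set.mem_insert_iff, Set.mem_singleton_iff, not_or] at ha hb
    rcases hab with hab | hab
    · have := mem_of_mem_arcPairs hab
      simp [ha, hb] at this
      simp [this]
    · have := mem_of_mem_arcPairs hab
      simp [ha, hb] at this
      have hd := (List.nodup_append.1 (List.nodup_cons.1 hnd').2).2.2
      have h3 : a ∉ S := fun h => hd a h a (by simp [this]) rfl
      have h4 : b ∉ S := fun h => hd b h b (by simp [this]) rfl
      simp [h3, h4]
  have hxy : x ≠ y := by
    rintro rfl
    have := h1 hx₁
    have := h1 hx₂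
    obtain rfl := SimpleGraph.Walk.eq_nil_iff_nil.2 (SimpleGraph.Walk.isPath_iff_nil.1 hP)
    simp_all
  obtain ⟨t, ht⟩ : ∃ t, P.support = x :: (t ++ [y]) := by
    have hn : ¬ P.Nil := SimpleGraph.Walk.not_nil_of_ne hxy
    cases P with
    | nil => simp at hn
    | cons h p =>
      exact ⟨p.support.dropLast, by
        rw [p.dropLast_support_concat, SimpleGraph.Walk.support_cons]⟩
  have hndP := hP.support_nodup
  rw [ht] at hndP
  have hmem : ∀ {v}, v ∈ P.support → v ∈ x :: (t ++ [y]) := fun h => ht ▸ h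
  have hnotx : ∀ z ∈ ({x₁, x₂} : Set V), z ∉ ({y₁, y₂} : Set V) := by
    simp only [List.nodup_cons, List.mem_cons, not_or] at hnd4
    rintro z (rfl | rfl) (rfl | rfl) <;> tauto
  have := eq_of_arcPairs_interior (Y := {y₁, y₂}) (c := fun a => decide (a ∈ S)) (t := t) (x := x)
    (y := y) (by
      intro v hv hvY
      have hvP : v ∈ P.support := by rw [ht]; simp [hv]
      have hvx : v ≠ x := by rintro rfl; simp [hv] at hndP
      have hvy : v ≠ y := by
        rintro rfl
        exact (List.nodup_append.1 (List.nodup_cons.1 hndP).2).2.2 v hv v (by simp) rfl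
      refine notMem_support_of_partition hL hP hd hs hvP hvx hvy ?_
      rcases hvY with rfl | rfl
      · exact h2 hy₁
      · exact h2 hy₂) (by
      intro a b hab ha hb
      rw [← ht] at hab
      have hab := adj_of_mem_arcPairs_support P hab
      have : L.toSubgraph.Adj a b := by rw [← hs]; exact Or.inl hab
      rcases cyclicNext_of_adj hL.not_nil this with h | h
      · exact hcol a b h ha hb
      · exact (hcol b a h hb ha).symm) x₁ (hmem (h1 hx₁)) (hnotx _ (by simp)) x₂
        (hmem (h1 hx₂)) (hnotx _ (by simp))
  simp [hx1, hx2] at this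

/-! ### Structure of tree bridges -/

theorem VossBridges.IsBridge.not_adj {V : Type*} {G : SimpleGraph V} {H B : G.Subgraph} (hB : IsBridge H B)
    {a b : V} (h : B.Adj a b) : ¬ H.Adj a b := by
  rcases hB with ⟨x, y, hxy, hx, hy, hn, rfl⟩ | ⟨K, rfl⟩
  · rw [SimpleGraph.subgraphOfAdj_adj] at h
    rcases Sym2.eq_iff.1 h with ⟨rfl, rfl⟩ | ⟨rfl, rfl⟩
    · exact hn
    · exact fun h => hn h.symm
  · intro hH
    have hD : ∀ z, z ∈ Subtype.val '' K.supp → z ∉ H.verts := by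
      rintro _ ⟨⟨z, hz⟩, _, rfl⟩
      exact hz
    rcases h.2 with h | h | h
    · exact hD a h.1 hH.fst_mem
    · exact hD a h.1 hH.fst_mem
    · exact hD b h.2 hH.snd_mem

theorem mem_component_of_adj {V : Type*} {G : SimpleGraph V} {H : G.Subgraph}
    {K : (G.induce H.vertsᶜ).ConnectedComponent} {a b : V} (ha : a ∈ Subtype.val '' K.supp)
    (hb : b ∉ H.verts) (hab : G.Adj a b) : b ∈ Subtype.val '' K.supp := by
  obtain ⟨a', ha', rfl⟩ := ha
  refine ⟨⟨b, hb⟩, ?_, rfl⟩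
  rw [SimpleGraph.ConnectedComponent.mem_supp_iff] at ha' ⊢
  rw [← ha']
  exact (SimpleGraph.ConnectedComponent.connectedComponentMk_eq_of_adj (by simpa using hab)).symm

theorem exists_isBridge_adj {V : Type*} {G : SimpleGraph V} {H : G.Subgraph} {a b : V}
    (hab : G.Adj a b) (hn : ¬ H.Adj a b) : ∃ B, IsBridge H B ∧ B.Adj a b := by
  by_cases ha : a ∈ H.verts
  · by_cases hb : b ∈ H.verts
    · exact ⟨_, Or.inl ⟨a, b, hab, ha, hb, hn, rfl⟩, by simp⟩
    · refine ⟨_, Or.inr ⟨(G.induce H.vertsᶜ).connectedComponentMk ⟨b, hb⟩, rfl⟩, hab,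
        Or.inr (Or.inr ⟨ha, ⟨b, hb⟩, rfl, rfl⟩)⟩
  · have hm : a ∈ Subtype.val '' ((G.induce H.vertsᶜ).connectedComponentMk ⟨a, ha⟩).supp :=
      ⟨⟨a, ha⟩, rfl, rfl⟩
    refine ⟨_, Or.inr ⟨(G.induce H.vertsᶜ).connectedComponentMk ⟨a, ha⟩, rfl⟩, hab, ?_⟩
    by_cases hb : b ∈ H.verts
    · exact Or.inr (Or.inl ⟨hm, hb⟩)
    · exact Or.inl ⟨hm, mem_component_of_adj hm hb hab⟩

theorem VossBridges.IsBridge.adj_of_mem {V : Type*} {G : SimpleGraph V} {H B : G.Subgraph}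
    (hB : IsBridge H B) {a b : V} (ha : a ∈ B.verts) (haH : a ∉ H.verts) (hab : G.Adj a b) :
    B.Adj a b := by
  rcases hB with ⟨x, y, hxy, hx, hy, hn, rfl⟩ | ⟨K, rfl⟩
  · rcases ha with rfl | rfl
    · exact absurd hx haH
    · exact absurd hy haH
  · rcases ha with ha | ha
    · refine ⟨hab, ?_⟩
      by_cases hb : b ∈ H.verts
      · exact Or.inr (Or.inl ⟨ha, hb⟩)
      · exact Or.inl ⟨ha, mem_component_of_adj ha hb hab⟩
    · exact absurd ha.1 haH

theorem VossBridges.IsBridge.exists_adj {V : Type*} {G : SimpleGraph V} (hG : G.Connected) [Nontrivial V]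
    {H B : G.Subgraph} (hB : IsBridge H B) : ∃ a b, B.Adj a b := by
  rcases id hB with ⟨x, y, hxy, hx, hy, hn, rfl⟩ | ⟨K, rfl⟩
  · exact ⟨x, y, by simp⟩
  · obtain ⟨a, ha⟩ := K.nonempty_supp
    obtain ⟨b, hb⟩ := hG.preconnected.exists_adj_of_nontrivial a.1
    exact ⟨a, b, hB.adj_of_mem (Or.inl ⟨a, ha, rfl⟩) a.2 hb⟩

/-- In an acyclic subgraph, the ends of an edge are separated by its deletion. -/
theorem not_reachable_deleteEdges {V : Type*} {G : SimpleGraph V} {B : G.Subgraph}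
    (hB : B.coe.IsAcyclic) {a b : V} (hab : B.Adj a b) :
    ¬ (B.spanningCoe.deleteEdges {s(a, b)}).Reachable a b := by
  have key : ∀ {x y : V} (p : (B.spanningCoe.deleteEdges {s(a, b)}).Walk x y) (hx : x ∈ B.verts),
      ∃ hy : y ∈ B.verts, (B.coe.deleteEdges {s(⟨a, hab.fst_mem⟩, ⟨b, hab.snd_mem⟩)}).Reachable
        ⟨x, hx⟩ ⟨y, hy⟩ := by
    intro x y p
    induction p with
    | nil => exact fun hx => ⟨hx, SimpleGraph.Reachable.refl _⟩
    | cons h p ih =>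
      intro hx
      rw [SimpleGraph.deleteEdges_adj] at h
      have h1 : B.Adj _ _ := h.1
      obtain ⟨hy, hr⟩ := ih h1.snd_mem
      refine ⟨hy, SimpleGraph.Reachable.trans (SimpleGraph.Adj.reachable ?_) hr⟩
      rw [SimpleGraph.deleteEdges_adj]
      refine ⟨h1, fun he => h.2 ?_⟩
      have := congrArg (Sym2.map Subtype.val) (Set.mem_singleton_iff.1 he)
      simpa using this
  rintro ⟨p⟩
  obtain ⟨_, hr⟩ := key p hab.fst_mem
  have := SimpleGraph.isAcyclic_iff_forall_adj_isBridge.1 hB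
    (show B.coe.Adj ⟨a, hab.fst_mem⟩ ⟨b, hab.snd_mem⟩ from hab)
  exact this hr

theorem exists_isPath_of_connected {V : Type*} {G : SimpleGraph V} {B : G.Subgraph}
    (hB : B.coe.Connected) {x y : V} (hx : x ∈ B.verts) (hy : y ∈ B.verts) :
    ∃ p : G.Walk x y, p.IsPath ∧ ∀ d ∈ p.darts, B.Adj d.fst d.snd := by
  obtain ⟨p, hp⟩ := hB.exists_isPath ⟨x, hx⟩ ⟨y, hy⟩
  refine ⟨p.map B.hom, hp.map B.hom_injective, ?_⟩
  intro d hd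
  obtain ⟨d', _, rfl⟩ := List.mem_map.1
    (show d ∈ p.darts.map B.hom.mapDart from (SimpleGraph.Walk.darts_map B.hom p) ▸ hd)
  exact d'.adj

/-- Two edges from an attachment into one component would close a cycle, since the component is
connected without the attachment. Hence paths in a tree bridge meet `H` at most in their ends. -/
theorem VossBridges.IsBridge.eq_of_adj {V : Type*} {G : SimpleGraph V} {H B : G.Subgraph}
    (hB : IsBridge H B) (hT : B.coe.IsAcyclic) {x y z : V} (hx : x ∈ H.verts)
    (hxy : B.Adj x y) (hxz : B.Adj x z) : y = z := by
  by_contra hyz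
  refine not_reachable_deleteEdges hT hxy ?_
  have hz : (B.spanningCoe.deleteEdges {s(x, y)}).Adj x z := by
    rw [SimpleGraph.deleteEdges_adj]
    refine ⟨hxz, fun h => ?_⟩
    rcases Sym2.eq_iff.1 (Set.mem_singleton_iff.1 h) with ⟨_, h⟩ | ⟨h, h'⟩
    · exact hyz h.symm
    · exact hxz.ne h'.symm
  refine hz.reachable.trans ?_
  rcases hB with ⟨a, b, hab, ha, hb, hn, rfl⟩ | ⟨K, rfl⟩
  · exact absurd (by
      rw [SimpleGraph.subgraphOfAdj_adj] at hxy hxz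
      exact (Sym2.congr_right.1 (hxy.symm.trans hxz))) hyz
  · have hD : ∀ {v}, v ∈ Subtype.val '' K.supp → v ∉ H.verts := by
      rintro _ ⟨⟨v, hv⟩, _, rfl⟩
      exact hv
    have hK : ∀ {v}, (attachedSubgraph H (Subtype.val '' K.supp)).Adj x v →
        v ∈ Subtype.val '' K.supp := by
      intro v h
      rcases h.2 with h | h | h
      · exact absurd hx (hD h.1)
      · exact absurd hx (hD h.1)
      · exact h.2
    have key : ∀ {v w : (H.vertsᶜ : Set V)} (p : (G.induce H.vertsᶜ).Walk v w), v ∈ K.supp →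
        ((attachedSubgraph H (Subtype.val '' K.supp)).spanningCoe.deleteEdges
          {s(x, y)}).Reachable v.1 w.1 := by
      intro v w p
      induction p with
      | nil => exact fun _ => SimpleGraph.Reachable.refl _
      | @cons v w _ h p ih =>
        intro hv
        have hw : w ∈ K.supp := by
          rw [SimpleGraph.ConnectedComponent.mem_supp_iff] at hv ⊢
          rw [← hv]
          exact (SimpleGraph.ConnectedComponent.connectedComponentMk_eq_of_adj h).symm
        refine SimpleGraph.Reachable.trans (SimpleGraph.Adj.reachable ?_) (ih hw)
        rw [SimpleGraph.deleteEdges_adj]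
        refine ⟨⟨h, Or.inl ⟨⟨v, hv, rfl⟩, ⟨w, hw, rfl⟩⟩⟩, fun he => ?_⟩
        rcases Sym2.eq_iff.1 (Set.mem_singleton_iff.1 he) with ⟨h, _⟩ | ⟨_, h⟩
        · exact v.2 (h ▸ hx)
        · exact w.2 (h ▸ hx)
    obtain ⟨y', hy', rfl⟩ := hK hxy
    obtain ⟨z', hz', rfl⟩ := hK hxz
    obtain ⟨p⟩ := K.reachable_of_mem_supp hz' hy'
    exact key p hz'

/-- Deleting an edge of a bridge leaves attachments on both sides. -/
theorem VossBridges.IsBridge.exists_attachment {V : Type*} {G : SimpleGraph V}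
    (hG : IsTwoConnected G) {H B : G.Subgraph} (hH : H.verts.Nontrivial) (hB : IsBridge H B)
    {a b : V} (hab : B.Adj a b) :
    ∃ x ∈ attachments H B, (B.spanningCoe.deleteEdges {s(a, b)}).Reachable a x := by
  by_contra hno
  push Not at hno
  have hmem : ∀ {x}, (B.spanningCoe.deleteEdges {s(a, b)}).Reachable a x → x ∈ B.verts := by
    rintro x ⟨p⟩
    cases hp : p.reverse with
    | nil => exact hab.fst_mem
    | cons h q => exact (SimpleGraph.deleteEdges_adj.1 h).1.fst_mem
  have hout : ∀ {x}, (B.spanningCoe.deleteEdges {s(a, b)}).Reachable a x → x ∉ H.verts :=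
    fun hx hxH => hno _ ⟨hxH, hmem hx⟩ hx
  have hab' : a ≠ b := hab.ne
  -- The side of `a` misses `H`, so all edges of `G` at its vertices belong to the bridge, and only
  -- the edge to `b` leaves it. Deleting `b` would therefore separate `a` from `H`.
  have key : ∀ {x y : {w // w ≠ b}} (p : (G.induce {w | w ≠ b}).Walk x y),
      (B.spanningCoe.deleteEdges {s(a, b)}).Reachable a x.1 →
      (B.spanningCoe.deleteEdges {s(a, b)}).Reachable a y.1 := by
    intro x y p
    induction p with
    | nil => exact id
    | @cons x y _ h p ih =>
      intro hx
      refine ih (hx.trans (SimpleGraph.Adj.reachable ?_))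
      rw [SimpleGraph.deleteEdges_adj]
      refine ⟨hB.adj_of_mem (hmem hx) (hout hx) h, fun he => ?_⟩
      rcases Sym2.eq_iff.1 (Set.mem_singleton_iff.1 he) with ⟨_, h⟩ | ⟨h, _⟩
      · exact y.2 h
      · exact x.2 h
  obtain ⟨c, hc, hcb⟩ := hH.exists_ne b
  obtain ⟨p⟩ := (hG.2.2 b).preconnected ⟨a, hab'⟩ ⟨c, hcb⟩
  exact hout (key p (SimpleGraph.Reachable.refl _)) hc

/-- Each side of an edge of the tree contains an attachment, and the two sides are disjoint. -/
theorem VossBridges.IsBridge.attachments_nontrivial {V : Type*} {G : SimpleGraph V}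
    (hG : IsTwoConnected G) {H B : G.Subgraph} (hH : H.verts.Nontrivial) (hB : IsBridge H B)
    (hT : B.coe.IsAcyclic) : (attachments H B).Nontrivial := by
  have : Nontrivial V := by
    obtain ⟨x, _, y, _, h⟩ := hH
    exact ⟨x, y, h⟩
  obtain ⟨a, b, hab⟩ := hB.exists_adj hG.2.1
  obtain ⟨x, hx, hax⟩ := hB.exists_attachment hG hH hab
  obtain ⟨y, hy, hby⟩ := hB.exists_attachment hG hH hab.symm
  refine ⟨x, hx, y, hy, ?_⟩
  rintro rfl
  rw [Sym2.eq_swap] at hby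
  exact not_reachable_deleteEdges hT hab (hax.trans hby.symm)

/-! ### The overlap graph as crossing graph of the attachment word -/

theorem exists_sublist_of_sublist_filterMap {A B : Type*} {l : A → Option B} {w : List A} :
    ∀ {u : List B}, List.Sublist u (w.filterMap l) →
      ∃ w', List.Sublist w' w ∧ w'.map l = u.map some := by
  induction w with
  | nil =>
    intro u hu
    obtain rfl := List.sublist_nil.1 hu
    exact ⟨[], List.Sublist.refl _, rfl⟩
  | cons a w ih =>
    intro u hu
    cases ha : l a with
    | none =>
      rw [List.filterMap_cons_none ha] at hu
      obtain ⟨w', h1, h2⟩ := ih hu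
      exact ⟨w', h1.cons _, h2⟩
    | some c =>
      rw [List.filterMap_cons_some ha] at hu
      rcases List.sublist_cons_iff.1 hu with h | ⟨r, rfl, h⟩
      · obtain ⟨w', h1, h2⟩ := ih h
        exact ⟨w', h1.cons _, h2⟩
      · obtain ⟨w', h1, h2⟩ := ih h
        exact ⟨a :: w', h1.cons_cons _, by simp [ha, h2]⟩

/-- The occurrences of two letters that do not cross can be separated by cutting the cyclic word
twice. -/
theorem exists_split_of_not_crosses {B : Type*} {w : List B} {a b : B} (hab : a ≠ b) (ha : a ∈ w)
    (hb : b ∈ w) (h : ¬ Crosses w a b) : ∃ α β, w ~r α ++ β ∧ b ∉ α ∧ a ∉ β := by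
  obtain ⟨s, t, rfl⟩ := List.append_of_mem hb
  have hr := isRotated_append_comm s (b :: t)
  rw [crosses_isRotated hr] at h
  have ha' : a ∈ t ++ s := by
    have := hr.mem_iff.1 ha
    simp [hab] at this ⊢
    exact this
  rw [List.cons_append] at h hr
  generalize t ++ s = v at *
  obtain ⟨p, v', rfl, hp⟩ := List.eq_append_cons_of_mem ha'
  obtain ⟨m, r, e, har⟩ := exists_last_occurrence (v := a) (w := a :: v') (by simp)
  rw [e] at hr h
  refine ⟨m ++ [a], r ++ b :: p, ?_, ?_, by simp [har, hp, hab]⟩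
  · refine hr.trans ?_
    refine (isRotated_append_comm (b :: p) (m ++ a :: r)).trans ?_
    simp [List.IsRotated.refl]
  · intro hbm
    have hbm : b ∈ m := by simpa [hab.symm] using hbm
    cases m with
    | nil => simp at hbm
    | cons c m =>
      obtain ⟨rfl, _⟩ := List.cons.inj e
      have hbm : b ∈ m := by simpa [hab.symm] using hbm
      refine h ⟨hab, Or.inr (List.Sublist.cons_cons _ ?_)⟩
      refine List.Sublist.trans ?_ (List.sublist_append_right p _)
      rw [List.cons_append]
      exact ((List.singleton_sublist.2 hbm).append (List.singleton_sublist.2 (by simp))).cons_cons _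

open Classical in
/-- The bridge to which a vertex of the cycle is attached. -/
noncomputable def letter {V : Type*} {G : SimpleGraph V} {u : V} (L : G.Walk u u) (x : V) :
    Option (Bridge L.toSubgraph) :=
  if h : ∃ T : Bridge L.toSubgraph, x ∈ attachments L.toSubgraph T.1 then some h.choose else none

section

variable {V : Type*} {G : SimpleGraph V} {u : V} {L : G.Walk u u}

theorem letter_eq_some
    (hdisj : ∀ T₁ T₂ : Bridge L.toSubgraph, T₁ ≠ T₂ → Disjoint T₁.1.verts T₂.1.verts)
    {x : V} {T : Bridge L.toSubgraph} :
    letter L x = some T ↔ x ∈ attachments L.toSubgraph T.1 := by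
  unfold letter
  constructor
  · intro h
    split_ifs at h with hx
    obtain rfl := Option.some.inj h
    exact hx.choose_spec
  · intro h
    have hx : ∃ T : Bridge L.toSubgraph, x ∈ attachments L.toSubgraph T.1 := ⟨T, h⟩
    rw [dif_pos hx, Option.some.injEq]
    by_contra hne
    exact Set.disjoint_left.1 (hdisj _ _ hne) hx.choose_spec.2 h.2

theorem mem_cyclicWord_of_letter (hL : L.IsCycle)
    (hdisj : ∀ T₁ T₂ : Bridge L.toSubgraph, T₁ ≠ T₂ → Disjoint T₁.1.verts T₂.1.verts)
    {x : V} {T : Bridge L.toSubgraph} (h : letter L x = some T) : x ∈ cyclicWord L :=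
  (mem_cyclicWord hL.not_nil).2
    ((SimpleGraph.Walk.mem_verts_toSubgraph L).1 ((letter_eq_some hdisj).1 h).1)

theorem not_avoid_of_crosses (hL : L.IsCycle)
    (hdisj : ∀ T₁ T₂ : Bridge L.toSubgraph, T₁ ≠ T₂ → Disjoint T₁.1.verts T₂.1.verts)
    {a b : Bridge L.toSubgraph} (h : Crosses ((cyclicWord L).filterMap (letter L)) a b) :
    ¬ Avoid L a.1 b.1 := by
  have key : ∀ a b, List.Sublist [a, b, a, b] ((cyclicWord L).filterMap (letter L)) →
      ¬ Avoid L a.1 b.1 := by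
    intro a b h
    obtain ⟨w, hw, hm⟩ := exists_sublist_of_sublist_filterMap h
    obtain ⟨x₁, w, rfl, h1, hm⟩ := List.map_eq_cons_iff.1 hm
    obtain ⟨y₁, w, rfl, h2, hm⟩ := List.map_eq_cons_iff.1 hm
    obtain ⟨x₂, w, rfl, h3, hm⟩ := List.map_eq_cons_iff.1 hm
    obtain ⟨y₂, w, rfl, h4, hm⟩ := List.map_eq_cons_iff.1 hm
    obtain rfl := List.map_eq_nil_iff.1 hm
    exact not_avoid_of_sublist hL hw ((letter_eq_some hdisj).1 h1)
      ((letter_eq_some hdisj).1 h3) ((letter_eq_some hdisj).1 h2) ((letter_eq_some hdisj).1 h4)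
  rcases h.2 with h | h
  · exact key a b h
  · exact fun h' => key b a h h'.symm

theorem avoid_of_not_crosses (hL : L.IsCycle)
    (hdisj : ∀ T₁ T₂ : Bridge L.toSubgraph, T₁ ≠ T₂ → Disjoint T₁.1.verts T₂.1.verts)
    (hne : ∀ T : Bridge L.toSubgraph, (attachments L.toSubgraph T.1).Nonempty)
    {a b : Bridge L.toSubgraph} (hab : a ≠ b)
    (h : ¬ Crosses ((cyclicWord L).filterMap (letter L)) a b) : Avoid L a.1 b.1 := by
  have hmem : ∀ T, T ∈ (cyclicWord L).filterMap (letter L) := by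
    intro T
    obtain ⟨x, hx⟩ := hne T
    have := (letter_eq_some hdisj).2 hx
    exact List.mem_filterMap.2 ⟨x, mem_cyclicWord_of_letter hL hdisj this, this⟩
  obtain ⟨α, β, hr, hb, ha⟩ := exists_split_of_not_crosses hab (hmem a) (hmem b) h
  obtain ⟨w, hw, e⟩ := exists_isRotated_filterMap hr
  obtain ⟨α', β', rfl, rfl, rfl⟩ := List.filterMap_eq_append_iff.1 e
  have h1 : ∀ x ∈ attachments L.toSubgraph a.1, x ∈ α' := by
    intro x hx
    have hx := (letter_eq_some hdisj).2 hx
    have := hw.mem_iff.1 (mem_cyclicWord_of_letter hL hdisj hx)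
    rcases List.mem_append.1 this with h | h
    · exact h
    · exact absurd (List.mem_filterMap.2 ⟨x, h, hx⟩) ha
  have h2 : ∀ x ∈ attachments L.toSubgraph b.1, x ∈ β' := by
    intro x hx
    have hx := (letter_eq_some hdisj).2 hx
    have := hw.mem_iff.1 (mem_cyclicWord_of_letter hL hdisj hx)
    rcases List.mem_append.1 this with h | h
    · exact absurd (List.mem_filterMap.2 ⟨x, h, hx⟩) hb
    · exact h
  obtain ⟨x, hx⟩ := hne a
  obtain ⟨y, hy⟩ := hne b
  exact avoid_of_split hL hw (List.ne_nil_of_mem (h1 x hx)) (List.ne_nil_of_mem (h2 y hy)) h1 h2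

/-- A member of `S` farthest from `t` works: a neighbour in `S` is not farther, so a shortest path
to it extends to `v`. The neighbour is then the penultimate vertex of the unique path from `t` to
`v`. -/
theorem SimpleGraph.IsTree.exists_leaf {B : Type*} {O : SimpleGraph B} (hO : O.IsTree)
    {S : Finset B} {t : B} (hS : 2 ≤ S.card) :
    ∃ v ∈ S, v ≠ t ∧ ∀ x ∈ S, ∀ y ∈ S, O.Adj v x → O.Adj v y → x = y := by
  classical
  obtain ⟨v, hv, hmax⟩ := S.exists_max_image (O.dist t) (Finset.card_pos.1 (by omega))
  obtain ⟨z, hz, hzt⟩ := Finset.exists_mem_ne (show 1 < S.card by omega) t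
  have hvt : v ≠ t := by
    rintro rfl
    have h1 := hmax z hz
    rw [SimpleGraph.dist_self] at h1
    exact hzt ((hO.connected.dist_eq_zero_iff).1 (Nat.le_zero.1 h1)).symm
  refine ⟨v, hv, hvt, ?_⟩
  have key : ∀ x ∈ S, O.Adj v x → ∃ p : O.Walk t v, p.IsPath ∧ p.penultimate = x := by
    intro x hx hvx
    obtain ⟨p, hp, hl⟩ := hO.connected.exists_path_of_dist t x
    have hvp : v ∉ p.support := by
      intro hmem
      have h1 := SimpleGraph.dist_le (p.takeUntil v hmem)
      have h2 := SimpleGraph.Walk.length_takeUntil_lt_length hmem hvx.ne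
      have h3 := hmax x hx
      omega
    exact ⟨p.concat hvx.symm, hp.concat hvp hvx.symm, by simp⟩
  intro x hx y hy hvx hvy
  obtain ⟨p, hp, rfl⟩ := key x hx hvx
  obtain ⟨q, hq, rfl⟩ := key y hy hvy
  rw [(hO.existsUnique_path t v).unique hp hq]

theorem pair_sublist_of_mem {A : Type*} {x y : A} {w : List A} (hx : x ∈ w) (hy : y ∈ w)
    (h : x ≠ y) : List.Sublist [x, y] w ∨ List.Sublist [y, x] w := by
  obtain ⟨s, t, rfl⟩ := List.append_of_mem hx
  rcases List.mem_append.1 hy with hy | hy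
  · exact Or.inr ((List.singleton_sublist.2 hy).append (List.singleton_sublist.2 (by simp)))
  · have : y ∈ t := by simpa [h.symm] using hy
    exact Or.inl (((List.singleton_sublist.2 this).cons_cons x).trans
      (List.sublist_append_right _ _))

/-- Crossing of letters is overlap of bridges, so connectivity and leaves come from the overlap
graph; two attachments per bridge give the two occurrences. -/
theorem isTreeWord_letter (hL : L.IsCycle)
    (hdisj : ∀ T₁ T₂ : Bridge L.toSubgraph, T₁ ≠ T₂ → Disjoint T₁.1.verts T₂.1.verts)
    (hO : (overlapGraph L).IsTree)
    (hatt : ∀ T : Bridge L.toSubgraph, (attachments L.toSubgraph T.1).Nontrivial) :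
    IsTreeWord ((cyclicWord L).filterMap (letter L)) := by
  refine ⟨?_, ?_, ?_⟩
  · intro T _
    obtain ⟨x, hx, y, hy, hxy⟩ := hatt T
    have hx := (letter_eq_some hdisj).2 hx
    have hy := (letter_eq_some hdisj).2 hy
    rcases pair_sublist_of_mem (mem_cyclicWord_of_letter hL hdisj hx)
      (mem_cyclicWord_of_letter hL hdisj hy) hxy with h | h
    · have := h.filterMap (letter L)
      simpa [hx, hy] using this
    · have := h.filterMap (letter L)
      simpa [hx, hy] using this
  · intro s hs a ha b hb
    clear ha hb
    obtain ⟨p⟩ := hO.connected.preconnected a b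
    induction p with
    | nil => rfl
    | cons h p ih =>
      refine Eq.trans (hs _ _ ?_) ih
      by_contra hc
      exact h.2 (avoid_of_not_crosses hL hdisj (fun T => (hatt T).nonempty) h.1 hc)
  · intro S t _ hS
    obtain ⟨v, hv, hvt, h⟩ := hO.exists_leaf (t := t) hS
    exact ⟨v, hv, hvt, fun x hx y hy hx' hy' =>
      h x hx y hy ⟨hx'.1, not_avoid_of_crosses hL hdisj hx'⟩
        ⟨hy'.1, not_avoid_of_crosses hL hdisj hy'⟩⟩

end

/-! ### Recognising cycles from degrees and connectivity -/

section

variable {V : Type*} {G : SimpleGraph V}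

theorem exists_mem_darts_snd_eq {u v w : V} {p : G.Walk u v} (hw : w ∈ p.support) (hwu : w ≠ u) :
    ∃ d ∈ p.darts, d.snd = w := by
  have : w ∈ p.support.tail := by
    rw [← p.cons_tail_support] at hw
    exact (List.mem_cons.1 hw).resolve_left hwu
  rw [← p.map_snd_darts] at this
  obtain ⟨d, hd, rfl⟩ := List.mem_map.1 this
  exact ⟨d, hd, rfl⟩

theorem exists_mem_darts_fst_eq {u v w : V} {p : G.Walk u v} (hw : w ∈ p.support) (hwv : w ≠ v) :
    ∃ d ∈ p.darts, d.fst = w := by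
  have : w ∈ p.support.dropLast := by
    rw [← p.dropLast_support_concat] at hw
    exact (List.mem_append.1 hw).resolve_right (by simpa using hwv)
  rw [← p.map_fst_darts] at this
  obtain ⟨d, hd, rfl⟩ := List.mem_map.1 this
  exact ⟨d, hd, rfl⟩

theorem SimpleGraph.Walk.IsPath.fst_ne_of_mem_darts {u v : V} {p : G.Walk u v} (hp : p.IsPath)
    {d : G.Dart} (hd : d ∈ p.darts) : d.fst ≠ v := by
  have h1 : d.fst ∈ p.support.dropLast := by
    rw [← p.map_fst_darts]; exact List.mem_map_of_mem hd
  have := hp.support_nodup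
  rw [← p.dropLast_support_concat, List.nodup_append] at this
  exact this.2.2 _ h1 v (by simp)

theorem SimpleGraph.Walk.IsPath.eq_of_snd_eq {u v : V} {p : G.Walk u v} (hp : p.IsPath)
    {d d' : G.Dart} (hd : d ∈ p.darts) (hd' : d' ∈ p.darts) (h : d.snd = d'.snd) : d = d' := by
  have h1 : (p.darts.map (·.snd)).Nodup := by
    rw [p.map_snd_darts]
    exact (List.tail_sublist _).nodup hp.support_nodup
  exact List.inj_on_of_nodup_map h1 hd hd' h

/-- A finite set of darts in which every dart has a unique successor and that is connected is the
set of darts of a cycle. -/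
theorem exists_isCycle_darts_eq [Finite V] {D : Set G.Dart} (hne : D.Nonempty)
    (hsucc : ∀ d ∈ D, ∃ d' ∈ D, d'.fst = d.snd)
    (hinj : ∀ d ∈ D, ∀ d' ∈ D, d.snd = d'.snd → d = d') (hsymm : ∀ d ∈ D, d.symm ∉ D)
    (hconn : ∀ s : V → Bool, (∀ d ∈ D, s d.fst = s d.snd) →
      ∀ d ∈ D, ∀ d' ∈ D, s d.fst = s d'.fst) :
    ∃ (u : V) (c : G.Walk u u), c.IsCycle ∧ D = {d | d ∈ c.darts} := by
  classical
  have : Finite G.Dart := Finite.of_injective _ SimpleGraph.Dart.toProd_injective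
  have hfin : D.Finite := Set.toFinite D
  -- Counting: heads are distinct and every head is a tail, so in a finite set the tails are
  -- distinct as well.
  have hinj' : ∀ d ∈ D, ∀ d' ∈ D, d.fst = d'.fst → d = d' := by
    have hsub : (fun d : G.Dart => d.snd) '' D ⊆ (fun d : G.Dart => d.fst) '' D := by
      rintro _ ⟨d, hd, rfl⟩
      obtain ⟨d', hd', h⟩ := hsucc d hd
      exact ⟨d', hd', h⟩
    have h1 := Set.ncard_le_ncard hsub (hfin.image _)
    rw [Set.InjOn.ncard_image (fun d hd d' hd' h => hinj d hd d' hd' h)] at h1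
    have h2 := le_antisymm (Set.ncard_image_le (f := fun d : G.Dart => d.fst) hfin) h1
    have h3 := (Set.ncard_image_iff hfin).1 h2
    exact fun d hd d' hd' h => h3 hd hd' h
  -- A path following successors either grows or closes. It can close only at its start, because
  -- heads are distinct; `hsymm` rules out a closed walk of length two.
  have key : ∀ k : ℕ, (∃ (u : V) (c : G.Walk u u), c.IsCycle ∧ ∀ d ∈ c.darts, d ∈ D) ∨
      ∃ (u v : V) (p : G.Walk u v), p.IsPath ∧ p.length = k + 1 ∧ ∀ d ∈ p.darts, d ∈ D := by
    intro k
    induction k with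
    | zero =>
      obtain ⟨d, hd⟩ := hne
      refine Or.inr ⟨_, _, SimpleGraph.Walk.cons d.adj SimpleGraph.Walk.nil, ?_, rfl, ?_⟩
      · simp [SimpleGraph.Walk.cons_isPath_iff, d.adj.ne]
      · simpa using hd
    | succ k ih =>
      rcases ih with h | ⟨u, v, p, hp, hl, hD⟩
      · exact Or.inl h
      have hlast : ∃ d ∈ p.darts, d.snd = v := by
        refine exists_mem_darts_snd_eq p.end_mem_support ?_
        rintro rfl
        have := SimpleGraph.Walk.isPath_iff_nil.1 hp
        rw [← SimpleGraph.Walk.length_eq_zero_iff] at this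
        omega
      obtain ⟨d₀, hd₀, rfl⟩ := hlast
      obtain ⟨d, hd, hdf⟩ := hsucc d₀ (hD d₀ hd₀)
      have hadj : G.Adj d₀.snd d.snd := hdf ▸ d.adj
      have hdd : d = ⟨(d₀.snd, d.snd), hadj⟩ := SimpleGraph.Dart.ext _ _ (Prod.ext hdf rfl)
      have hdp : d ∉ p.darts := fun h => hp.fst_ne_of_mem_darts h hdf
      by_cases hmem : d.snd ∈ p.support
      · by_cases hu : d.snd = u
        · left
          have hadj' : G.Adj u d₀.snd := by rw [← hu]; exact hadj.symm
          refine ⟨d₀.snd, SimpleGraph.Walk.cons hadj'.symm p, ?_, ?_⟩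
          · rw [SimpleGraph.Walk.cons_isCycle_iff]
            refine ⟨hp, fun he => ?_⟩
            obtain ⟨e, he, hee⟩ := List.mem_map.1 he
            rcases SimpleGraph.dart_edge_eq_mk'_iff'.1 hee with ⟨h1, h2⟩ | ⟨h1, h2⟩
            · exact hp.fst_ne_of_mem_darts he h1
            · refine hsymm d hd ?_
              have : d.symm = e := SimpleGraph.Dart.ext _ _
                (Prod.ext (by simp [h1, hu]) (by simp [h2, hdf]))
              rw [this]
              exact hD e he
          · intro e he
            rw [SimpleGraph.Walk.darts_cons, List.mem_cons] at he
            rcases he with rfl | he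
            · have : d = ⟨(d₀.snd, u), hadj'.symm⟩ := SimpleGraph.Dart.ext _ _ (Prod.ext hdf hu)
              exact this ▸ hd
            · exact hD e he
        · obtain ⟨e, he, hes⟩ := exists_mem_darts_snd_eq hmem hu
          exact absurd (hinj e (hD e he) d hd hes ▸ he) hdp
      · refine Or.inr ⟨u, d.snd, p.concat hadj, hp.concat hmem hadj, by simp [hl], ?_⟩
        intro e he
        rw [SimpleGraph.Walk.darts_concat, List.concat_eq_append, List.mem_append] at he
        rcases he with he | he
        · exact hD e he
        · rw [List.mem_singleton] at he
          rw [he, ← hdd]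
          exact hd
  obtain ⟨u, c, hc, hcD⟩ : ∃ (u : V) (c : G.Walk u u), c.IsCycle ∧ ∀ d ∈ c.darts, d ∈ D := by
    have := Fintype.ofFinite V
    rcases key (Fintype.card V) with h | ⟨u, v, p, hp, hl, _⟩
    · exact h
    · have := hp.length_lt
      omega
  refine ⟨u, c, hc, Set.Subset.antisymm ?_ hcD⟩
  have hfst : ∀ w ∈ c.support, ∃ d ∈ c.darts, d.fst = w := by
    intro w hw
    have := (mem_cyclicWord hc.not_nil).2 hw
    rw [cyclicWord_eq_map] at this
    obtain ⟨d, hd, rfl⟩ := List.mem_map.1 this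
    exact ⟨d, hd, rfl⟩
  have hsnd : ∀ w ∈ c.support, ∃ d ∈ c.darts, d.snd = w := by
    intro w hw
    obtain ⟨d, hd, rfl⟩ := hfst w hw
    by_cases h : d.fst = u
    · rw [h]
      have h1 : u ∈ c.support.tail := c.end_mem_tail_support hc.not_nil
      rw [← c.map_snd_darts] at h1
      obtain ⟨e, he, hh⟩ := List.mem_map.1 h1
      exact ⟨e, he, hh⟩
    · exact exists_mem_darts_snd_eq hw h
  -- No dart of `D` enters or leaves the vertex set of the cycle found, so by connectedness there is
  -- no dart elsewhere.
  have hs : ∀ d ∈ D, decide (d.fst ∈ c.support) = decide (d.snd ∈ c.support) := by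
    intro d hd
    rw [decide_eq_decide]
    constructor
    · intro h
      obtain ⟨e, he, hed⟩ := hfst _ h
      obtain rfl := hinj' e (hcD e he) d hd hed
      exact c.dart_snd_mem_support_of_mem_darts he
    · intro h
      obtain ⟨e, he, hed⟩ := hsnd _ h
      obtain rfl := hinj e (hcD e he) d hd hed
      exact c.dart_fst_mem_support_of_mem_darts he
  obtain ⟨e, he, heu⟩ := hfst u c.start_mem_support
  intro d hd
  have := hconn (fun w => decide (w ∈ c.support)) hs d hd e (hcD e he)
  simp only [heu, c.start_mem_support, decide_true, decide_eq_true_eq] at this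
  obtain ⟨e', he', hed⟩ := hfst _ this
  exact hinj' e' (hcD e' he') d hd hed ▸ he'

theorem symmDiff_eq_empty_or_ncard {A : Type*} {s t : Set A} (hs : s.ncard = 2)
    (ht : t.ncard = 2) (h : (s ∩ t).Nonempty) : symmDiff s t = ∅ ∨ (symmDiff s t).ncard = 2 := by
  obtain ⟨a, has, hat⟩ := h
  obtain ⟨b, hb, rfl⟩ : ∃ b, b ≠ a ∧ s = {a, b} := by
    obtain ⟨x, y, hxy, rfl⟩ := Set.ncard_eq_two.1 hs
    rcases has with rfl | rfl
    · exact ⟨y, hxy.symm, rfl⟩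
    · exact ⟨x, hxy, Set.pair_comm _ _⟩
  obtain ⟨c, hc, rfl⟩ : ∃ c, c ≠ a ∧ t = {a, c} := by
    obtain ⟨x, y, hxy, rfl⟩ := Set.ncard_eq_two.1 ht
    rcases hat with rfl | rfl
    · exact ⟨y, hxy.symm, rfl⟩
    · exact ⟨x, hxy, Set.pair_comm _ _⟩
  by_cases hbc : b = c
  · subst hbc; left; simp
  · right
    have : symmDiff ({a, b} : Set A) {a, c} = {b, c} := by
      ext x
      simp only [Set.mem_symmDiff, Set.mem_insert_iff, Set.mem_singleton_iff]
      by_cases h1 : x = a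
      · subst h1; simp [hb.symm, hc.symm]
      by_cases h2 : x = b
      · subst h2; simp [h1, hbc]
      simp [h1, h2]
    rw [this, Set.ncard_pair hbc]

/-- If each common vertex of two cycles lies on a common edge and their symmetric difference is
connected, then it is a cycle. -/
theorem isCycleEdgeSet_symmDiff [Finite V] {u v : V} {L : G.Walk u u} {C : G.Walk v v}
    (hL : L.IsCycle) (hC : C.IsCycle)
    (hmeet : ∀ w ∈ L.support, w ∈ C.support → ∃ z, s(w, z) ∈ L.edges ∧ s(w, z) ∈ C.edges)
    (hne : (symmDiff L.edgeSet C.edgeSet).Nonempty)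
    (hconn : ∀ s : V → Bool, (∀ a b, s(a, b) ∈ symmDiff L.edgeSet C.edgeSet → s a = s b) →
      ∀ a b a' b', s(a, b) ∈ symmDiff L.edgeSet C.edgeSet →
        s(a', b') ∈ symmDiff L.edgeSet C.edgeSet → s a = s a') :
    IsCycleEdgeSet G (symmDiff L.edgeSet C.edgeSet) := by
  classical
  set S := symmDiff L.edgeSet C.edgeSet with hS
  have hSG : ∀ {a b}, s(a, b) ∈ S → G.Adj a b := by
    intro a b h
    rcases h with h | h
    · exact L.adj_of_mem_edges h.1
    · exact C.adj_of_mem_edges h.1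
  set H := SimpleGraph.fromEdgeSet S
  have hH : ∀ {a b}, H.Adj a b ↔ s(a, b) ∈ S := by
    intro a b
    rw [SimpleGraph.fromEdgeSet_adj]
    exact ⟨And.left, fun h => ⟨h, (hSG h).ne⟩⟩
  have hHG : H ≤ G := fun a b h => hSG (hH.1 h)
  have hnb : ∀ w, H.neighborSet w =
      symmDiff (L.toSubgraph.neighborSet w) (C.toSubgraph.neighborSet w) := by
    intro w
    ext z
    rw [SimpleGraph.mem_neighborSet, hH, hS, Set.mem_symmDiff, Set.mem_symmDiff]
    simp only [SimpleGraph.Subgraph.mem_neighborSet, SimpleGraph.Walk.adj_toSubgraph_iff_mem_edges,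
      SimpleGraph.Walk.mem_edgeSet]
  have hemp : ∀ {x : V} {P : G.Walk x x} {w : V}, w ∉ P.support →
      P.toSubgraph.neighborSet w = ∅ := by
    intro x P w hw
    rw [Set.eq_empty_iff_forall_notMem]
    intro z hz
    exact hw ((SimpleGraph.Walk.mem_verts_toSubgraph P).1
      (SimpleGraph.Subgraph.Adj.fst_mem hz))
  -- At a common vertex the two pairs of edges share an edge, so none or two edges remain. A
  -- connected graph with all degrees two is a cycle.
  have hcyc : H.IsCycles := by
    intro w hw
    rw [hnb] at hw ⊢
    by_cases h1 : w ∈ L.support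
    · have hL2 := hL.ncard_neighborSet_toSubgraph_eq_two h1
      by_cases h2 : w ∈ C.support
      · obtain ⟨z, hz1, hz2⟩ := hmeet w h1 h2
        refine (symmDiff_eq_empty_or_ncard hL2 (hC.ncard_neighborSet_toSubgraph_eq_two h2)
          ⟨z, ?_, ?_⟩).resolve_left hw.ne_empty
        · exact (SimpleGraph.Walk.adj_toSubgraph_iff_mem_edges).2 hz1
        · exact (SimpleGraph.Walk.adj_toSubgraph_iff_mem_edges).2 hz2
      · rw [hemp h2]
        rwa [← Set.bot_eq_empty, symmDiff_bot]
    · rw [hemp h1] at hw ⊢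
      by_cases h2 : w ∈ C.support
      · rw [← Set.bot_eq_empty, bot_symmDiff]
        exact hC.ncard_neighborSet_toSubgraph_eq_two h2
      · rw [hemp h2] at hw
        simp at hw
  obtain ⟨e, he⟩ := hne
  induction e with
  | _ a b =>
  obtain ⟨p, hp, hpv⟩ := hcyc.exists_cycle_toSubgraph_verts_eq_connectedComponentSupp
    (c := H.connectedComponentMk a) (v := a) rfl ⟨b, hH.2 he⟩
  refine ⟨a, p.mapLe hHG, hp.mapLe hHG, ?_⟩
  ext e
  rw [SimpleGraph.Walk.mem_edgeSet, SimpleGraph.Walk.edges_mapLe_eq_edges]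
  constructor
  · intro h
    have := p.edges_subset_edgeSet h
    induction e with
    | _ x y => exact hH.1 this
  · intro h
    induction e with
    | _ x y =>
    have hx : x ∈ p.toSubgraph.verts := by
      rw [hpv, SimpleGraph.ConnectedComponent.mem_supp_iff, SimpleGraph.ConnectedComponent.eq]
      have := hconn (fun z => decide (H.Reachable z a)) (fun c d hcd => by
        have hcd := (hH.2 hcd).reachable
        simp only [decide_eq_decide]
        exact ⟨hcd.symm.trans, hcd.trans⟩) x y a b h he
      simpa using this
    have h2 := hp.ncard_neighborSet_toSubgraph_eq_two
      ((SimpleGraph.Walk.mem_verts_toSubgraph p).1 hx)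
    have h3 := hcyc (v := x) ⟨y, hH.2 h⟩
    have heq := Set.eq_of_subset_of_ncard_le (p.toSubgraph.neighborSet_subset x) (by omega)
      (Set.toFinite _)
    have : y ∈ p.toSubgraph.neighborSet x := by
      rw [heq]; exact hH.2 h
    exact (SimpleGraph.Walk.adj_toSubgraph_iff_mem_edges).1 this

end

/-! ### Arcs along the cycle and paths through bridges -/

section

variable {V : Type*} {G : SimpleGraph V} {u : V} {L : G.Walk u u}

/-- The dart `d` lies on the cycle `L`, in the direction of traversal if `b` is `false` and against
it if `b` is `true`. -/
def Along (L : G.Walk u u) (b : Bool) (d : G.Dart) : Prop :=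
  (cond b d.symm d) ∈ L.darts

theorem along_not_symm {b : Bool} {d : G.Dart} : Along L (!b) d.symm ↔ Along L b d := by
  cases b <;> simp [Along]

theorem Along.mem_edgeSet {b : Bool} {d : G.Dart} (h : Along L b d) : d.edge ∈ L.edgeSet := by
  cases b
  · exact List.mem_map_of_mem h
  · have : d.symm.edge ∈ L.edgeSet := List.mem_map_of_mem h
    simpa using this

theorem exists_along_fst (hL : L.IsCycle) {x : V} (hx : x ∈ cyclicWord L) (b : Bool) :
    ∃ d, Along L b d ∧ d.fst = x := by
  cases b
  · rw [cyclicWord_eq_map] at hx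
    obtain ⟨d, hd, rfl⟩ := List.mem_map.1 hx
    exact ⟨d, hd, rfl⟩
  · have h : ∃ d ∈ L.darts, d.snd = x := by
      by_cases hxu : x = u
      · subst hxu
        have h1 := L.end_mem_tail_support hL.not_nil
        rw [← L.map_snd_darts] at h1
        obtain ⟨e, he, hh⟩ := List.mem_map.1 h1
        exact ⟨e, he, hh⟩
      · exact exists_mem_darts_snd_eq ((mem_cyclicWord hL.not_nil).1 hx) hxu
    obtain ⟨d, hd, rfl⟩ := h
    exact ⟨d.symm, by simpa [Along] using hd, rfl⟩

theorem exists_along_snd (hL : L.IsCycle) {x : V} (hx : x ∈ cyclicWord L) (b : Bool) :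
    ∃ d, Along L b d ∧ d.snd = x := by
  obtain ⟨d, hd, rfl⟩ := exists_along_fst hL hx (!b)
  exact ⟨d.symm, by simpa using along_not_symm.2 hd, rfl⟩

theorem Along.fst_mem (hL : L.IsCycle) {b : Bool} {d : G.Dart} (h : Along L b d) :
    d.fst ∈ cyclicWord L := by
  rw [mem_cyclicWord hL.not_nil]
  cases b
  · exact L.dart_fst_mem_support_of_mem_darts h
  · exact L.dart_snd_mem_support_of_mem_darts h

theorem Along.snd_mem (hL : L.IsCycle) {b : Bool} {d : G.Dart} (h : Along L b d) :
    d.snd ∈ cyclicWord L :=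
  Along.fst_mem hL (along_not_symm.2 h)

theorem Along.eq_of_fst_eq (hL : L.IsCycle) {b : Bool} {d d' : G.Dart} (h : Along L b d)
    (h' : Along L b d') (e : d.fst = d'.fst) : d = d' := by
  cases b
  · have := cyclicWord_nodup hL
    rw [cyclicWord_eq_map] at this
    exact List.inj_on_of_nodup_map this h h' e
  · have := hL.support_nodup
    rw [← L.map_snd_darts] at this
    exact SimpleGraph.Dart.symm_involutive.injective (List.inj_on_of_nodup_map this h h' e)

theorem Along.eq_of_snd_eq (hL : L.IsCycle) {b : Bool} {d d' : G.Dart} (h : Along L b d)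
    (h' : Along L b d') (e : d.snd = d'.snd) : d = d' :=
  SimpleGraph.Dart.symm_involutive.injective
    (Along.eq_of_fst_eq hL (along_not_symm.2 h) (along_not_symm.2 h') e)

theorem Along.unique (hL : L.IsCycle) {b c : Bool} {d : G.Dart} (h : Along L b d)
    (h' : Along L c d) : b = c := by
  have key : ∀ d : G.Dart, d ∈ L.darts → d.symm ∉ L.darts := by
    intro d h1 h2
    have := List.inj_on_of_nodup_map hL.edges_nodup h1 h2 (by simp)
    exact d.symm_ne this.symm
  cases b <;> cases c
  · rfl
  · exact absurd h' (key d h)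
  · exact absurd h (key d h')
  · rfl

theorem Along.cyclicNext (hL : L.IsCycle) {d : G.Dart} (h : Along L false d) :
    CyclicNext (cyclicWord L) d.fst d.snd :=
  (cyclicNext_cyclicWord hL.not_nil).2 ⟨d, h, rfl, rfl⟩

theorem exists_along_of_cyclicNext (hL : L.IsCycle) {x y : V}
    (h : CyclicNext (cyclicWord L) x y) : ∃ d, Along L false d ∧ d.fst = x ∧ d.snd = y := by
  obtain ⟨d, hd, h⟩ := (cyclicNext_cyclicWord hL.not_nil).1 h
  exact ⟨d, hd, h⟩

theorem nontrivial_verts_toSubgraph (hL : L.IsCycle) : L.toSubgraph.verts.Nontrivial := by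
  refine ⟨u, L.start_mem_verts_toSubgraph, L.snd, ?_, (L.adj_snd hL.not_nil).ne⟩
  rw [SimpleGraph.Walk.mem_verts_toSubgraph]
  exact L.getVert_mem_support 1

open Classical in
/-- The darts of some path from `x` to `y` in the subgraph `B`. -/
noncomputable def pathDarts (B : G.Subgraph) (x y : V) : Set G.Dart :=
  if h : ∃ p : G.Walk x y, p.IsPath ∧ ∀ d ∈ p.darts, B.Adj d.fst d.snd then
    {d | d ∈ h.choose.darts} else ∅

theorem exists_pathDarts_eq {B : G.Subgraph} (hB : B.coe.Connected) {x y : V} (hx : x ∈ B.verts)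
    (hy : y ∈ B.verts) : ∃ p : G.Walk x y, p.IsPath ∧ (∀ d ∈ p.darts, B.Adj d.fst d.snd) ∧
      pathDarts B x y = {d | d ∈ p.darts} := by
  have h := exists_isPath_of_connected hB hx hy
  refine ⟨h.choose, h.choose_spec.1, h.choose_spec.2, ?_⟩
  rw [pathDarts, dif_pos h]

theorem notMem_edgeSet_of_bridge_adj {T : Bridge L.toSubgraph} {d : G.Dart}
    (h : T.1.Adj d.fst d.snd) : d.edge ∉ L.edgeSet := fun he =>
  T.2.not_adj h (SimpleGraph.Walk.adj_toSubgraph_iff_mem_edges.2 he)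

theorem not_along_of_bridge_adj {T : Bridge L.toSubgraph} {d : G.Dart}
    (h : T.1.Adj d.fst d.snd) (b : Bool) : ¬ Along L b d :=
  fun h' => notMem_edgeSet_of_bridge_adj h h'.mem_edgeSet

/-- The bridges of the cycle `L` are vertex-disjoint trees. -/
structure HasTreeBridges (L : G.Walk u u) : Prop where
  isCycle : L.IsCycle
  disj : ∀ T₁ T₂ : Bridge L.toSubgraph, T₁ ≠ T₂ → Disjoint T₁.1.verts T₂.1.verts
  isTree : ∀ T : Bridge L.toSubgraph, T.1.coe.IsTree

namespace HasTreeBridges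

theorem letter_eq_some (hb : HasTreeBridges L) {x : V} {T : Bridge L.toSubgraph} :
    letter L x = some T ↔ x ∈ attachments L.toSubgraph T.1 :=
  _root_.letter_eq_some hb.disj

theorem mem_of_letter (hb : HasTreeBridges L) {x : V} {T : Bridge L.toSubgraph}
    (h : letter L x = some T) : x ∈ cyclicWord L :=
  mem_cyclicWord_of_letter hb.isCycle hb.disj h

theorem mem_verts_iff (hb : HasTreeBridges L) {x : V} :
    x ∈ L.toSubgraph.verts ↔ x ∈ cyclicWord L := by
  rw [mem_cyclicWord hb.isCycle.not_nil, SimpleGraph.Walk.mem_verts_toSubgraph]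

/-- The path between two attachments in a bridge, and how it meets the cycle. -/
theorem exists_path (hb : HasTreeBridges L) {x y : V} {T : Bridge L.toSubgraph}
    (hx : letter L x = some T) (hy : letter L y = some T) :
    ∃ p : G.Walk x y, p.IsPath ∧ pathDarts T.1 x y = {d | d ∈ p.darts} ∧
      (∀ d ∈ p.darts, T.1.Adj d.fst d.snd) ∧
      (∀ d ∈ p.darts, d.fst ∈ cyclicWord L → d.fst = x) ∧
      (∀ d ∈ p.darts, d.snd ∈ cyclicWord L → d.snd = y) := by
  obtain ⟨p, hp, hadj, hD⟩ := exists_pathDarts_eq (hb.isTree T).connected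
    (hb.letter_eq_some.1 hx).2 (hb.letter_eq_some.1 hy).2
  -- A vertex of `L` has only one edge in `T`, so a path passing through it would have to return by
  -- the same edge.
  have hback : ∀ d ∈ p.darts, ∀ d' ∈ p.darts, d.snd = d'.fst → d.snd ∉ cyclicWord L := by
    intro d hd d' hd' h hmem
    have h1 := T.2.eq_of_adj (hb.isTree T).isAcyclic (hb.mem_verts_iff.2 hmem) (hadj d hd).symm
      (h ▸ hadj d' hd')
    have h2 : d' = d.symm := SimpleGraph.Dart.ext _ _ (Prod.ext h.symm h1.symm)
    have := List.inj_on_of_nodup_map hp.isTrail.edges_nodup hd hd' (by simp [h2])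
    exact d.symm_ne (h2.symm.trans this.symm)
  refine ⟨p, hp, hD, hadj, ?_, ?_⟩
  · intro d hd hmem
    by_contra hne
    obtain ⟨d', hd', h⟩ := exists_mem_darts_snd_eq (p.dart_fst_mem_support_of_mem_darts hd) hne
    exact hback d' hd' d hd h (h ▸ hmem)
  · intro d hd hmem
    by_contra hne
    obtain ⟨d', hd', h⟩ := exists_mem_darts_fst_eq (p.dart_snd_mem_support_of_mem_darts hd) hne
    exact hback d hd d' hd' h.symm hmem

end HasTreeBridges

end

/-! ### From labels to dicycles -/

section

variable {V : Type*} {G : SimpleGraph V} {u : V} {L : G.Walk u u} {K : Type*}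
  {fa fd : V → Bool → K}

/-- A good labelling of the cyclic word of the attachments on the cycle `L`. -/
abbrev CycleLabelling (L : G.Walk u u) (fa fd : V → Bool → K) : Prop :=
  GoodLabelling (letter L) {x | x ∈ cyclicWord L} (CyclicNext (cyclicWord L)) fa fd

/-- The chord with label `k` from `x` to `y` in the bridge `T`. -/
structure IsChord (L : G.Walk u u) (fa fd : V → Bool → K) (k : K) (T : Bridge L.toSubgraph)
    (x y : V) (b c : Bool) : Prop where
  fst : letter L x = some T
  snd : letter L y = some T
  arrive : fa x b = k
  depart : fd y c = k

/-- The darts of the dicycle with label `k`. -/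
def labelDarts (L : G.Walk u u) (fa fd : V → Bool → K) (k : K) : Set G.Dart :=
  {d | (∃ b, Along L b d ∧ fa d.snd b = k) ∨
    ∃ T x y b c, IsChord L fa fd k T x y b c ∧ d ∈ pathDarts T.1 x y}

namespace HasTreeBridges

/-- The label of a dart can be read at either end. The Boolean flips because it names the side of
the vertex on which the dart lies. -/
theorem depart_eq (hb : HasTreeBridges L) (h : CycleLabelling L fa fd) {b : Bool} {d : G.Dart}
    (hd : Along L b d) : fd d.fst (!b) = fa d.snd b := by
  cases b
  · exact h.fwd _ _ (hd.cyclicNext hb.isCycle)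
  · exact h.bwd _ _ (Along.cyclicNext hb.isCycle (d := d.symm) hd)

theorem arrive_injective (h : CycleLabelling L fa fd) {x : V} (hx : x ∈ cyclicWord L)
    {b c : Bool} (e : fa x b = fa x c) : b = c := by
  cases hl : letter L x with
  | some T => exact (h.inja x hx x hx T hl hl b c e).2
  | none =>
    by_contra hne
    obtain rfl : c = !b := by cases b <;> cases c <;> simp_all
    have h1 := h.pass x hx hl b
    exact h.ne x hx (!b) (e.symm.trans h1)

end HasTreeBridges

theorem IsChord.ne (hb : HasTreeBridges L) (h : CycleLabelling L fa fd) {k : K}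
    {T : Bridge L.toSubgraph} {x y : V} {b c : Bool} (hc : IsChord L fa fd k T x y b c) :
    x ≠ y := by
  rintro rfl
  exact h.sep x (hb.mem_of_letter hc.fst) T hc.fst b c (hc.arrive.trans hc.depart.symm)

/-- This uniqueness of the chord of a label in a bridge is what makes dart sets injective and gives
(C3). -/
theorem IsChord.eq (hb : HasTreeBridges L) (h : CycleLabelling L fa fd) {k : K}
    {T : Bridge L.toSubgraph} {x y x' y' : V} {b c b' c' : Bool}
    (hc : IsChord L fa fd k T x y b c) (hc' : IsChord L fa fd k T x' y' b' c') :
    x = x' ∧ y = y' :=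
  ⟨(h.inja x (hb.mem_of_letter hc.fst) x' (hb.mem_of_letter hc'.fst) T hc.fst hc'.fst b b'
    (hc.arrive.trans hc'.arrive.symm)).1,
   (h.injd y (hb.mem_of_letter hc.snd) y' (hb.mem_of_letter hc'.snd) T hc.snd hc'.snd c c'
    (hc.depart.trans hc'.depart.symm)).1⟩

namespace HasTreeBridges

theorem exists_chord_of_arrive (h : CycleLabelling L fa fd) (hb : HasTreeBridges L) {x : V}
    {T : Bridge L.toSubgraph} (hx : letter L x = some T) (b : Bool) :
    ∃ y c, IsChord L fa fd (fa x b) T x y b c := by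
  obtain ⟨y, _, hy, c, hc⟩ := h.exd x (hb.mem_of_letter hx) T hx b
  exact ⟨y, c, hx, hy, rfl, hc⟩

theorem exists_chord_of_depart (h : CycleLabelling L fa fd) (hb : HasTreeBridges L) {y : V}
    {T : Bridge L.toSubgraph} (hy : letter L y = some T) (c : Bool) :
    ∃ x b, IsChord L fa fd (fd y c) T x y b c := by
  obtain ⟨x, _, hx, b, hc⟩ := h.exa y (hb.mem_of_letter hy) T hy c
  exact ⟨x, b, hx, hy, hc, rfl⟩

theorem labelDarts_snd_injOn (hb : HasTreeBridges L) (h : CycleLabelling L fa fd) {k : K} :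
    ∀ d ∈ labelDarts L fa fd k, ∀ d' ∈ labelDarts L fa fd k, d.snd = d'.snd → d = d' := by
  -- A dart of a chord that ends on `L` ends at the departure `y`, where `sep` forbids the same
  -- label to arrive along `L`.
  have mixed : ∀ {d d' : G.Dart} {b : Bool}, Along L b d → fa d.snd b = k →
      (∃ T x y b c, IsChord L fa fd k T x y b c ∧ d' ∈ pathDarts T.1 x y) → d.snd ≠ d'.snd := by
    rintro d d' b hd hk ⟨T, x, y, b', c, hc, hd'⟩ e
    obtain ⟨p, hp, hD, hadj, h1, h2⟩ := hb.exists_path hc.fst hc.snd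
    rw [hD] at hd'
    have hdm := hd.snd_mem hb.isCycle
    have hy := h2 d' hd' (e ▸ hdm)
    rw [e, hy] at hk
    exact h.sep y (hb.mem_of_letter hc.snd) T hc.snd b c (hk.trans hc.depart.symm)
  rintro d (⟨b, hd, hk⟩ | hd) d' (⟨c, hd', hk'⟩ | hd') e
  · have hdm := hd.snd_mem hb.isCycle
    obtain rfl := arrive_injective h hdm (show fa d.snd b = fa d.snd c by rw [hk, e, hk'])
    exact hd.eq_of_snd_eq hb.isCycle hd' e
  · exact absurd e (mixed hd hk hd')
  · exact absurd e.symm (mixed hd' hk' hd)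
  · obtain ⟨T, x, y, b, c, hc, hd⟩ := hd
    obtain ⟨T', x', y', b', c', hc', hd'⟩ := hd'
    obtain ⟨p, hp, hD, hadj, -, -⟩ := hb.exists_path hc.fst hc.snd
    obtain ⟨p', hp', hD', hadj', -, -⟩ := hb.exists_path hc'.fst hc'.snd
    have hTT : T = T' := by
      by_contra hne
      rw [hD] at hd
      rw [hD'] at hd'
      exact Set.disjoint_left.1 (hb.disj T T' hne) (hadj d hd).snd_mem
        (e ▸ (hadj' d' hd').snd_mem)
    subst hTT
    obtain ⟨rfl, rfl⟩ := hc.eq hb h hc'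
    rw [hD] at hd hd'
    exact hp.eq_of_snd_eq hd hd' e

theorem labelDarts_exists_next (hb : HasTreeBridges L) (h : CycleLabelling L fa fd) {k : K} :
    ∀ d ∈ labelDarts L fa fd k, ∃ d' ∈ labelDarts L fa fd k, d'.fst = d.snd := by
  rintro d (⟨b, hd, hk⟩ | ⟨T, x, y, b, c, hc, hd⟩)
  · have hdm := hd.snd_mem hb.isCycle
    cases hl : letter L d.snd with
    | none =>
      obtain ⟨d', hd', e⟩ := exists_along_fst hb.isCycle hdm b
      refine ⟨d', Or.inl ⟨b, hd', ?_⟩, e⟩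
      rw [← hb.depart_eq h hd', e, ← h.pass _ hdm hl b, hk]
    | some T =>
      obtain ⟨y, c, hc⟩ := exists_chord_of_arrive h hb hl b
      rw [hk] at hc
      obtain ⟨p, hp, hD, -⟩ := hb.exists_path hc.fst hc.snd
      obtain ⟨d', hd', e⟩ := exists_mem_darts_fst_eq p.start_mem_support (hc.ne hb h)
      exact ⟨d', Or.inr ⟨T, _, y, b, c, hc, hD ▸ hd'⟩, e⟩
  · obtain ⟨p, hp, hD, -⟩ := hb.exists_path hc.fst hc.snd
    by_cases hy : d.snd = y
    · obtain ⟨d', hd', e⟩ := exists_along_fst hb.isCycle (hb.mem_of_letter hc.snd) (!c)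
      refine ⟨d', Or.inl ⟨!c, hd', ?_⟩, e.trans hy.symm⟩
      rw [← hb.depart_eq h hd', e, Bool.not_not, hc.depart]
    · have hd₀ : d ∈ p.darts := by rw [hD] at hd; exact hd
      obtain ⟨d', hd', e⟩ := exists_mem_darts_fst_eq (p.dart_snd_mem_support_of_mem_darts hd₀) hy
      exact ⟨d', Or.inr ⟨T, x, y, b, c, hc, hD ▸ hd'⟩, e⟩

theorem symm_notMem_labelDarts (hb : HasTreeBridges L) (h : CycleLabelling L fa fd) {k : K} :
    ∀ d ∈ labelDarts L fa fd k, d.symm ∉ labelDarts L fa fd k := by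
  have mixed : ∀ {d : G.Dart} {b : Bool}, Along L b d →
      ¬ ∃ T x y b c, IsChord L fa fd k T x y b c ∧ d.symm ∈ pathDarts T.1 x y := by
    rintro d b hd ⟨T, x, y, b', c, hc, hd'⟩
    obtain ⟨p, hp, hD, hadj, -, -⟩ := hb.exists_path hc.fst hc.snd
    rw [hD] at hd'
    exact not_along_of_bridge_adj (hadj _ hd') (!b) (along_not_symm.2 hd)
  rintro d (⟨b, hd, hk⟩ | hd) (⟨c, hd', hk'⟩ | hd')
  · obtain rfl := (along_not_symm.2 hd).unique hb.isCycle hd'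
    refine h.ne d.fst (hd.fst_mem hb.isCycle) (!b) ?_
    rw [hb.depart_eq h hd, hk]
    exact hk'
  · exact mixed hd hd'
  · exact mixed hd' (by simpa using hd)
  · obtain ⟨T, x, y, b, c, hc, hd⟩ := hd
    obtain ⟨T', x', y', b', c', hc', hd'⟩ := hd'
    obtain ⟨p, hp, hD, hadj, -, -⟩ := hb.exists_path hc.fst hc.snd
    obtain ⟨p', hp', hD', hadj', -, -⟩ := hb.exists_path hc'.fst hc'.snd
    have hTT : T = T' := by
      by_contra hne
      rw [hD] at hd
      rw [hD'] at hd'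
      exact Set.disjoint_left.1 (hb.disj T T' hne) (hadj d hd).snd_mem (hadj' _ hd').fst_mem
    subst hTT
    obtain ⟨rfl, rfl⟩ := hc.eq hb h hc'
    rw [hD] at hd hd'
    exact d.symm_ne (List.inj_on_of_nodup_map hp.isTrail.edges_nodup hd' hd (by simp))

/-- A colouring that is constant along the darts of a chord is constant on the chord. -/
theorem eq_of_pathDarts (hb : HasTreeBridges L) {x y : V} {T : Bridge L.toSubgraph}
    (hx : letter L x = some T) (hy : letter L y = some T) {s : V → Bool}
    (hs : ∀ d ∈ pathDarts T.1 x y, s d.fst = s d.snd) :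
    s x = s y ∧ ∀ d ∈ pathDarts T.1 x y, s d.fst = s x := by
  obtain ⟨p, hp, hD, -⟩ := hb.exists_path hx hy
  rw [hD] at hs ⊢
  have := eq_of_arcPairs (w := p.support) (s := s) fun a b hab => by
    obtain ⟨d, hd, rfl, rfl⟩ := (mem_arcPairs_support p).1 hab
    exact hs d hd
  exact ⟨this x p.start_mem_support y p.end_mem_support, fun d hd =>
    this _ (p.dart_fst_mem_support_of_mem_darts hd) x p.start_mem_support⟩

theorem mem_labelDarts_of_along (hb : HasTreeBridges L) {k : K} {b : Bool} {d : G.Dart}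
    (hd : Along L b d) : d ∈ labelDarts L fa fd k ↔ fa d.snd b = k := by
  refine ⟨?_, fun h => Or.inl ⟨b, hd, h⟩⟩
  rintro (⟨c, hd', hk⟩ | ⟨T, x, y, b', c, hc, hd'⟩)
  · obtain rfl := hd.unique hb.isCycle hd'
    exact hk
  · obtain ⟨p, hp, hD, hadj, -, -⟩ := hb.exists_path hc.fst hc.snd
    rw [hD] at hd'
    exact absurd hd (not_along_of_bridge_adj (hadj _ hd') b)

theorem onLabel_of_along {k : K} {b : Bool} {d : G.Dart} (hd : Along L b d)
    (hb : HasTreeBridges L) (hk : fa d.snd b = k) : ∃ x y, CyclicNext (cyclicWord L) x y ∧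
      OnLabel fa k x y ∧ ((d.fst = x ∧ d.snd = y) ∨ (d.fst = y ∧ d.snd = x)) := by
  cases b
  · exact ⟨_, _, hd.cyclicNext hb.isCycle, Or.inl hk, Or.inl ⟨rfl, rfl⟩⟩
  · exact ⟨_, _, Along.cyclicNext hb.isCycle (d := d.symm) hd, Or.inr hk, Or.inr ⟨rfl, rfl⟩⟩

theorem exists_labelDarts_of_onLabel (hb : HasTreeBridges L) {k : K} {x y : V}
    (hN : CyclicNext (cyclicWord L) x y) (hk : OnLabel fa k x y) :
    ∃ d ∈ labelDarts L fa fd k, (d.fst = x ∧ d.snd = y) ∨ (d.fst = y ∧ d.snd = x) := by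
  obtain ⟨d, hd, rfl, rfl⟩ := exists_along_of_cyclicNext hb.isCycle hN
  rcases hk with hk | hk
  · exact ⟨d, Or.inl ⟨false, hd, hk⟩, Or.inl ⟨rfl, rfl⟩⟩
  · exact ⟨d.symm, Or.inl ⟨true, along_not_symm.2 hd, hk⟩, Or.inr ⟨rfl, rfl⟩⟩

theorem labelDarts_connected (hb : HasTreeBridges L) (h : CycleLabelling L fa fd) {k : K}
    (s : V → Bool) (hs : ∀ d ∈ labelDarts L fa fd k, s d.fst = s d.snd) :
    ∀ d ∈ labelDarts L fa fd k, ∀ d' ∈ labelDarts L fa fd k, s d.fst = s d'.fst := by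
  have harc : ∀ x y, CyclicNext (cyclicWord L) x y → OnLabel fa k x y → s x = s y := by
    intro x y hN hk
    obtain ⟨d, hd, ⟨rfl, rfl⟩ | ⟨rfl, rfl⟩⟩ := hb.exists_labelDarts_of_onLabel hN hk
    · exact hs d hd
    · exact (hs d hd).symm
  have hch : ∀ {T x y b c}, IsChord L fa fd k T x y b c →
      s x = s y ∧ ∀ d ∈ pathDarts T.1 x y, s d.fst = s x := fun hc =>
    hb.eq_of_pathDarts hc.fst hc.snd fun d hd => hs d (Or.inr ⟨_, _, _, _, _, hc, hd⟩)
  have hlink := h.conn k s harc fun x _ y _ T b c hx hy hk hk' =>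
    (hch (T := T) (x := x) (y := y) ⟨hx, hy, hk, hk'⟩).1
  have key : ∀ d ∈ labelDarts L fa fd k, ∃ x y, CyclicNext (cyclicWord L) x y ∧
      OnLabel fa k x y ∧ s d.fst = s x := by
    have along : ∀ {d b}, Along L b d → fa d.snd b = k → ∃ x y, CyclicNext (cyclicWord L) x y ∧
      OnLabel fa k x y ∧ s d.fst = s x ∧ s d.snd = s x := by
      intro d b hd hk
      obtain ⟨x, y, hN, hO, ⟨h1, h2⟩ | ⟨h1, h2⟩⟩ := onLabel_of_along hd hb hk
      · exact ⟨x, y, hN, hO, by rw [h1], by rw [h2, harc x y hN hO]⟩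
      · exact ⟨x, y, hN, hO, by rw [h1, harc x y hN hO], by rw [h2]⟩
    rintro d (⟨b, hd, hk⟩ | ⟨T, x, y, b, c, hc, hd⟩)
    · obtain ⟨x, y, hN, hO, h1, _⟩ := along hd hk
      exact ⟨x, y, hN, hO, h1⟩
    -- The colour of a chord is seen on the arc by which the dicycle arrives at its first end, so it
    -- suffices to link arcs.
    · obtain ⟨d', hd', e⟩ := exists_along_snd hb.isCycle (hb.mem_of_letter hc.fst) b
      obtain ⟨x', y', hN, hO, _, h2⟩ := along hd' (by rw [e, hc.arrive])
      exact ⟨x', y', hN, hO, by rw [(hch hc).2 d hd, ← e, h2]⟩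
  intro d hd d' hd'
  obtain ⟨x, y, hN, hO, e⟩ := key d hd
  obtain ⟨x', y', hN', hO', e'⟩ := key d' hd'
  rw [e, e', hlink x y x' y' hN hO hN' hO']

theorem exists_chord_of_mem_labelDarts (hb : HasTreeBridges L) (h : CycleLabelling L fa fd) {k : K}
    {d : G.Dart} (hd : d ∈ labelDarts L fa fd k) {T : Bridge L.toSubgraph}
    (hT : letter L d.fst = some T) :
    ∃ x y b c, IsChord L fa fd k T x y b c ∧ (d.fst = x ∨ d.fst = y) := by
  rcases hd with ⟨b, hd, hk⟩ | ⟨T', x, y, b, c, hc, hd⟩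
  · obtain ⟨x, c, hc⟩ := exists_chord_of_depart h hb hT (!b)
    rw [hb.depart_eq h hd, hk] at hc
    exact ⟨x, _, c, !b, hc, Or.inr rfl⟩
  · obtain ⟨p, hp, hD, -, h1, -⟩ := hb.exists_path hc.fst hc.snd
    have hx := h1 d (by rw [hD] at hd; exact hd) (hb.mem_of_letter hT)
    obtain rfl : T' = T := Option.some.inj (hc.fst.symm.trans (hx ▸ hT))
    exact ⟨x, y, b, c, hc, Or.inl hx⟩

/-- At an attachment, at least one of the two arcs of the cycle is not traversed by a given
dicycle. -/
theorem exists_not_onLabel (hb : HasTreeBridges L) (h : CycleLabelling L fa fd) (k : K) {x : V}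
    {T : Bridge L.toSubgraph} (hx : letter L x = some T) :
    ∃ y z, CyclicNext (cyclicWord L) y z ∧ ¬ OnLabel fa k y z ∧ (y = x ∨ z = x) := by
  have hxw := hb.mem_of_letter hx
  obtain ⟨d, hd, rfl⟩ := exists_along_snd hb.isCycle hxw false
  obtain ⟨e, he, hed⟩ := exists_along_fst hb.isCycle hxw false
  by_cases h1 : OnLabel fa k d.fst d.snd
  · refine ⟨e.fst, e.snd, he.cyclicNext hb.isCycle, fun h2 => ?_, Or.inl hed⟩
    have e1 := hb.depart_eq h (along_not_symm.2 hd)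
    have e2 := hb.depart_eq h he
    have i1 := h.inja _ hxw _ hxw T hx hx
    have i2 := h.injd _ hxw _ hxw T hx hx
    have i3 := h.sep _ hxw T hx
    simp only [Bool.not_false, Bool.not_true, SimpleGraph.Dart.symm_toProd, Prod.fst_swap,
      Prod.snd_swap] at e1 e2
    rw [OnLabel] at h1 h2
    rw [hed] at e2 h2
    rcases h1 with h1 | h1 <;> rcases h2 with h2 | h2
    · exact i3 _ _ (h1.trans (e2.trans h2).symm)
    · exact absurd (i1 _ _ (h1.trans h2.symm)).2 (by simp)
    · exact absurd (i2 _ _ ((e1.trans h1).trans (e2.trans h2).symm)).2 (by simp)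
    · exact i3 _ _ (h2.trans (e1.trans h1).symm)
  · exact ⟨_, _, hd.cyclicNext hb.isCycle, h1, Or.inr rfl⟩

theorem labelDarts_isCycle [Finite V] (hb : HasTreeBridges L) (h : CycleLabelling L fa fd) {x : V}
    (hx : x ∈ cyclicWord L) (b : Bool) : ∃ (v : V) (c : G.Walk v v), c.IsCycle ∧
      labelDarts L fa fd (fa x b) = {d | d ∈ c.darts} := by
  obtain ⟨d, hd, e⟩ := exists_along_snd hb.isCycle hx b
  exact exists_isCycle_darts_eq ⟨d, Or.inl ⟨b, hd, by rw [e]⟩⟩ (hb.labelDarts_exists_next h)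
    (hb.labelDarts_snd_injOn h) (hb.symm_notMem_labelDarts h) (hb.labelDarts_connected h)

/-- The dicycle of a labelling that arrives at `x` in the direction `b`. -/
def dicycle [Finite V] (hb : HasTreeBridges L) (h : CycleLabelling L fa fd) {x : V}
    (hx : x ∈ cyclicWord L) (b : Bool) : Dicycle G where
  arcs := labelDarts L fa fd (fa x b)
  isDicycle := hb.labelDarts_isCycle h hx b

end HasTreeBridges

end

/-! ### Verification of (C1) to (C4) -/

section

variable {V : Type*} [Finite V] {G : SimpleGraph V} {u : V} {L : G.Walk u u} {K : Type*}
  {fa fd : V → Bool → K}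

namespace HasTreeBridges

/-- A label can be recovered from any dart of its dicycle along `L`, so dicycles may be counted by
their labels. -/
theorem dicycle_eq_iff (hb : HasTreeBridges L) (h : CycleLabelling L fa fd) {x y : V}
    (hx : x ∈ cyclicWord L) (hy : y ∈ cyclicWord L) {b c : Bool} :
    hb.dicycle h hx b = hb.dicycle h hy c ↔ fa x b = fa y c := by
  refine ⟨fun e => ?_, fun e => Dicycle.ext (congrArg (labelDarts L fa fd) e)⟩
  obtain ⟨d, hd, rfl⟩ := exists_along_snd hb.isCycle hx b
  have h1 : d ∈ (hb.dicycle h hx b).arcs := Or.inl ⟨b, hd, rfl⟩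
  rw [e] at h1
  exact (hb.mem_labelDarts_of_along hd).1 h1

/-- The dicycles of a labelling. -/
def dicycles (hb : HasTreeBridges L) (h : CycleLabelling L fa fd) : Set (Dicycle G) :=
  {C | ∃ (x : V) (hx : x ∈ cyclicWord L) (b : Bool), C = hb.dicycle h hx b}

theorem encard_dicycles_of_mem_edgeSet (hb : HasTreeBridges L) (h : CycleLabelling L fa fd)
    {e : Sym2 V} (he : e ∈ L.edgeSet) : {C ∈ hb.dicycles h | e ∈ C.edgeSet}.encard = 2 := by
  obtain ⟨d, hd, rfl⟩ := List.mem_map.1 he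
  replace hd : Along L false d := hd
  have hd' : Along L true d.symm := along_not_symm.2 hd
  have h1 := hd.snd_mem hb.isCycle
  have h2 := hd.fst_mem hb.isCycle
  have hne : hb.dicycle h h1 false ≠ hb.dicycle h h2 true := by
    rw [ne_eq, dicycle_eq_iff]
    have := hb.depart_eq h hd'
    exact fun e => h.ne _ h1 false (e.trans this.symm)
  have : {C ∈ hb.dicycles h | d.edge ∈ C.edgeSet} =
      {hb.dicycle h h1 false, hb.dicycle h h2 true} := by
    ext C
    constructor
    · rintro ⟨⟨x, hx, b, rfl⟩, d', hdm, hde⟩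
      rcases (SimpleGraph.dart_edge_eq_iff d' d).1 hde with rfl | rfl
      · exact Or.inl ((hb.dicycle_eq_iff h _ _).2 ((hb.mem_labelDarts_of_along hd).1 hdm).symm)
      · exact Or.inr ((hb.dicycle_eq_iff h _ _).2 ((hb.mem_labelDarts_of_along hd').1 hdm).symm)
    · rintro (rfl | rfl)
      · exact ⟨⟨_, h1, false, rfl⟩, d, (hb.mem_labelDarts_of_along hd).2 rfl, rfl⟩
      · exact ⟨⟨_, h2, true, rfl⟩, d.symm, (hb.mem_labelDarts_of_along hd').2 rfl, by simp⟩
  rw [this, Set.encard_pair hne]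

/-- A chord whose ends are separated by an edge of its bridge passes through this edge. -/
theorem mem_edgeSet_of_separated (hb : HasTreeBridges L) (h : CycleLabelling L fa fd)
    {T : Bridge L.toSubgraph} {a b x y : V} {c c' : Bool} {s : V → Bool}
    (hs : ∀ p q, T.1.Adj p q → s(p, q) ≠ s(a, b) → s p = s q)
    (hc : IsChord L fa fd (fa x c) T x y c c') (hne : s x ≠ s y) :
    s(a, b) ∈ (hb.dicycle h (hb.mem_of_letter hc.fst) c).edgeSet := by
  by_contra hno
  refine hne (hb.eq_of_pathDarts hc.fst hc.snd fun d hd => ?_).1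
  obtain ⟨p, hp, hD, hadj, -⟩ := hb.exists_path hc.fst hc.snd
  refine hs _ _ (hadj d (by rw [hD] at hd; exact hd)) fun e => hno ?_
  exact ⟨d, Or.inr ⟨T, x, y, c, c', hc, hd⟩, e⟩

/-- Deleting the edge cuts the tree into two sides, both with attachments. `cutLabel` gives two
labels whose chords lead from one side to the other, and two for the opposite direction. They are
four different labels, since a label has only one chord in the bridge. -/
theorem four_le_encard_dicycles (hG : IsTwoConnected G) (hb : HasTreeBridges L)
    (h : CycleLabelling L fa fd) {e : Sym2 V} (he : e ∈ G.edgeSet \ L.edgeSet) :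
    4 ≤ {C ∈ hb.dicycles h | e ∈ C.edgeSet}.encard := by
  classical
  induction e with
  | _ a b =>
  have hH := nontrivial_verts_toSubgraph hb.isCycle
  obtain ⟨B, hB, hab⟩ := exists_isBridge_adj (H := L.toSubgraph) he.1 (fun hL =>
    he.2 (SimpleGraph.Walk.adj_toSubgraph_iff_mem_edges.1 hL))
  obtain ⟨T, rfl⟩ : ∃ T : Bridge L.toSubgraph, T.1 = B := ⟨⟨B, hB⟩, rfl⟩
  obtain ⟨x₀, hx₀, hr₀⟩ := T.2.exists_attachment hG hH hab
  obtain ⟨y₀, hy₀, hr₁⟩ := T.2.exists_attachment hG hH hab.symm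
  rw [Sym2.eq_swap] at hr₁
  set F := T.1.spanningCoe.deleteEdges {s(a, b)} with hF
  have hsep := not_reachable_deleteEdges (hb.isTree T).isAcyclic hab
  set s : V → Bool := fun x => decide (F.Reachable a x) with hs
  have hs₀ : s x₀ = true := by simp [hs, hr₀]
  have hs₁ : s y₀ = false := by
    simp only [hs, decide_eq_false_iff_not]
    exact fun h => hsep (h.trans hr₁.symm)
  have hsF : ∀ p q, T.1.Adj p q → s(p, q) ≠ s(a, b) → s p = s q := by
    intro p q hpq hne
    have : F.Adj p q := by
      rw [hF, SimpleGraph.deleteEdges_adj]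
      exact ⟨hpq, by simpa using hne⟩
    simp only [hs, decide_eq_decide]
    exact ⟨fun h => h.trans this.reachable, fun h => h.trans this.reachable.symm⟩
  have hlx := hb.letter_eq_some.2 hx₀
  have hly := hb.letter_eq_some.2 hy₀
  have key : ∀ s : V → Bool, s x₀ ≠ s y₀ → ∀ k : K, ∃ x y c c', fa x c ≠ k ∧
      IsChord L fa fd (fa x c) T x y c c' ∧ s x = true ∧ s y = false := by
    intro s hs k
    by_contra hno
    refine hs (h.cutLabel T k s ?_ x₀ (hb.mem_of_letter hlx) y₀ (hb.mem_of_letter hly) hlx hly)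
    intro x _ y _ hx hy c c' e hk hsx
    by_contra hsy
    exact hno ⟨x, y, c, c', hk, ⟨hx, hy, rfl, e.symm⟩, hsx, by simpa using hsy⟩
  have hne : s x₀ ≠ s y₀ := by rw [hs₀, hs₁]; simp
  have hne' : (fun x => !s x) x₀ ≠ (fun x => !s x) y₀ := by simp [hs₀, hs₁]
  -- The label `fa x₀ false` is an arbitrary one to exclude; the second chord in each direction
  -- excludes the label of the first.
  obtain ⟨x₁, y₁, c₁, c₁', -, hc₁, hx₁, hy₁⟩ := key s hne (fa x₀ false)
  obtain ⟨x₂, y₂, c₂, c₂', hk₂, hc₂, hx₂, hy₂⟩ := key s hne (fa x₁ c₁)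
  obtain ⟨x₃, y₃, c₃, c₃', -, hc₃, hx₃, hy₃⟩ := key (fun x => !s x) hne' (fa x₀ false)
  obtain ⟨x₄, y₄, c₄, c₄', hk₄, hc₄, hx₄, hy₄⟩ := key (fun x => !s x) hne' (fa x₃ c₃)
  simp only [Bool.not_eq_true', Bool.not_eq_false'] at hx₃ hy₃ hx₄ hy₄
  have hdiff : ∀ {x y x' y' c c' d d'}, IsChord L fa fd (fa x c) T x y c c' →
      IsChord L fa fd (fa x' d) T x' y' d d' → s x = true → s x' = false →
      fa x c ≠ fa x' d := by
    intro x y x' y' c c' d d' h1 h2 hs1 hs2 e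
    rw [← e] at h2
    rw [(h1.eq hb h h2).1, hs2] at hs1
    cases hs1
  have hsub : ({hb.dicycle h (hb.mem_of_letter hc₁.fst) c₁,
      hb.dicycle h (hb.mem_of_letter hc₂.fst) c₂, hb.dicycle h (hb.mem_of_letter hc₃.fst) c₃,
      hb.dicycle h (hb.mem_of_letter hc₄.fst) c₄} : Set (Dicycle G)) ⊆
      {C ∈ hb.dicycles h | s(a, b) ∈ C.edgeSet} := by
    have : ∀ {x y c c'} (hc : IsChord L fa fd (fa x c) T x y c c'), s x ≠ s y →
        hb.dicycle h (hb.mem_of_letter hc.fst) c ∈ {C ∈ hb.dicycles h | s(a, b) ∈ C.edgeSet} :=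
      fun hc hne => ⟨⟨_, _, _, rfl⟩, hb.mem_edgeSet_of_separated h hsF hc hne⟩
    rintro C (rfl | rfl | rfl | rfl)
    · exact this hc₁ (by rw [hx₁, hy₁]; simp)
    · exact this hc₂ (by rw [hx₂, hy₂]; simp)
    · exact this hc₃ (by rw [hx₃, hy₃]; simp)
    · exact this hc₄ (by rw [hx₄, hy₄]; simp)
  refine le_trans (le_of_eq ?_) (Set.encard_le_encard hsub)
  rw [Set.encard_insert_of_notMem, Set.encard_insert_of_notMem, Set.encard_pair]
  · norm_num
  · rw [ne_eq, dicycle_eq_iff]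
    exact hk₄.symm
  · rintro (e | e)
    · exact hdiff hc₂ hc₃ hx₂ hx₃ ((hb.dicycle_eq_iff h _ _).1 e)
    · exact hdiff hc₂ hc₄ hx₂ hx₄ ((hb.dicycle_eq_iff h _ _).1 e)
  · rintro (e | e | e)
    · exact hk₂ ((hb.dicycle_eq_iff h _ _).1 e).symm
    · exact hdiff hc₁ hc₃ hx₁ hx₃ ((hb.dicycle_eq_iff h _ _).1 e)
    · exact hdiff hc₁ hc₄ hx₁ hx₄ ((hb.dicycle_eq_iff h _ _).1 e)

theorem encard_verts_inter_attachments (hb : HasTreeBridges L) (h : CycleLabelling L fa fd)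
    {C : Dicycle G} (hC : C ∈ hb.dicycles h) (T : Bridge L.toSubgraph) :
    (C.verts ∩ attachments L.toSubgraph T.1).encard = 0 ∨
      (C.verts ∩ attachments L.toSubgraph T.1).encard = 2 := by
  obtain ⟨z, hz, b₀, rfl⟩ := hC
  by_cases hex : ∃ x y b c, IsChord L fa fd (fa z b₀) T x y b c
  · right
    obtain ⟨x, y, b, c, hc⟩ := hex
    have : (hb.dicycle h hz b₀).verts ∩ attachments L.toSubgraph T.1 = {x, y} := by
      ext v
      constructor
      · rintro ⟨⟨d, hd, rfl⟩, hv⟩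
        obtain ⟨x', y', b', c', hc', hxy⟩ :=
          hb.exists_chord_of_mem_labelDarts h hd (hb.letter_eq_some.2 hv)
        obtain ⟨rfl, rfl⟩ := hc.eq hb h hc'
        exact hxy
      · rintro (rfl | rfl)
        · refine ⟨?_, hb.letter_eq_some.1 hc.fst⟩
          obtain ⟨p, hp, hD, -⟩ := hb.exists_path hc.fst hc.snd
          obtain ⟨d, hd, e⟩ := exists_mem_darts_fst_eq p.start_mem_support (hc.ne hb h)
          exact ⟨d, Or.inr ⟨T, _, y, b, c, hc, hD ▸ hd⟩, e⟩
        · refine ⟨?_, hb.letter_eq_some.1 hc.snd⟩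
          obtain ⟨d, hd, e⟩ := exists_along_fst hb.isCycle (hb.mem_of_letter hc.snd) (!c)
          refine ⟨d, Or.inl ⟨!c, hd, ?_⟩, e⟩
          rw [← hb.depart_eq h hd, e, Bool.not_not, hc.depart]
    rw [this, Set.encard_pair (hc.ne hb h)]
  · left
    rw [Set.encard_eq_zero, Set.eq_empty_iff_forall_notMem]
    rintro v ⟨⟨d, hd, rfl⟩, hv⟩
    obtain ⟨x, y, b, c, hc, -⟩ := hb.exists_chord_of_mem_labelDarts h hd (hb.letter_eq_some.2 hv)
    exact hex ⟨x, y, b, c, hc⟩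

/-- The type fixes one dart along `L` at `x`, hence one label. Its dicycle uses the bridge at `x` on
the other side because a chord of that label starts or ends there. -/
theorem existsUnique_isOfType (hb : HasTreeBridges L) (h : CycleLabelling L fa fd) (i j : ZMod 2)
    {x : V} {T : Bridge L.toSubgraph} (hx : x ∈ attachments L.toSubgraph T.1) :
    ∃! C : Dicycle G, C ∈ hb.dicycles h ∧ C.IsOfType L x i j := by
  have hl := hb.letter_eq_some.2 hx
  have hxw := hb.mem_of_letter hl
  obtain ⟨b, hbi⟩ : ∃ b : Bool, ∀ f : G.Dart,
      (if i = 0 then f ∈ L.darts else f.symm ∈ L.darts) ↔ Along L b f := by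
    by_cases hi : i = 0
    · exact ⟨false, fun f => by rw [if_pos hi]; rfl⟩
    · exact ⟨true, fun f => by rw [if_neg hi]; rfl⟩
  obtain ⟨f, hf, rfl⟩ := exists_along_fst hb.isCycle hxw b
  have hf' := along_not_symm.2 hf
  have hfs := hf.snd_mem hb.isCycle
  by_cases hj : j = 0
  · refine ⟨hb.dicycle h hfs b, ⟨⟨_, hfs, b, rfl⟩, ?_⟩, ?_⟩
    · obtain ⟨y, c, hc⟩ := exists_chord_of_depart h hb hl (!b)
      obtain ⟨p, hp, hD, hadj, -⟩ := hb.exists_path hc.fst hc.snd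
      obtain ⟨d, hd, e⟩ := exists_mem_darts_snd_eq p.end_mem_support (hc.ne hb h).symm
      refine ⟨d.symm, f, e, ?_, rfl, (hbi f).2 hf, ?_⟩
      · rw [SimpleGraph.Dart.edge_symm]
        exact notMem_edgeSet_of_bridge_adj (hadj d hd)
      · rw [if_pos hj, SimpleGraph.Dart.symm_symm]
        refine ⟨?_, (hb.mem_labelDarts_of_along hf).2 rfl⟩
        rw [hb.depart_eq h hf] at hc
        exact Or.inr ⟨T, y, _, c, !b, hc, hD ▸ hd⟩
    · rintro _ ⟨⟨z, hz, c, rfl⟩, d, f', hd, hdL, hff, hf'', hm⟩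
      obtain rfl := ((hbi f').1 hf'').eq_of_fst_eq hb.isCycle hf hff
      rw [if_pos hj] at hm
      exact (hb.dicycle_eq_iff h _ _).2 ((hb.mem_labelDarts_of_along hf).1 hm.2).symm
  · refine ⟨hb.dicycle h hxw (!b), ⟨⟨_, hxw, !b, rfl⟩, ?_⟩, ?_⟩
    · obtain ⟨y, c, hc⟩ := exists_chord_of_arrive h hb hl (!b)
      obtain ⟨p, hp, hD, hadj, -⟩ := hb.exists_path hc.fst hc.snd
      obtain ⟨d, hd, e⟩ := exists_mem_darts_fst_eq p.start_mem_support (hc.ne hb h)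
      refine ⟨d, f, e, notMem_edgeSet_of_bridge_adj (hadj d hd), rfl, (hbi f).2 hf, ?_⟩
      rw [if_neg hj]
      exact ⟨Or.inr ⟨T, _, y, !b, c, hc, hD ▸ hd⟩, (hb.mem_labelDarts_of_along hf').2 rfl⟩
    · rintro _ ⟨⟨z, hz, c, rfl⟩, d, f', hd, hdL, hff, hf'', hm⟩
      obtain rfl := ((hbi f').1 hf'').eq_of_fst_eq hb.isCycle hf hff
      rw [if_neg hj] at hm
      exact (hb.dicycle_eq_iff h _ _).2 ((hb.mem_labelDarts_of_along hf').1 hm.2).symm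

theorem mk_mem_edgeSet_iff (hb : HasTreeBridges L) (h : CycleLabelling L fa fd) {z : V}
    (hz : z ∈ cyclicWord L) {b : Bool} {x y : V} (hN : CyclicNext (cyclicWord L) x y) :
    s(x, y) ∈ (hb.dicycle h hz b).edgeSet ↔ OnLabel fa (fa z b) x y := by
  obtain ⟨d, hd, rfl, rfl⟩ := exists_along_of_cyclicNext hb.isCycle hN
  have hd' := along_not_symm.2 hd
  constructor
  · rintro ⟨d', hdm, hde⟩
    rcases (SimpleGraph.dart_edge_eq_iff d' d).1 hde with rfl | rfl
    · exact Or.inl ((hb.mem_labelDarts_of_along hd).1 hdm)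
    · exact Or.inr ((hb.mem_labelDarts_of_along hd').1 hdm)
  · rintro (hk | hk)
    · exact ⟨d, (hb.mem_labelDarts_of_along hd).2 hk, rfl⟩
    · exact ⟨d.symm, (hb.mem_labelDarts_of_along hd').2 hk, by simp; rfl⟩

/-- A dicycle meets `L` only in vertices at which it uses an edge of `L`, so all degrees in the
symmetric difference are zero or two; `coconn` supplies the connectedness. -/
theorem isCycleEdgeSet_symmDiff_dicycle (hb : HasTreeBridges L) (h : CycleLabelling L fa fd)
    {x₀ : V} {T₀ : Bridge L.toSubgraph} (hx₀ : letter L x₀ = some T₀) {C : Dicycle G}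
    (hC : C ∈ hb.dicycles h) : IsCycleEdgeSet G (symmDiff L.edgeSet C.edgeSet) := by
  obtain ⟨z, hz, b₀, rfl⟩ := hC
  obtain ⟨v, c, hc, hD⟩ := hb.labelDarts_isCycle h hz b₀
  have hmem := fun {x y} => hb.mk_mem_edgeSet_iff h hz (b := b₀) (x := x) (y := y)
  have hE : (hb.dicycle h hz b₀).edgeSet = c.edgeSet := by
    ext e
    rw [SimpleGraph.Walk.mem_edgeSet, SimpleGraph.Walk.edges, List.mem_map]
    change (∃ d ∈ labelDarts L fa fd (fa z b₀), d.edge = e) ↔ _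
    rw [hD]
    rfl
  rw [hE] at hmem ⊢
  have hLmem : ∀ {x y}, CyclicNext (cyclicWord L) x y → s(x, y) ∈ L.edgeSet := by
    intro x y hN
    obtain ⟨d, hd, rfl, rfl⟩ := exists_along_of_cyclicNext hb.isCycle hN
    exact hd.mem_edgeSet
  have hoff : ∀ {x y}, CyclicNext (cyclicWord L) x y → ¬ OnLabel fa (fa z b₀) x y →
      s(x, y) ∈ symmDiff L.edgeSet c.edgeSet := fun hN hO =>
    Or.inl ⟨hLmem hN, fun hm => hO ((hmem hN).1 hm)⟩
  refine isCycleEdgeSet_symmDiff hb.isCycle hc ?_ ?_ ?_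
  · intro w hw hwc
    have hww := (mem_cyclicWord hb.isCycle.not_nil).2 hw
    have hwc := (mem_cyclicWord hc.not_nil).2 hwc
    rw [cyclicWord_eq_map] at hwc
    obtain ⟨d, hd, rfl⟩ := List.mem_map.1 hwc
    have hd' : d ∈ labelDarts L fa fd (fa z b₀) := by rw [hD]; exact hd
    have hcE : ∀ e ∈ labelDarts L fa fd (fa z b₀), e.edge ∈ c.edges := by
      intro e he
      rw [hD] at he
      exact List.mem_map_of_mem he
    rcases hd' with ⟨b, hda, hk⟩ | ⟨T, x, y, b, b', hch, hdp⟩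
    · exact ⟨d.snd, hda.mem_edgeSet, hcE d (Or.inl ⟨b, hda, hk⟩)⟩
    · obtain ⟨p, hp, hpD, -, h1, -⟩ := hb.exists_path hch.fst hch.snd
      have hx := h1 d (by rw [hpD] at hdp; exact hdp) hww
      -- The chord starts at `x`, so the dicycle has arrived there along an edge of `L`; this is the
      -- common edge.
      obtain ⟨e, he, hes⟩ := exists_along_snd hb.isCycle hww b
      have hk : fa e.snd b = fa z b₀ := by rw [hes, hx]; exact hch.arrive
      have hswap : s(d.fst, e.fst) = e.edge := by rw [← hes, Sym2.eq_swap]; rfl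
      refine ⟨e.fst, ?_, ?_⟩
      · rw [hswap]; exact he.mem_edgeSet
      · rw [hswap]; exact hcE e (Or.inl ⟨b, he, hk⟩)
  · obtain ⟨y, w, hN, hO, -⟩ := hb.exists_not_onLabel h (fa z b₀) hx₀
    exact ⟨_, hoff hN hO⟩
  · intro s hs
    have harc : ∀ x y, CyclicNext (cyclicWord L) x y → ¬ OnLabel fa (fa z b₀) x y → s x = s y :=
      fun x y hN hO => hs x y (hoff hN hO)
    have hch : ∀ {T x y b b'}, IsChord L fa fd (fa z b₀) T x y b b' →
        s x = s y ∧ ∀ d ∈ pathDarts T.1 x y, s d.fst = s x := by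
      intro T x y b b' hch
      refine hb.eq_of_pathDarts hch.fst hch.snd fun d hd => hs _ _ (Or.inr ⟨?_, ?_⟩)
      · have : d ∈ labelDarts L fa fd (fa z b₀) := Or.inr ⟨T, x, y, b, b', hch, hd⟩
        rw [hD] at this
        have : d.edge ∈ c.edges := List.mem_map_of_mem this
        exact this
      · obtain ⟨p, hp, hpD, hadj, -⟩ := hb.exists_path hch.fst hch.snd
        exact notMem_edgeSet_of_bridge_adj (hadj d (by rw [hpD] at hd; exact hd))
    have hlink := h.coconn z hz b₀ s harc fun x _ y _ T b c hx hy hk hk' =>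
      (hch (T := T) (x := x) (y := y) ⟨hx, hy, hk, hk'⟩).1
    have key : ∀ a b, s(a, b) ∈ symmDiff L.edgeSet c.edgeSet →
        ∃ x y, CyclicNext (cyclicWord L) x y ∧ ¬ OnLabel fa (fa z b₀) x y ∧ s a = s x := by
      rintro a b he
      have hab := hs a b he
      rcases he with ⟨h1, h2⟩ | ⟨h1, h2⟩
      · rcases cyclicNext_of_adj hb.isCycle.not_nil
          (SimpleGraph.Walk.adj_toSubgraph_iff_mem_edges.2 h1) with hN | hN
        · exact ⟨a, b, hN, fun hO => h2 ((hmem hN).2 hO), rfl⟩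
        · refine ⟨b, a, hN, fun hO => h2 ?_, hab⟩
          rw [Sym2.eq_swap]
          exact (hmem hN).2 hO
      · obtain ⟨d, hd, hde⟩ := List.mem_map.1 h1
        have hsd : s a = s d.fst := by
          rcases SimpleGraph.dart_edge_eq_mk'_iff'.1 hde with ⟨h3, h4⟩ | ⟨h3, h4⟩
          · rw [h3]
          · rw [h3, hab]
        have hd' : d ∈ labelDarts L fa fd (fa z b₀) := by rw [hD]; exact hd
        rcases hd' with ⟨b', hda, hk⟩ | ⟨T, x, y, b', c', hc', hdp⟩
        · exact absurd (hde ▸ hda.mem_edgeSet) h2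
        -- The chord's first end also lies on an arc of `L` that the dicycle leaves out, so the
        -- chord is attached to the rest of the symmetric difference.
        · obtain ⟨x', y', hN, hO, hx⟩ := hb.exists_not_onLabel h (fa z b₀) hc'.fst
          refine ⟨x', y', hN, hO, ?_⟩
          rw [hsd, (hch hc').2 d hdp]
          rcases hx with rfl | rfl
          · rfl
          · exact (harc _ _ hN hO).symm
    intro a b a' b' he he'
    obtain ⟨x, y, hN, hO, e⟩ := key a b he
    obtain ⟨x', y', hN', hO', e'⟩ := key a' b' he'
    rw [e, e', hlink x y x' y' hN hO hN' hO']

end HasTreeBridges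

end

theorem theorem5 {V : Type*} [Finite V] (G : SimpleGraph V) (hG : IsTwoConnected G)
    {u : V} (L : G.Walk u u) (hL : L.IsCycle)
    (hdisj : ∀ T₁ T₂ : Bridge L.toSubgraph, T₁ ≠ T₂ → Disjoint T₁.1.verts T₂.1.verts)
    (hoverlap : (overlapGraph L).IsTree)
    (htree : ∀ T : Bridge L.toSubgraph, T.1.coe.IsTree) :
    ∃ 𝒞 : Set (Dicycle G),
      -- (C1)
      ((∀ e ∈ L.edgeSet, {C ∈ 𝒞 | e ∈ C.edgeSet}.encard = 2) ∧
        (∀ e ∈ G.edgeSet \ L.edgeSet, 4 ≤ {C ∈ 𝒞 | e ∈ C.edgeSet}.encard)) ∧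
      -- (C2)
      (∀ C ∈ 𝒞, IsCycleEdgeSet G (symmDiff L.edgeSet C.edgeSet)) ∧
      -- (C3)
      (∀ C ∈ 𝒞, ∀ T : Bridge L.toSubgraph,
        (C.verts ∩ attachments L.toSubgraph T.1).encard = 0 ∨
          (C.verts ∩ attachments L.toSubgraph T.1).encard = 2) ∧
      -- (C4)
      (∀ (i j : ZMod 2) (x : V),
        (∃ T : Bridge L.toSubgraph, x ∈ attachments L.toSubgraph T.1) →
          ∃! C : Dicycle G, C ∈ 𝒞 ∧ C.IsOfType L x i j) := by
  have hb : HasTreeBridges L := ⟨hL, hdisj, htree⟩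
  have hH := nontrivial_verts_toSubgraph hL
  have hatt : ∀ T : Bridge L.toSubgraph, (attachments L.toSubgraph T.1).Nontrivial :=
    fun T => T.2.attachments_nontrivial hG hH (htree T).isAcyclic
  obtain ⟨T₀⟩ := hoverlap.connected.nonempty
  obtain ⟨x₀, hx₀⟩ := (hatt T₀).nonempty
  have hl₀ := hb.letter_eq_some.2 hx₀
  obtain ⟨K, fa, fd, h⟩ := (isTreeWord_letter hL hdisj hoverlap hatt).hasGoodLabelling _
    (cyclicWord L) rfl (cyclicWord_nodup hL)
    (List.ne_nil_of_mem (List.mem_filterMap.2 ⟨x₀, hb.mem_of_letter hl₀, hl₀⟩))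
  exact ⟨hb.dicycles h, ⟨fun e he => hb.encard_dicycles_of_mem_edgeSet h he,
    fun e he => hb.four_le_encard_dicycles hG h he⟩,
    fun C hC => hb.isCycleEdgeSet_symmDiff_dicycle h hl₀ hC,
    fun C hC T => hb.encard_verts_inter_attachments h hC T,
    fun i j x ⟨T, hx⟩ => hb.existsUnique_isOfType h i j hx⟩
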